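/- Let $k$ be an algebraically closed field of characteristic zero, let $V_1,\dots,V_n$ be nonzero finite-dimensional $k$-vector spaces, $d_i=\dim V_i-1$, let $s_1,\dots,s_n$ be positive integers, and put $A=V_1^{\otimes s_1}\otimes\dots\otimes V_n^{\otimes s_n}$. Let $$X=\{[v_1^{\otimes s_1}\otimes\dots\otimes v_n^{\otimes s_n}] : 0\ne v_i\in V_i\}\subset \mathbb P(S^{s_1}V_1\otimes\dots\otimes S^{s_n}V_n)\subset\mathbb P(A)$$ be the Segre–Veronese variety ($S^{s}V\subset V^{\otimes s}$ denotes the symmetric tensors). Let $\operatorname{Sec}X$ be the Zariski closure of the union of the secant lines $\langle p,q\rangle$, $p,q\in X$ (with $\langle p,p\rangle=\{p\}$), and $\operatorname{Tan}X$ the Zariski closure of the union of the (embedded) tangent lines to $X$ (a zero tangent direction giving the point itself). For a tuple $\varphi=(\varphi_1,\dots,\varphi_n)$ of nonzero linear forms $\varphi_i\in V_i^*$ let $H_\varphi\subset\mathbb P(A)$ be the hyperplane $\varphi_1^{\otimes s_1}\otimes\dots\otimes\varphi_n^{\otimes s_n}=0$. Let $M$ be the lattice with basis $\chi^i_j$ $(1\le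 i\le n,\ 1\le j\le d_i)$, and let $P\subset M\otimes\mathbb Q$ be the polytope of all $a=\sum a^i_j\chi^i_j$ with $a^i_j\ge 0$ for all $i,j$, $\sum_j a^i_j\le s_i$ for all $i$, and $\sum_{i,j}a^i_j\ge 2$. Let $T$ be the torus with character lattice $M$, let $X_P$ be the closure in projective space of the image of $T$ under $t\mapsto[\chi^m(t)]_{m\in P\cap M}$, and $X'_P$ the closure in affine space of the image of $T$ under $t\mapsto(\chi^m(t))_{m\in P\cap M}$. (If $P\cap M=\emptyset$, then $X_P=\emptyset$, and its affine cone and $X'_P$ are a point.) An affine toric variety is an affine variety (not necessarily normal) containing a torus as an open dense subset whose multiplication extends to an action on the variety; it has no torus factors if it is not isomorphic to a product $Y\times\mathbb G_m$; it is nondegenerate if its only invertible regular functions are the constants. Then: 1. There are finitely many tuples $\varphi$ as above such that the complements $\operatorname{Sec}X\setminus H_\varphi$ cover $\operatorname{Sec}X$ and the complements $\operatorname{Tan}X\setminus H_\varphi$ cover $\operatorname{Tan}X$. 2. For every $\varphi$, $\operatorname{Sec}X\setminus H_\varphi$ is a normal affine toric variety without torus factors, isomorphic to $\mathbb A^{N}\times\operatorname{AffCone}(X_P)$,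 where $N=d_1+\dots+d_n$. 3. For every $\varphi$, $\operatorname{Tan}X\setminus H_\varphi$ is an affine toric variety without torus factors, isomorphic to $\mathbb A^{N}\times X'_P$, where $X'_P$ is a nondegenerate affine toric variety; it is normal if $s_1=\dots=s_n=1$. -/

import Mathlib

open scoped TensorProduct LinearAlgebra.Projectivization

universe u v

noncomputable section

namespace SegreVeronese

/-! ### Zariski closures, coordinate rings and charts

Varieties are sets of points over a field `k` (algebraically closed in the application).
A polynomial on a vector space `W` is written as a polynomial in the linear forms on `W`. -/

section Geometry

variable {k : Type u} [Field k] {W : Type v} [AddCommGroup W] [Module k W]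

/-- The value at `a : W` of a polynomial in the linear forms on `W`. -/
def polyEval (a : W) (f : MvPolynomial (Module.Dual k W) k) : k :=
  MvPolynomial.eval (fun ℓ : Module.Dual k W => ℓ a) f

/-- Zariski closure of a subset of the affine space `W`. -/
def affineClosure (k : Type u) [Field k] {W : Type v} [AddCommGroup W] [Module k W]
    (S : Set W) : Set W :=
  {a | ∀ f : MvPolynomial (Module.Dual k W) k, (∀ b ∈ S, polyEval b f = 0) → polyEval a f = 0}

/-- The homogeneous polynomial `f` vanishes on the subset `S` of `ℙ(W)`. -/
def VanishesOn (f : MvPolynomial (Module.Dual k W) k) (S : Set (ℙ k W)) : Prop :=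
  ∀ y ∈ S, polyEval y.rep f = 0

/-- Zariski closure of a subset of the projective space `ℙ(W)`. -/
def projClosure (S : Set (ℙ k W)) : Set (ℙ k W) :=
  {x | ∀ (m : ℕ) (f : MvPolynomial (Module.Dual k W) k), f.IsHomogeneous m →
    VanishesOn f S → polyEval x.rep f = 0}

/-- The affine cone over a subset of `ℙ(W)`, with its vertex `0`. -/
def affineCone (Y : Set (ℙ k W)) : Set W :=
  {a | ∀ h : a ≠ 0, Projectivization.mk k a h ∈ Y}

/-- The ring of regular functions of a Zariski closed subset `Z` of the affine space `W`: the
functions on `Z` that are polynomials in linear forms. -/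
def coordRing (k : Type u) [Field k] {W : Type v} [AddCommGroup W] [Module k W]
    (Z : Set W) : Subalgebra k (Z → k) :=
  Algebra.adjoin k (Set.range fun ℓ : Module.Dual k W => fun z : Z => ℓ z)

/-- The complement, in a subset `Y` of `ℙ(W)`, of the hyperplane section `{ℓ = 0}`. -/
def hyperplaneCompl (Y : Set (ℙ k W)) (ℓ : Module.Dual k W) : Set (ℙ k W) :=
  {x | x ∈ Y ∧ ℓ x.rep ≠ 0}

/-- The ring of regular functions of the complement, in a Zariski closed subset `Y` of `ℙ(W)`, of
the hyperplane section `{ℓ = 0}`: the functions that are polynomials in the quotients `ℓ' / ℓ` of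
linear forms. -/
def chartRing (Y : Set (ℙ k W)) (ℓ : Module.Dual k W) : Subalgebra k (hyperplaneCompl Y ℓ → k) :=
  Algebra.adjoin k (Set.range fun ℓ' : Module.Dual k W =>
    fun x : hyperplaneCompl Y ℓ => ℓ' x.1.rep / ℓ x.1.rep)

/-! ### Secant and tangential varieties -/

/-- The secant variety: the Zariski closure of the union of the lines spanned by two points of `X`
(the span of a point with itself is that point). -/
def secantVariety (X : Set (ℙ k W)) : Set (ℙ k W) :=
  projClosure {x | ∃ p ∈ X, ∃ q ∈ X, x.submodule ≤ p.submodule ⊔ q.submodule}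

/-- `w : W` is a tangent vector of the affine cone over `X` at the chosen representative of `p`:
`f(p + ε w) = 0` in the dual numbers for every homogeneous `f` in the ideal of `X`. -/
def IsTangentVector (X : Set (ℙ k W)) (p : ℙ k W) (w : W) : Prop :=
  ∀ (m : ℕ) (f : MvPolynomial (Module.Dual k W) k), f.IsHomogeneous m → VanishesOn f X →
    MvPolynomial.aeval (fun ℓ : Module.Dual k W =>
      (TrivSqZeroExt.inl (ℓ p.rep) + TrivSqZeroExt.inr (ℓ w) : DualNumber k)) f = 0

/-- The tangential variety: the Zariski closure of the union of the tangent lines to `X`, that is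
of the lines through a point `p` of `X` in the direction of a tangent vector at `p`. -/
def tangentialVariety (X : Set (ℙ k W)) : Set (ℙ k W) :=
  projClosure {x | ∃ p ∈ X, ∃ w : W, IsTangentVector X p w ∧
    x.submodule ≤ Submodule.span k {p.rep, w}}

end Geometry

/-! ### Segre–Veronese varieties -/

section SegreVeronese

variable (k : Type u) [Field k] {n : ℕ} (V : Fin n → Type u) [∀ i, AddCommGroup (V i)]
  [∀ i, Module k (V i)] (s : Fin n → ℕ)

/-- The space `A = V₁^{⊗ s₁} ⊗ ⋯ ⊗ Vₙ^{⊗ sₙ}`. -/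
abbrev Ambient : Type u := ⨂[k] p : (Σ i : Fin n, Fin (s i)), V p.1

/-- The Segre–Veronese variety: the image of `ℙ(V₁) × ⋯ × ℙ(Vₙ)` in `ℙ(A)` under
`([v₁], …, [vₙ]) ↦ [v₁^{⊗ s₁} ⊗ ⋯ ⊗ vₙ^{⊗ sₙ}]`. It lies in the subspace of `ℙ(A)` given by
`S^{s₁} V₁ ⊗ ⋯ ⊗ S^{sₙ} Vₙ`, the tensors that are symmetric in each group of factors. -/
def segreVeronese : Set (ℙ k (Ambient k V s)) :=
  {x | ∃ v : ∀ i, V i, (∀ i, v i ≠ 0) ∧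
    x.submodule = Submodule.span k {PiTensorProduct.tprod k fun p : (Σ i, Fin (s i)) => v p.1}}

variable {k V}

/-- The linear form `φ₁^{⊗ s₁} ⊗ ⋯ ⊗ φₙ^{⊗ sₙ}` on `A`. If `φᵢ` is the coordinate dual to the first
vector of a basis of `Vᵢ`, this is the coordinate of `A` dual to the first basis tensor. -/
def powerForm (φ : ∀ i, Module.Dual k (V i)) : Module.Dual k (Ambient k V s) :=
  PiTensorProduct.dualDistrib (PiTensorProduct.tprod k fun p : (Σ i, Fin (s i)) => φ p.1)

end SegreVeronese

/-! ### The polytope `P` and its toric varieties -/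

section Polytope

variable {n : ℕ} (d s : Fin n → ℕ)

/-- The polytope `P` in `M ⊗ ℚ`, where `M` is the lattice with basis `χ^i_j`, `1 ≤ j ≤ dᵢ`. -/
def polytope : Set ((Σ i : Fin n, Fin (d i)) → ℚ) :=
  {a | (∀ q, 0 ≤ a q) ∧ (∀ i, ∑ j, a ⟨i, j⟩ ≤ s i) ∧ 2 ≤ ∑ q, a q}

/-- The set `P ∩ M` of lattice points of `P`. -/
abbrev LatticePoint : Type :=
  {m : (Σ i : Fin n, Fin (d i)) → ℤ // (fun q => (m q : ℚ)) ∈ polytope d s}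

variable (k : Type u) [Field k]

/-- The point `(χ^m(t))_{m ∈ P ∩ M}` for `t` in the torus with character lattice `M`. -/
def torusPoint (t : (Σ i : Fin n, Fin (d i)) → kˣ) : LatticePoint d s → k :=
  fun m => ((∏ q, t q ^ m.1 q : kˣ) : k)

/-- The projective toric variety `X_P`: the closure in projective space of the image of the torus
under the characters in `P ∩ M`. -/
def projToric : Set (ℙ k (LatticePoint d s → k)) :=
  projClosure {x | ∃ t, x.submodule = Submodule.span k {torusPoint d s k t}}

/-- The affine toric variety `X'_P`: the closure in affine space of the image of the torus under
the characters in `P ∩ M`. -/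
def affineToric : Set (LatticePoint d s → k) :=
  affineClosure k (Set.range (torusPoint d s k))

end Polytope

/-! ### Affine toric varieties, through their rings of regular functions -/

section Toric

variable (k : Type u) [Field k] (R : Type u) [CommRing R] [Algebra k R]

/-- `Spec R` is an affine toric variety over `k`: an affine variety that contains a torus
`T = Spec k[ℤ^r]` as an open (hence dense) subset such that the multiplication of `T` extends to an
action of `T` on the variety. Normality is not required. -/
def IsAffineToric : Prop :=
  IsDomain R ∧ Algebra.FiniteType k R ∧
  ∃ (r : ℕ) (j : R →ₐ[k] AddMonoidAlgebra k (Fin r → ℤ))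
    (δ : R →ₐ[k] AddMonoidAlgebra k (Fin r → ℤ) ⊗[k] R),
    -- the inclusion of the torus is an open immersion
    AlgebraicGeometry.IsOpenImmersion
      (AlgebraicGeometry.Spec.map (CommRingCat.ofHom j.toRingHom)) ∧
    -- `δ` is an action: the unit acts trivially, and the action is associative
    (∀ a : R, Algebra.TensorProduct.lid k R (Algebra.TensorProduct.map
      (Bialgebra.counitAlgHom k (AddMonoidAlgebra k (Fin r → ℤ))) (AlgHom.id k R) (δ a)) = a) ∧
    (∀ a : R, Algebra.TensorProduct.assoc k k k _ _ _ (Algebra.TensorProduct.map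
      (Bialgebra.comulAlgHom k (AddMonoidAlgebra k (Fin r → ℤ))) (AlgHom.id k R) (δ a)) =
        Algebra.TensorProduct.map (AlgHom.id k _) δ (δ a)) ∧
    -- `δ` extends the multiplication of the torus
    (∀ a : R, Algebra.TensorProduct.map (AlgHom.id k _) j (δ a) =
      Bialgebra.comulAlgHom k (AddMonoidAlgebra k (Fin r → ℤ)) (j a))

/-- `Spec R` has a torus factor: it is isomorphic to `Y × 𝔾ₘ` for some affine scheme `Y` over
`k`. -/
def HasTorusFactor : Prop :=
  ∃ (R' : Type u) (_ : CommRing R') (_ : Algebra k R'),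
    Nonempty (R ≃ₐ[k] LaurentPolynomial R')

/-- Nondegeneracy of an affine toric variety: every invertible regular function is constant. -/
def IsNondegenerate : Prop :=
  ∀ a : R, IsUnit a → ∃ c : k, a = algebraMap k R c

end Toric

end SegreVeronese

end

/-! Choose bases in which each `φ i` is the first coordinate. The chart of `X` is then an affine
space with coordinates `x`, and the coordinates of its points in `A` are the monomials `mon x c`. A
point `α v(x) + (1 - α) v(y)` of a secant line has as coordinates the moments of the distribution
with mass `α` at `x` and `1 - α` at `y`, so changes of generators familiar from statistics apply.
Moments are triangular in the means `μ` and the central moments (`adjoin_moments_eq`). With `z = x -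
y`, the central moment of exponent `m` and degree `r` is `κ r * z^m`, where `κ (r + 2) = C * κ (r +
1) + q * κ r`, `C = 1 - 2α`, `q = α(1 - α)`. This recurrence gives a second triangular change
(`central_moment_sub_mem`), after which the generators are `q C^(r-2) z^m = T u^m` with `T = q / C²`
and `u = C z`. The functions `μ`, `T`, `u` are algebraically independent, and the exponents `m` that
occur are exactly the lattice points of `P`. The chart ring is thus generated by the variables `μ`
and the `T u^m`: it is the ring of affine space times the cone over `X_P`
(`nonempty_secant_chart_equiv`).

For the tangential variety, the dual number `x + ε y` and the functional `a + bε ↦ a + b` replace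
the distribution. The centered variable is now `(ε - 1) y`, and `κ r = (-1)^r (1 - r)` is a
constant, nonzero for `r ≥ 2` in characteristic zero. Hence the generators are `μ` and `z^m`,
without the factor `T`, which gives `X'_P` instead of a cone (`nonempty_tangent_chart_equiv`). That
all tangent vectors come from the parametrization is read off from linear and quadratic equations of
`X` (`exists_eq_derivTensor`).

Both chart rings are therefore algebras generated by finitely many monomials in a polynomial ring.
Such an algebra is toric (`isAffineToric_of_monomialAlgebra`), and its units are constants because
it sits in a polynomial ring, so there is no torus factor. It is normal as soon as its exponents are
cut out by linear inequalities (`isIntegrallyClosed_monomialAlgebra`). These inequalities come from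
the integer decomposition property of `P` (`exists_latticeExp_add`).

Finally, the points of both varieties are symmetric tensors, and in characteristic zero a nonzero
symmetric tensor is not annihilated by all products of powers of linear forms
(`eq_zero_of_powerForm_eq_zero`). Finitely many such forms span the rest, which gives the finite
cover. -/

noncomputable section

namespace SegreVeronese

/-! ### Monoid algebras as affine toric varieties -/

section MonoidAlgebra

variable {k : Type u} [Field k]

/-- In a finitely generated commutative monoid some element is a multiple of the sum of the
generators, up to any given summand. -/
lemma exists_dominating (S : Type*) [AddCommMonoid S] (hfg : AddMonoid.FG S) :
    ∃ g : S, ∀ b : S, ∃ (N : ℕ) (b' : S), b + b' = N • g := by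
  classical
  obtain ⟨G, hG⟩ := hfg.fg_top
  refine ⟨∑ x ∈ G, x, fun b => ?_⟩
  have hb : b ∈ AddSubmonoid.closure (G : Set S) := hG ▸ AddSubmonoid.mem_top b
  induction hb using AddSubmonoid.closure_induction with
  | mem x hx => exact ⟨1, ∑ y ∈ G.erase x, y, by
      rw [one_smul]; exact Finset.add_sum_erase G (fun y => y) hx⟩
  | zero => exact ⟨0, 0, by simp⟩
  | add x y _ _ hx hy =>
    obtain ⟨N, x', hx⟩ := hx
    obtain ⟨M, y', hy⟩ := hy
    exact ⟨N + M, x' + y', by rw [add_smul, ← hx, ← hy]; abel⟩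

/-- The group algebra of the group generated by a finitely generated monoid `S` is a localization
of the monoid algebra of `S` at one monomial. -/
lemma exists_isLocalization_away {S : Type*} [AddCommMonoid S] (hfg : AddMonoid.FG S)
    {H : Type*} [AddCommGroup H] (ι : S →+ H)
    (hcl : AddSubgroup.closure (Set.range ι) = ⊤) :
    ∃ g : AddMonoidAlgebra k S,
      IsUnit (AddMonoidAlgebra.mapDomainAlgHom k k ι g) ∧
      ∀ f : AddMonoidAlgebra k H, ∃ (N : ℕ) (a : AddMonoidAlgebra k S),
        f * AddMonoidAlgebra.mapDomainAlgHom k k ι g ^ N =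
          AddMonoidAlgebra.mapDomainAlgHom k k ι a := by
  obtain ⟨g, hg⟩ := exists_dominating S hfg
  have key : ∀ x : H, ∃ (N : ℕ) (a : S), x + N • ι g = ι a := by
    intro x
    have hx : x ∈ AddSubgroup.closure (Set.range ι) := hcl ▸ AddSubgroup.mem_top x
    induction hx using AddSubgroup.closure_induction with
    | mem x hx => obtain ⟨a, rfl⟩ := hx; exact ⟨0, a, by simp⟩
    | zero => exact ⟨0, 0, by simp⟩
    | add x y _ _ hx hy =>
      obtain ⟨N, a, hx⟩ := hx
      obtain ⟨M, b, hy⟩ := hy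
      exact ⟨N + M, a + b, by rw [map_add, ← hx, ← hy, add_smul]; abel⟩
    -- If `x + N g = a` and `b` completes `a` to `M g`, then `-x + M g = b + N g`.
    | neg x _ hx =>
      obtain ⟨N, a, hx⟩ := hx
      obtain ⟨M, b, hb⟩ := hg a
      refine ⟨M, b + N • g, ?_⟩
      have : ι a + ι b = M • ι g := by rw [← map_add, hb, map_nsmul]
      rw [map_add, map_nsmul, ← this, ← hx]; abel
  refine ⟨AddMonoidAlgebra.single g 1, ?_, fun f => ?_⟩
  · rw [AddMonoidAlgebra.mapDomainAlgHom_apply, AddMonoidAlgebra.mapDomain_single]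
    refine IsUnit.of_mul_eq_one (AddMonoidAlgebra.single (-ι g) 1) ?_
    rw [AddMonoidAlgebra.single_mul_single, add_neg_cancel, one_mul]
    rfl
  · have hpow (N : ℕ) : AddMonoidAlgebra.mapDomainAlgHom k k ι (AddMonoidAlgebra.single g 1) ^ N =
        AddMonoidAlgebra.mapDomainAlgHom k k ι (AddMonoidAlgebra.single (N • g) 1) := by
      rw [← map_pow, AddMonoidAlgebra.single_pow, one_pow]
    induction f using AddMonoidAlgebra.induction_on with
    | of x =>
      obtain ⟨N, a, h⟩ := key x
      refine ⟨N, AddMonoidAlgebra.single a 1, ?_⟩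
      rw [hpow]
      simp only [AddMonoidAlgebra.mapDomainAlgHom_apply, AddMonoidAlgebra.mapDomain_single, ← h]
      simp [AddMonoidAlgebra.of_apply, AddMonoidAlgebra.single_mul_single]
    | add x y hx hy =>
      obtain ⟨N, a, hx⟩ := hx
      obtain ⟨M, b, hy⟩ := hy
      refine ⟨N + M, a * AddMonoidAlgebra.single g 1 ^ M + b * AddMonoidAlgebra.single g 1 ^ N, ?_⟩
      rw [map_add, map_mul, map_mul, map_pow, map_pow, ← hx, ← hy]
      ring
    | smul r x hx =>
      obtain ⟨N, a, hx⟩ := hx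
      exact ⟨N, r • a, by rw [map_smul, ← hx, smul_mul_assoc]⟩

/-- The torus has character lattice `ℤ^r`, and it acts by the grading: the coaction sends the
monomial of `m` to `χ^(ι m) ⊗ χ^m`. All axioms of an action are equalities of algebra homomorphisms,
so they need checking only on monomials. The torus is open because its ring is the localization at
one monomial. -/
theorem isAffineToric_of_monoidAlgebra {S : Type*} [AddCommMonoid S] (hfg : AddMonoid.FG S)
    {r : ℕ} (ι : S →+ (Fin r → ℤ)) (hι : Function.Injective ι)
    (hcl : AddSubgroup.closure (Set.range ι) = ⊤)
    (R : Type u) [CommRing R] [Algebra k R] (e : AddMonoidAlgebra k S ≃ₐ[k] R) :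
    IsAffineToric k R := by
  let j₀ := AddMonoidAlgebra.mapDomainAlgHom k k ι
  have hj₀ : Function.Injective j₀ := AddMonoidAlgebra.mapDomain_injective hι
  let j : R →ₐ[k] AddMonoidAlgebra k (Fin r → ℤ) := j₀.comp e.symm.toAlgHom
  have hj : Function.Injective j := hj₀.comp e.symm.injective
  let δ₀ : AddMonoidAlgebra k S →ₐ[k] AddMonoidAlgebra k (Fin r → ℤ) ⊗[k] R :=
    AddMonoidAlgebra.lift k _ S
      { toFun := fun m => AddMonoidAlgebra.single (ι m.toAdd) 1 ⊗ₜ[k]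
          e (AddMonoidAlgebra.single m.toAdd 1)
        map_one' := by
          simp only [toAdd_one, map_zero, ← AddMonoidAlgebra.one_def, map_one]
          rfl
        map_mul' := fun a b => by
          rw [Algebra.TensorProduct.tmul_mul_tmul, ← map_mul, AddMonoidAlgebra.single_mul_single,
            AddMonoidAlgebra.single_mul_single, one_mul, toAdd_mul, map_add] }
  have hδ₀ (m : S) : δ₀ (AddMonoidAlgebra.single m 1) = AddMonoidAlgebra.single (ι m) 1 ⊗ₜ[k]
      e (AddMonoidAlgebra.single m 1) := by
    simp [δ₀, AddMonoidAlgebra.lift_single]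
  let δ : R →ₐ[k] AddMonoidAlgebra k (Fin r → ℤ) ⊗[k] R := δ₀.comp e.symm.toAlgHom
  have hδ (m : S) : δ (e (AddMonoidAlgebra.single m 1)) = AddMonoidAlgebra.single (ι m) 1 ⊗ₜ[k]
      e (AddMonoidAlgebra.single m 1) := by
    simp [δ, hδ₀]
  have hje (m : S) : j (e (AddMonoidAlgebra.single m 1)) = AddMonoidAlgebra.single (ι m) 1 := by
    simp [j, j₀]
  have ext {C : Type u} [Semiring C] [Algebra k C] (f g : R →ₐ[k] C)
      (h : ∀ m : S, f (e (AddMonoidAlgebra.single m 1)) = g (e (AddMonoidAlgebra.single m 1)))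
      (a : R) : f a = g a := by
    have : f.comp e.toAlgHom = g.comp e.toAlgHom := AddMonoidAlgebra.algHom_ext h (by ext)
    simpa using DFunLike.congr_fun this (e.symm a)
  refine ⟨hj.isDomain j.toRingHom, ?_, r, j, δ, ?_, ?_, ?_, ?_⟩
  · have : Algebra.FiniteType k (AddMonoidAlgebra k S) := inferInstance
    exact this.equiv e
  · obtain ⟨g, hg, hs⟩ := exists_isLocalization_away (k := k) hfg ι hcl
    let _ := j.toRingHom.toAlgebra
    have hj' (a : R) : algebraMap R (AddMonoidAlgebra k (Fin r → ℤ)) a = j a := rfl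
    have hg' : j (e g) = j₀ g := by simp [j]
    have : IsLocalization.Away (e g) (AddMonoidAlgebra k (Fin r → ℤ)) := by
      refine IsLocalization.Away.mk _ (by rwa [hj', hg']) (fun f => ?_) (fun a b h => ⟨0, ?_⟩)
      · obtain ⟨N, a, h⟩ := hs f
        exact ⟨N, e a, by rw [hj', hj', hg', h]; simp [j, j₀]⟩
      · simpa using hj h
    exact AlgebraicGeometry.IsOpenImmersion.of_isLocalization (e g)
  · refine ext ((Algebra.TensorProduct.lid k R).toAlgHom.comp ((Algebra.TensorProduct.map
      (Bialgebra.counitAlgHom k (AddMonoidAlgebra k (Fin r → ℤ))) (AlgHom.id k R)).comp δ))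
      (AlgHom.id k R) fun m => ?_
    simp [hδ]
  · refine ext ((Algebra.TensorProduct.assoc k k k _ _ _).toAlgHom.comp ((Algebra.TensorProduct.map
      (Bialgebra.comulAlgHom k (AddMonoidAlgebra k (Fin r → ℤ))) (AlgHom.id k R)).comp δ))
      ((Algebra.TensorProduct.map (AlgHom.id k _) δ).comp δ) fun m => ?_
    simp [hδ]
  · refine ext ((Algebra.TensorProduct.map (AlgHom.id k _) j).comp δ)
      ((Bialgebra.comulAlgHom k (AddMonoidAlgebra k (Fin r → ℤ))).comp j) fun m => ?_
    simp [hδ, hje]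

end MonoidAlgebra

/-! ### Algebras generated by monomials -/

section MonomialAlgebra

variable (k : Type u) [Field k] {τ : Type} (G : Set (τ →₀ ℕ))

/-- The subalgebra of a polynomial ring generated by the monomials with exponents in `G`. -/
def monomialAlgebra : Subalgebra k (MvPolynomial τ k) :=
  Algebra.adjoin k ((fun m => MvPolynomial.monomial m 1) '' G)

variable {k G}

lemma monomial_mem_monomialAlgebra {m : τ →₀ ℕ} (hm : m ∈ AddSubmonoid.closure G) :
    MvPolynomial.monomial m (1 : k) ∈ monomialAlgebra k G := by
  induction hm using AddSubmonoid.closure_induction with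
  | mem x hx => exact Algebra.subset_adjoin ⟨x, hx, rfl⟩
  | zero => exact one_mem _
  | add x y _ _ hx hy =>
    have := mul_mem hx hy
    rwa [MvPolynomial.monomial_mul, one_mul] at this

lemma mem_monomialAlgebra_of_support {f : MvPolynomial τ k}
    (hf : ∀ m ∈ f.support, m ∈ AddSubmonoid.closure G) : f ∈ monomialAlgebra k G := by
  rw [f.as_sum]
  refine sum_mem fun m hm => ?_
  have := (monomialAlgebra k G).smul_mem (monomial_mem_monomialAlgebra (k := k) (hf m hm))
    (f.coeff m)
  rwa [MvPolynomial.smul_monomial, smul_eq_mul, mul_one] at this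

lemma range_mapDomainAlgHom_closure :
    (AddMonoidAlgebra.mapDomainAlgHom k k (AddSubmonoid.closure G).subtype).range =
      monomialAlgebra k G := by
  apply le_antisymm
  · rintro _ ⟨x, rfl⟩
    induction x using AddMonoidAlgebra.induction_on with
    | of m =>
      have := monomial_mem_monomialAlgebra (k := k) m.2
      simpa [MvPolynomial.monomial] using this
    | add x y hx hy =>
      exact (congrArg (· ∈ monomialAlgebra k G) (map_add _ x y)).mpr (add_mem hx hy)
    | smul r x hx =>
      exact (congrArg (· ∈ monomialAlgebra k G) (map_smul
        (AddMonoidAlgebra.mapDomainAlgHom k k (AddSubmonoid.closure G).subtype) r x)).mpr (Subalgebra.smul_mem _ hx r)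
  · refine Algebra.adjoin_le ?_
    rintro _ ⟨m, hm, rfl⟩
    refine ⟨AddMonoidAlgebra.single ⟨m, AddSubmonoid.subset_closure hm⟩ 1, ?_⟩
    simp [MvPolynomial.monomial]

/-- The monoid algebra of the monoid generated by `G`. -/
def monoidAlgebraEquiv :
    AddMonoidAlgebra k (AddSubmonoid.closure G) ≃ₐ[k] monomialAlgebra k G :=
  (AlgEquiv.ofInjective (AddMonoidAlgebra.mapDomainAlgHom k k (AddSubmonoid.closure G).subtype)
    (AddMonoidAlgebra.mapDomain_injective Subtype.val_injective)).trans
    (Subalgebra.equivOfEq _ _ range_mapDomainAlgHom_closure)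

/-- The exponents may generate a proper subgroup of `ℤ^τ`, so the character lattice has to be that
subgroup. It is free of finite rank, and a basis identifies it with `ℤ^r`. -/
theorem isAffineToric_of_monomialAlgebra [Finite τ] (hG : G.Finite) {R : Type u} [CommRing R]
    [Algebra k R] (e : monomialAlgebra k G ≃ₐ[k] R) : IsAffineToric k R := by
  let S := AddSubmonoid.closure G
  let f : S →+ (τ → ℤ) :=
    { toFun := fun m q => (m.1 q : ℤ)
      map_zero' := by ext; simp
      map_add' := fun a b => by ext; simp }
  have hf : Function.Injective f := fun a b h => by
    ext q; simpa [f] using congrFun h q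
  let H := Submodule.span ℤ (Set.range f)
  let b := Module.finBasis ℤ H
  let f' : S →+ H := f.codRestrict H.toAddSubgroup fun m => Submodule.subset_span ⟨m, rfl⟩
  let ι : S →+ (Fin (Module.finrank ℤ H) → ℤ) := b.equivFun.toAddEquiv.toAddMonoidHom.comp f'
  refine isAffineToric_of_monoidAlgebra (S := S) ?_ ι ?_ ?_ R (monoidAlgebraEquiv.trans e)
  · exact (AddMonoid.fg_iff_addSubmonoid_fg _).2 ⟨hG.toFinset, by simp [S]⟩
  · intro x y h
    exact hf (congrArg Subtype.val (b.equivFun.injective h))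
  · have h1 : Submodule.span ℤ (Set.range f') = ⊤ := by
      have : Set.range f' = Subtype.val ⁻¹' (Set.range f) := by
        ext x
        simp only [Set.mem_range, Set.mem_preimage, f', Subtype.ext_iff]
        rfl
      rw [this]
      exact Submodule.span_span_coe_preimage
    have h2 : Submodule.span ℤ (Set.range ι) = ⊤ := by
      have : Set.range ι = b.equivFun.toLinearMap '' Set.range f' := by
        rw [← Set.range_comp]; rfl
      rw [this, Submodule.span_image, h1, Submodule.map_top, LinearEquiv.range]
    rw [← Submodule.span_int_eq_addSubgroupClosure, h2]
    rfl

/-! ### Units and torus factors -/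

/-- A ring that embeds in a polynomial ring has only constant units. -/
theorem isNondegenerate_of_injective {τ : Type*} {R : Type u} [CommRing R] [Algebra k R]
    (f : R →ₐ[k] MvPolynomial τ k) (hf : Function.Injective f) : IsNondegenerate k R := by
  intro a ha
  obtain ⟨c, -, hc⟩ := MvPolynomial.isUnit_iff_eq_C_of_isReduced.1 (ha.map f)
  exact ⟨c, hf (by rw [hc, AlgHom.commutes]; rfl)⟩

/-- The Laurent variable is a unit, and comparing coefficients in degree one shows that it is not a
constant. -/
theorem not_hasTorusFactor {R : Type u} [CommRing R] [Nontrivial R] [Algebra k R]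
    (h : IsNondegenerate k R) : ¬ HasTorusFactor k R := by
  rintro ⟨R', _, _, ⟨e⟩⟩
  have : Nontrivial R' := by
    by_contra hn
    rw [not_nontrivial_iff_subsingleton] at hn
    have : Subsingleton (LaurentPolynomial R') :=
      subsingleton_of_zero_eq_one (by
        rw [← map_zero (LaurentPolynomial.C (R := R')), ← map_one (LaurentPolynomial.C (R := R')),
          Subsingleton.elim (0 : R') 1])
    exact not_subsingleton R e.injective.subsingleton
  obtain ⟨c, hc⟩ := h (e.symm (LaurentPolynomial.T 1))
    ((LaurentPolynomial.isUnit_T 1).map e.symm)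
  have h2 : LaurentPolynomial.T 1 = algebraMap k (LaurentPolynomial R') c := by
    rw [← e.commutes, ← hc, e.apply_symm_apply]
  have h3 : (LaurentPolynomial.T 1 : LaurentPolynomial R') =
      LaurentPolynomial.C (algebraMap k R' c) := by
    rw [h2]; rfl
  have h4 := congrArg (fun f : LaurentPolynomial R' => f.coeff 1) h3
  rw [LaurentPolynomial.T, ← LaurentPolynomial.single_eq_C] at h4
  simp [-LaurentPolynomial.single_eq_C_mul_T] at h4

/-! ### Normality of monomial algebras by means of weights -/

/-- An integrally closed domain is integrally closed in its localizations. -/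
lemma exists_algebraMap_eq_of_isIntegral_localization {A L : Type*} [CommRing A] [IsDomain A]
    [IsIntegrallyClosed A] [CommRing L] [Algebra A L] (M : Submonoid A)
    (hM : M ≤ nonZeroDivisors A) [IsLocalization M L] {x : L} (hx : IsIntegral A x) :
    ∃ a : A, algebraMap A L a = x := by
  let K := FractionRing A
  have hu : ∀ y : M, IsUnit (algebraMap A K y) := fun y =>
    IsLocalization.map_units K (⟨y, hM y.2⟩ : nonZeroDivisors A)
  let f : L →ₐ[A] K := { IsLocalization.lift (S := L) hu with
    commutes' := fun a => IsLocalization.lift_eq hu a }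
  have hf : Function.Injective f := (IsLocalization.lift_injective_iff hu).2 fun a b => by
    rw [(IsLocalization.injective L hM).eq_iff, (IsFractionRing.injective A K).eq_iff]
  obtain ⟨a, ha⟩ := IsIntegrallyClosed.algebraMap_eq_of_integral (hx.map f)
  exact ⟨a, hf (by rw [AlgHom.commutes, ha])⟩

/-- The homomorphism that multiplies each monomial of weight `d` by `T ^ d`. -/
def weightHom (w : (τ →₀ ℕ) →+ ℤ) :
    MvPolynomial τ k →+* LaurentPolynomial (MvPolynomial τ k) :=
  MvPolynomial.eval₂Hom (LaurentPolynomial.C.comp MvPolynomial.C) fun q =>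
    LaurentPolynomial.C (MvPolynomial.X q) * LaurentPolynomial.T (w (Finsupp.single q 1))

lemma weightHom_monomial (w : (τ →₀ ℕ) →+ ℤ) (m : τ →₀ ℕ) (c : k) :
    weightHom w (MvPolynomial.monomial m c) =
      LaurentPolynomial.C (MvPolynomial.monomial m c) * LaurentPolynomial.T (w m) := by
  induction m using Finsupp.induction_linear generalizing c with
  | zero =>
    rw [map_zero, LaurentPolynomial.T_zero, mul_one, ← MvPolynomial.C_apply, weightHom]
    exact MvPolynomial.eval₂Hom_C _ _ c
  | add m m' hm hm' =>
    rw [← mul_one c, ← MvPolynomial.monomial_mul, map_mul, hm, hm', map_mul, map_add,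
      LaurentPolynomial.T_add]
    ring
  | single q n =>
    have hX : MvPolynomial.monomial (Finsupp.single q n) c =
        MvPolynomial.C c * MvPolynomial.X q ^ n :=
      (MvPolynomial.C_mul_X_pow_eq_monomial).symm
    have hw : w (Finsupp.single q n) = n * w (Finsupp.single q 1) := by
      rw [← nsmul_eq_mul, ← map_nsmul, Finsupp.smul_single, smul_eq_mul, mul_one]
    rw [hX, hw, map_mul, map_pow, map_mul, map_pow, ← LaurentPolynomial.T_pow, mul_assoc, ← mul_pow,
      weightHom, MvPolynomial.eval₂Hom_C, MvPolynomial.eval₂Hom_X']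
    rfl

lemma weightHom_apply (w : (τ →₀ ℕ) →+ ℤ) (f : MvPolynomial τ k) :
    weightHom w f = ∑ m ∈ f.support,
      AddMonoidAlgebra.single (w m) (MvPolynomial.monomial m (f.coeff m)) := by
  conv_lhs => rw [f.as_sum]
  rw [map_sum]
  refine Finset.sum_congr rfl fun m _ => ?_
  rw [weightHom_monomial, LaurentPolynomial.single_eq_C_mul_T]

lemma coeff_weightHom (w : (τ →₀ ℕ) →+ ℤ) (f : MvPolynomial τ k) (m : τ →₀ ℕ) :
    ((weightHom w f).coeff (w m)).coeff m = f.coeff m := by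
  classical
  rw [weightHom_apply, AddMonoidAlgebra.coeff_sum, Finsupp.finsetSum_apply, MvPolynomial.coeff_sum,
    Finset.sum_eq_single m]
  · rw [AddMonoidAlgebra.coeff_single, Finsupp.single_eq_same, MvPolynomial.coeff_monomial,
      if_pos rfl]
  · intro m' _ hm'
    rw [AddMonoidAlgebra.coeff_single, Finsupp.single_apply]
    split_ifs
    · rw [MvPolynomial.coeff_monomial, if_neg hm']
    · exact MvPolynomial.coeff_zero m
  · intro h
    rw [AddMonoidAlgebra.coeff_single, Finsupp.single_eq_same, MvPolynomial.coeff_monomial,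
      if_pos rfl]
    exact MvPolynomial.notMem_support_iff.1 h

/-- No homomorphism `A → C` is needed: the image under `F` of the monic equation has coefficients
that lift to `C`, and the lift can be taken monic. -/
lemma isIntegral_of_map {A B C D : Type*} [CommRing A] [CommRing B] [CommRing C] [CommRing D]
    [Algebra A B] [Algebra C D] (F : B →+* D)
    (hF : ∀ a : A, F (algebraMap A B a) ∈ (algebraMap C D).range) {x : B} (hx : IsIntegral A x) :
    IsIntegral C (F x) := by
  obtain ⟨p, hp, hpx⟩ := hx
  have h1 : Polynomial.eval (F x) (p.map (F.comp (algebraMap A B))) = 0 := by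
    rw [Polynomial.eval_map, ← Polynomial.hom_eval₂, hpx, map_zero]
  obtain ⟨q, hq, -, hqm⟩ := Polynomial.lifts_and_natDegree_eq_and_monic (f := algebraMap C D)
    (p := p.map (F.comp (algebraMap A B)))
    ((Polynomial.lifts_iff_coeff_lifts _).2 fun n => by
      rw [Polynomial.coeff_map]; exact hF _) (hp.map _)
  exact ⟨q, hqm, by rw [← Polynomial.eval_map, hq, h1]⟩

/-- A polynomial that is integral over an algebra spanned by monomials of nonnegative weight has
only monomials of nonnegative weight. -/
lemma weight_nonneg_of_isIntegral (w : (τ →₀ ℕ) →+ ℤ) (B : Subalgebra k (MvPolynomial τ k))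
    (hB : ∀ f ∈ B, ∀ m ∈ f.support, 0 ≤ w m) {f : MvPolynomial τ k} (hf : IsIntegral B f)
    {m : τ →₀ ℕ} (hm : m ∈ f.support) : 0 ≤ w m := by
  have hpos : ∀ b : B, weightHom w (algebraMap B (MvPolynomial τ k) b) ∈
      (algebraMap (Polynomial (MvPolynomial τ k)) (LaurentPolynomial (MvPolynomial τ k))).range := by
    rintro ⟨f, hf⟩
    rw [Subalgebra.algebraMap_apply, weightHom_apply]
    refine sum_mem fun m hm => ?_
    obtain ⟨n, hn⟩ := Int.eq_ofNat_of_zero_le (hB f hf m hm)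
    refine ⟨Polynomial.monomial n (MvPolynomial.monomial m (f.coeff m)), ?_⟩
    rw [hn, LaurentPolynomial.single_eq_C_mul_T, ← Polynomial.C_mul_X_pow_eq_monomial,
      LaurentPolynomial.algebraMap_eq_toLaurent]
    simp
  -- The image of `f` is integral over the polynomials in `T`, hence is such a polynomial: no
  -- negative power of `T`, that is no negative weight, occurs.
  obtain ⟨q, hq⟩ := exists_algebraMap_eq_of_isIntegral_localization
    (Submonoid.powers (Polynomial.X : Polynomial (MvPolynomial τ k)))
    (powers_le_nonZeroDivisors_of_noZeroDivisors Polynomial.X_ne_zero)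
    (isIntegral_of_map (weightHom w) hpos hf)
  by_contra hneg
  have h0 : (weightHom w f).coeff (w m) = 0 := by
    rw [← hq, LaurentPolynomial.algebraMap_eq_toLaurent, LaurentPolynomial.coeff_toLaurent]
    refine Finsupp.mapDomain_of_notMem_range _ _ ?_
    rintro ⟨n, hn⟩
    exact hneg (hn ▸ Int.natCast_nonneg n)
  have h1 := coeff_weightHom w f m
  rw [h0, MvPolynomial.coeff_zero] at h1
  exact MvPolynomial.mem_support_iff.1 hm h1.symm

lemma mem_closure_of_mem_monomialAlgebra {f : MvPolynomial τ k} (hf : f ∈ monomialAlgebra k G)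
    {m : τ →₀ ℕ} (hm : m ∈ f.support) : m ∈ AddSubmonoid.closure G := by
  classical
  induction hf using Algebra.adjoin_induction generalizing m with
  | mem x hx =>
    obtain ⟨m', hm', rfl⟩ := hx
    rw [Finset.mem_singleton.1 (MvPolynomial.support_monomial_subset hm)]
    exact AddSubmonoid.subset_closure hm'
  | algebraMap r =>
    rw [Finset.mem_singleton.1 (MvPolynomial.support_monomial_subset hm)]
    exact zero_mem _
  | add x y _ _ hx hy =>
    rcases Finset.mem_union.1 (MvPolynomial.support_add hm) with h | h
    exacts [hx h, hy h]
  | mul x y _ _ hx hy =>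
    obtain ⟨a, ha, b, hb, rfl⟩ := Finset.mem_add.1 (MvPolynomial.support_mul x y hm)
    exact add_mem (hx ha) (hy hb)

/-- An integral element of the fraction field lies in the ambient polynomial ring, which is normal.
Each weight is then nonnegative on its support, so all its exponents lie in the monoid. -/
theorem isIntegrallyClosed_monomialAlgebra {ι : Type*} (w : ι → (τ →₀ ℕ) →+ ℤ)
    (hw : ∀ m, m ∈ AddSubmonoid.closure G ↔ ∀ i, 0 ≤ w i m) :
    IsIntegrallyClosed (monomialAlgebra k G) := by
  let B := monomialAlgebra k G
  let P := MvPolynomial τ k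
  let K := FractionRing B
  let L := FractionRing P
  have hB : ∀ i, ∀ f ∈ B, ∀ m ∈ f.support, 0 ≤ w i m := fun i f hf m hm =>
    (hw m).1 (mem_closure_of_mem_monomialAlgebra hf hm) i
  rw [isIntegrallyClosed_iff K]
  intro x hx
  have hinj : Function.Injective ((algebraMap P L).comp (algebraMap B P)) :=
    (IsFractionRing.injective P L).comp Subtype.val_injective
  let F : K →+* L := IsFractionRing.lift hinj
  have hF (b : B) : F (algebraMap B K b) = algebraMap P L b := IsFractionRing.lift_algebraMap hinj b
  let F' : K →ₐ[B] L := { F with commutes' := fun b => hF b }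
  have hFx : IsIntegral B (F x) := hx.map F'
  obtain ⟨g, hg⟩ := IsIntegrallyClosed.algebraMap_eq_of_integral (R := P) (hFx.tower_top)
  have hgi : IsIntegral B g := by
    rw [← hg] at hFx
    exact (isIntegral_algebraMap_iff (IsFractionRing.injective P L)).1 hFx
  have hgB : g ∈ B := mem_monomialAlgebra_of_support fun m hm =>
    (hw m).2 fun i => weight_nonneg_of_isIntegral (w i) B (hB i) hgi hm
  exact ⟨⟨g, hgB⟩, F.injective (by rw [hF, hg])⟩

end MonomialAlgebra

/-! ### Algebras of functions -/

section Functions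

variable {k : Type u} [Field k]

/-- Two families with the same polynomial relations generate isomorphic algebras. -/
lemma nonempty_adjoin_equiv {I A B : Type*} [CommRing A] [Algebra k A] [CommRing B] [Algebra k B]
    (f : I → A) (g : I → B)
    (h : ∀ F : MvPolynomial I k, MvPolynomial.aeval f F = 0 ↔ MvPolynomial.aeval g F = 0) :
    Nonempty (Algebra.adjoin k (Set.range f) ≃ₐ[k] Algebra.adjoin k (Set.range g)) := by
  have hker : RingHom.ker (MvPolynomial.aeval (R := k) f).rangeRestrict =
      RingHom.ker (MvPolynomial.aeval (R := k) g).rangeRestrict := by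
    ext F
    simpa [RingHom.mem_ker, Subtype.ext_iff] using h F
  exact ⟨(Subalgebra.equivOfEq _ _ (Algebra.adjoin_range_eq_range_aeval k f)).trans
    ((Ideal.quotientKerAlgEquivOfSurjective (AlgHom.rangeRestrict_surjective _)).symm.trans
    ((Ideal.quotientEquivAlgOfEq k hker).trans
    ((Ideal.quotientKerAlgEquivOfSurjective (AlgHom.rangeRestrict_surjective _)).trans
    (Subalgebra.equivOfEq _ _ (Algebra.adjoin_range_eq_range_aeval k g).symm))))⟩

lemma aeval_fun_apply {I Θ : Type*} (f : I → Θ → k) (F : MvPolynomial I k) (θ : Θ) :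
    MvPolynomial.aeval f F θ = MvPolynomial.eval (fun i => f i θ) F := by
  have : (Pi.evalAlgHom k (fun _ : Θ => k) θ).comp (MvPolynomial.aeval f) =
      MvPolynomial.aeval fun i => f i θ := by
    ext i; simp
  exact DFunLike.congr_fun this F

/-- Monomial functions on a set with Zariski dense image in an affine space generate the
corresponding algebra of monomials. -/
lemma nonempty_monomialAlgebra_equiv {τ : Type} {I Θ : Type*} (ρ : Θ → τ → k)
    (hρ : ∀ P : MvPolynomial τ k, (∀ θ, MvPolynomial.eval (ρ θ) P = 0) → P = 0)
    (G : I → τ →₀ ℕ) :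
    Nonempty (monomialAlgebra k (Set.range G) ≃ₐ[k] Algebra.adjoin k (Set.range
      fun i (θ : Θ) => MvPolynomial.eval (ρ θ) (MvPolynomial.monomial (G i) 1))) := by
  rw [monomialAlgebra, ← Set.range_comp]
  refine nonempty_adjoin_equiv _ _ fun F => ?_
  have key (θ : Θ) : MvPolynomial.aeval (fun i (θ : Θ) =>
      MvPolynomial.eval (ρ θ) (MvPolynomial.monomial (G i) 1)) F θ =
      MvPolynomial.eval (ρ θ) (MvPolynomial.aeval
        ((fun m => MvPolynomial.monomial m (1 : k)) ∘ G) F) := by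
    rw [aeval_fun_apply]
    have : MvPolynomial.eval (fun i => MvPolynomial.eval (ρ θ) (MvPolynomial.monomial (G i) 1)) =
      (MvPolynomial.eval (ρ θ)).comp (MvPolynomial.aeval
        ((fun m => MvPolynomial.monomial m (1 : k)) ∘ G)).toRingHom := by
      ext i <;> simp
    exact DFunLike.congr_fun this F
  constructor
  · intro h
    ext θ
    rw [key, h, map_zero]; rfl
  · intro h
    exact hρ _ fun θ => by rw [← key, h]; rfl

/-- A family that differs from `g` by a triangular change of generators generates the same
algebra. -/
lemma adjoin_eq_of_triangular {C B : Type*} [CommRing B] [Algebra k B] (f g : C → B) (deg : C → ℕ)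
    (h : ∀ c, ∃ r : k, r ≠ 0 ∧ f c - r • g c ∈ Algebra.adjoin k (g '' {c' | deg c' < deg c})) :
    Algebra.adjoin k (Set.range f) = Algebra.adjoin k (Set.range g) := by
  apply le_antisymm
  · refine Algebra.adjoin_le ?_
    rintro _ ⟨c, rfl⟩
    obtain ⟨r, -, hr⟩ := h c
    have h1 := Algebra.adjoin_mono (Set.image_subset_range g _) hr
    have h2 := Subalgebra.smul_mem _ (Algebra.subset_adjoin (R := k) (Set.mem_range_self (f := g) c)) r
    simpa using add_mem h1 h2
  · refine Algebra.adjoin_le ?_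
    have key : ∀ N c, deg c = N → g c ∈ Algebra.adjoin k (Set.range f) := by
      intro N
      induction N using Nat.strong_induction_on with
      | _ N ih =>
        intro c hc
        obtain ⟨r, hr0, hr⟩ := h c
        have h1 : f c - r • g c ∈ Algebra.adjoin k (Set.range f) := by
          refine (Algebra.adjoin_le ?_ : Algebra.adjoin k _ ≤ _) hr
          rintro _ ⟨c', hc', rfl⟩
          exact ih (deg c') (hc ▸ hc') c' rfl
        have h2 := Subalgebra.smul_mem _ (sub_mem
          (Algebra.subset_adjoin (R := k) (Set.mem_range_self (f := f) c)) h1) r⁻¹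
        simpa [smul_smul, inv_mul_cancel₀ hr0] using h2
    rintro _ ⟨c, rfl⟩
    exact key _ c rfl

end Functions

/-! ### Polynomials on vector spaces and charts of projective varieties -/

section Charts

variable {k : Type u} [Field k] {W : Type v} [AddCommGroup W] [Module k W]

lemma polyEval_smul {f : MvPolynomial (Module.Dual k W) k} {m : ℕ} (hf : f.IsHomogeneous m)
    (c : k) (a : W) : polyEval (c • a) f = c ^ m * polyEval a f := by
  simp only [polyEval, MvPolynomial.eval_eq, Finset.mul_sum]
  refine Finset.sum_congr rfl fun d hd => ?_
  have h1 : ∑ i ∈ d.support, d i = m := by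
    rw [hf.degree_eq_sum_deg_support hd]
  simp only [map_smul, smul_eq_mul, mul_pow, Finset.prod_mul_distrib, Finset.prod_pow_eq_pow_sum, h1]
  ring

lemma polyEval_rep_eq_zero_iff {f : MvPolynomial (Module.Dual k W) k} {m : ℕ}
    (hf : f.IsHomogeneous m) (x : ℙ k W) {a : W} (hx : x.submodule = Submodule.span k {a}) :
    polyEval x.rep f = 0 ↔ polyEval a f = 0 := by
  rw [Projectivization.submodule_eq, Submodule.span_singleton_eq_span_singleton] at hx
  obtain ⟨c, rfl⟩ := hx
  rw [Units.smul_def, polyEval_smul hf]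
  simp

/-- Padding the homogeneous components with powers of `ℓ` makes the degrees equal; this translates
between the affine chart `ℓ = 1` and homogeneous equations. -/
lemma exists_homogenization (ℓ : Module.Dual k W) (F : MvPolynomial (Module.Dual k W) k) :
    ∃ (m : ℕ) (f : MvPolynomial (Module.Dual k W) k), f.IsHomogeneous m ∧
      ∀ a : W, ℓ a ≠ 0 → polyEval a f = ℓ a ^ m * polyEval ((ℓ a)⁻¹ • a) F := by
  refine ⟨F.totalDegree, ∑ j ∈ Finset.range (F.totalDegree + 1),
    MvPolynomial.X ℓ ^ (F.totalDegree - j) * MvPolynomial.homogeneousComponent j F, ?_, ?_⟩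
  · refine MvPolynomial.IsHomogeneous.sum _ _ _ fun j hj => ?_
    have := (MvPolynomial.isHomogeneous_X_pow (R := k) ℓ (F.totalDegree - j)).mul
      (MvPolynomial.homogeneousComponent_isHomogeneous j F)
    rwa [Nat.sub_add_cancel (Nat.lt_succ_iff.1 (Finset.mem_range.1 hj))] at this
  · intro a ha
    conv_rhs => rhs; rw [← MvPolynomial.sum_homogeneousComponent F]
    have hs (b : W) (s : Finset ℕ) (g : ℕ → MvPolynomial (Module.Dual k W) k) :
        polyEval b (∑ j ∈ s, g j) = ∑ j ∈ s, polyEval b (g j) := map_sum (MvPolynomial.eval _) _ _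
    rw [hs, hs, Finset.mul_sum]
    refine Finset.sum_congr rfl fun j hj => ?_
    rw [polyEval_smul (MvPolynomial.homogeneousComponent_isHomogeneous j F)]
    have hj' := Nat.lt_succ_iff.1 (Finset.mem_range.1 hj)
    have h1 : polyEval a (MvPolynomial.X ℓ ^ (F.totalDegree - j) *
        MvPolynomial.homogeneousComponent j F) =
        ℓ a ^ (F.totalDegree - j) * polyEval a (MvPolynomial.homogeneousComponent j F) := by
      simp [polyEval]
    rw [h1, ← mul_assoc, inv_pow, ← pow_sub₀ _ ha hj']

/-- A polynomial in the quotients `ℓ' / ℓ` that vanishes on `S` vanishes on the closure of `S`. -/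
lemma vanishes_on_chart_of_projClosure (S : Set (ℙ k W)) (ℓ : Module.Dual k W)
    (F : MvPolynomial (Module.Dual k W) k)
    (hF : ∀ x ∈ S, ℓ x.rep ≠ 0 → polyEval ((ℓ x.rep)⁻¹ • x.rep) F = 0) {x : ℙ k W}
    (hx : x ∈ projClosure S) (hℓ : ℓ x.rep ≠ 0) : polyEval ((ℓ x.rep)⁻¹ • x.rep) F = 0 := by
  obtain ⟨m, f, hf, h⟩ := exists_homogenization ℓ F
  have hX (a : W) : polyEval a (MvPolynomial.X ℓ * f) = ℓ a * polyEval a f := by simp [polyEval]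
  -- The extra factor `ℓ` makes the equation hold also at the points of `S` on the hyperplane, where
  -- nothing is known about `f`.
  have h0 := hx (1 + m) (MvPolynomial.X ℓ * f) ((MvPolynomial.isHomogeneous_X k ℓ).mul hf)
    fun y hy => by
      rw [hX]
      by_cases hy0 : ℓ y.rep = 0
      · rw [hy0, zero_mul]
      · rw [h _ hy0, hF y hy hy0, mul_zero, mul_zero]
  rw [hX, h _ hℓ] at h0
  simpa [hℓ] using h0

lemma subset_projClosure (S : Set (ℙ k W)) : S ⊆ projClosure S := fun _ hx _ _ _ hf => hf _ hx

/-- The regular functions on a chart of a projective closure, computed on a parametrized subset. -/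
lemma nonempty_chartRing_equiv (S : Set (ℙ k W)) (ℓ : Module.Dual k W) {Θ : Type*} (π : Θ → W)
    (h1 : ∀ θ, ℓ (π θ) = 1 ∧ ∃ x ∈ S, x.submodule = Submodule.span k {π θ})
    (h2 : ∀ F : MvPolynomial (Module.Dual k W) k, (∀ θ, polyEval (π θ) F = 0) →
      ∀ x ∈ S, ℓ x.rep ≠ 0 → polyEval ((ℓ x.rep)⁻¹ • x.rep) F = 0) :
    Nonempty (chartRing (projClosure S) ℓ ≃ₐ[k] Algebra.adjoin k (Set.range
      fun (ℓ' : Module.Dual k W) (θ : Θ) => ℓ' (π θ))) := by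
  refine nonempty_adjoin_equiv _ _ fun F => ?_
  have e1 (x : hyperplaneCompl (projClosure S) ℓ) : MvPolynomial.aeval (fun (ℓ' : Module.Dual k W)
      (x : hyperplaneCompl (projClosure S) ℓ) => ℓ' x.1.rep / ℓ x.1.rep) F x =
      polyEval ((ℓ x.1.rep)⁻¹ • x.1.rep) F := by
    rw [aeval_fun_apply, polyEval]
    congr 2
    ext ℓ'
    rw [map_smul, smul_eq_mul, div_eq_inv_mul]
  have e2 (θ : Θ) : MvPolynomial.aeval (fun (ℓ' : Module.Dual k W) (θ : Θ) => ℓ' (π θ)) F θ =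
      polyEval (π θ) F := aeval_fun_apply _ _ _
  constructor
  · intro h
    ext θ
    obtain ⟨hθ, x, hxS, hx⟩ := h1 θ
    rw [e2]
    rw [Projectivization.submodule_eq, Submodule.span_singleton_eq_span_singleton] at hx
    obtain ⟨c, hc⟩ := hx
    have hc' : x.rep = (c⁻¹ : kˣ) • π θ := by rw [← hc, inv_smul_smul]
    have hℓ : ℓ x.rep = ((c⁻¹ : kˣ) : k) := by
      rw [hc', Units.smul_def, map_smul, hθ, smul_eq_mul, mul_one]
    have hx0 : ℓ x.rep ≠ 0 := by rw [hℓ]; exact Units.ne_zero _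
    have : polyEval ((ℓ x.rep)⁻¹ • x.rep) F = 0 := by
      rw [← e1 ⟨x, subset_projClosure S hxS, hx0⟩, h]; rfl
    rw [hℓ, hc', Units.smul_def, smul_smul, inv_mul_cancel₀ (Units.ne_zero _), one_smul] at this
    exact this
  · intro h
    ext x
    rw [e1]
    exact vanishes_on_chart_of_projClosure S ℓ F (h2 F fun θ => by rw [← e2, h]; rfl) x.2.1 x.2.2

/-! ### Polynomial curves and specialization -/

variable (k) in
/-- The algebra of polynomial functions of one variable. -/
def polyFun : Subalgebra k (k → k) := (Polynomial.aeval (id : k → k)).range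

lemma mem_polyFun {f : k → k} : f ∈ polyFun k ↔ ∃ P : Polynomial k, ∀ t, P.eval t = f t := by
  have h (P : Polynomial k) (t : k) : Polynomial.aeval (id : k → k) P t = P.eval t := by
    have : (Pi.evalAlgHom k (fun _ : k => k) t).comp (Polynomial.aeval id) =
        Polynomial.aeval t := by ext; simp
    exact (DFunLike.congr_fun this P).trans (Polynomial.coe_aeval_eq_eval t ▸ rfl)
  constructor
  · rintro ⟨P, rfl⟩
    exact ⟨P, fun t => (h P t).symm⟩
  · rintro ⟨P, hP⟩
    exact ⟨P, funext fun t => (h P t).trans (hP t)⟩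

/-- Over an infinite field polynomial functions form a domain, and `f * g` vanishes everywhere. -/
lemma polyFun_eq_zero [Infinite k] {f g : k → k} (hf : f ∈ polyFun k) (hg : g ∈ polyFun k)
    (hg0 : g ≠ 0) (h : ∀ t, g t ≠ 0 → f t = 0) : f = 0 := by
  obtain ⟨P, hP⟩ := mem_polyFun.1 hf
  obtain ⟨Q, hQ⟩ := mem_polyFun.1 hg
  have h1 : P * Q = 0 := Polynomial.funext fun t => by
    rw [Polynomial.eval_mul, hP, hQ, Polynomial.eval_zero]
    by_cases ht : g t = 0
    · rw [ht, mul_zero]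
    · rw [h t ht, zero_mul]
  rcases mul_eq_zero.1 h1 with h1 | h1
  · ext t; rw [← hP, h1]; simp
  · exact absurd (funext fun t => by rw [← hQ, h1]; simp) hg0

lemma polyEval_mem_polyFun {u : k → W} (hu : ∀ ℓ : Module.Dual k W, (fun t => ℓ (u t)) ∈ polyFun k)
    (F : MvPolynomial (Module.Dual k W) k) : (fun t => polyEval (u t) F) ∈ polyFun k := by
  have : (fun t => polyEval (u t) F) =
      MvPolynomial.aeval (fun (ℓ : Module.Dual k W) (t : k) => ℓ (u t)) F := by
    ext t; rw [aeval_fun_apply]; rfl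
  rw [this]
  have h2 : (MvPolynomial.aeval (fun (ℓ : Module.Dual k W) (t : k) => ℓ (u t)) F) ∈
      Algebra.adjoin k (Set.range fun (ℓ : Module.Dual k W) (t : k) => ℓ (u t)) := by
    rw [Algebra.adjoin_range_eq_range_aeval]; exact ⟨F, rfl⟩
  refine (Algebra.adjoin_le ?_ : Algebra.adjoin k _ ≤ polyFun k) h2
  rintro _ ⟨ℓ, rfl⟩
  exact hu ℓ

/-- Vanishing of a polynomial in the quotients `ℓ' / ℓ` extends along polynomial curves. -/
lemma polyEval_eq_zero_of_curve [Infinite k] (ℓ : Module.Dual k W)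
    (F : MvPolynomial (Module.Dual k W) k) {u : k → W}
    (hu : ∀ ℓ : Module.Dual k W, (fun t => ℓ (u t)) ∈ polyFun k) {g : k → k} (hg : g ∈ polyFun k)
    (hg0 : g ≠ 0) (h : ∀ t, g t ≠ 0 → ℓ (u t) ≠ 0 → polyEval ((ℓ (u t))⁻¹ • u t) F = 0)
    (h0 : ℓ (u 0) ≠ 0) : polyEval ((ℓ (u 0))⁻¹ • u 0) F = 0 := by
  obtain ⟨m, f, hf, hfF⟩ := exists_homogenization ℓ F
  -- Multiplying by `ℓ (u t)` takes care of the parameters at which the curve leaves the chart.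
  have h1 : (fun t => polyEval (u t) f) * (fun t => ℓ (u t)) = 0 :=
    polyFun_eq_zero (mul_mem (polyEval_mem_polyFun hu f) (hu ℓ)) hg hg0 fun t ht => by
      by_cases hℓ : ℓ (u t) = 0
      · simp [hℓ]
      · simp [hfF _ hℓ, h t ht hℓ]
  have h2 := congrFun h1 0
  simp only [Pi.mul_apply, hfF _ h0, Pi.zero_apply] at h2
  simpa [h0] using h2

/-- The functions given by linear forms generate the same algebra as the coordinates. -/
lemma adjoin_dual_eq_adjoin_basis {ι : Type*} [Fintype ι] (b : Module.Basis ι k W) {Θ : Type*}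
    (π : Θ → W) : Algebra.adjoin k (Set.range fun (ℓ : Module.Dual k W) (θ : Θ) => ℓ (π θ)) =
      Algebra.adjoin k (Set.range fun (c : ι) (θ : Θ) => b.repr (π θ) c) := by
  apply le_antisymm
  · refine Algebra.adjoin_le ?_
    rintro _ ⟨ℓ, rfl⟩
    have : (fun θ : Θ => ℓ (π θ)) = ∑ c, ℓ (b c) • fun θ : Θ => b.repr (π θ) c := by
      ext θ
      conv_lhs => rw [← b.sum_repr (π θ)]
      rw [map_sum, Finset.sum_apply]
      refine Finset.sum_congr rfl fun c _ => ?_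
      rw [map_smul, smul_eq_mul, mul_comm]
      rfl
    have h (c : ι) : ℓ (b c) • (fun θ : Θ => b.repr (π θ) c) ∈ Algebra.adjoin k (Set.range
          fun (c : ι) (θ : Θ) => b.repr (π θ) c) :=
      Subalgebra.smul_mem _ (Algebra.subset_adjoin (Set.mem_range_self c)) _
    change (fun θ : Θ => ℓ (π θ)) ∈ Algebra.adjoin k _
    rw [this]
    exact sum_mem fun c _ => h c
  · refine Algebra.adjoin_mono ?_
    rintro _ ⟨c, rfl⟩
    exact ⟨b.coord c, rfl⟩

end Charts

/-! ### Colorings and monomials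

The coordinates of `A` with respect to bases of the `Vᵢ` are indexed by the colorings of the tensor
factors; color `0` stands for the first basis vector. -/

section Colorings

variable {n : ℕ} {d s : Fin n → ℕ}

/-- A choice of a basis vector for each tensor factor. -/
abbrev Coloring (d s : Fin n → ℕ) : Type := ∀ p : (Σ i : Fin n, Fin (s i)), Fin (d p.1 + 1)

/-- The coordinates of the vectors `(1, x)`. -/
def hat {R : Type*} [CommSemiring R] (x : (Σ i : Fin n, Fin (d i)) → R) (i : Fin n) :
    Fin (d i + 1) → R :=
  Fin.cons 1 fun j => x ⟨i, j⟩

/-- The monomial in `x` given by a coloring. -/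
def mon {R : Type*} [CommSemiring R] (x : (Σ i : Fin n, Fin (d i)) → R) (c : Coloring d s) : R :=
  ∏ p, hat x p.1 (c p)

/-- The tensor factors with nonzero color. -/
def csupp (c : Coloring d s) : Finset (Σ i : Fin n, Fin (s i)) := {p | c p ≠ 0}

/-- The coloring that agrees with `c` on `J` and is zero elsewhere. -/
def restr (c : Coloring d s) (J : Finset (Σ i : Fin n, Fin (s i))) : Coloring d s :=
  fun p => if p ∈ J then c p else 0

section CommSemiring

variable {R : Type*} [CommSemiring R]

@[simp] lemma hat_zero (x : (Σ i : Fin n, Fin (d i)) → R) (i : Fin n) : hat x i 0 = 1 := rfl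

@[simp] lemma hat_succ (x : (Σ i : Fin n, Fin (d i)) → R) (i : Fin n) (j : Fin (d i)) :
    hat x i j.succ = x ⟨i, j⟩ := rfl

lemma mem_csupp {c : Coloring d s} {p : Σ i : Fin n, Fin (s i)} : p ∈ csupp c ↔ c p ≠ 0 := by
  simp [csupp]

lemma csupp_restr {c : Coloring d s} {J : Finset (Σ i : Fin n, Fin (s i))} (hJ : J ⊆ csupp c) :
    csupp (restr c J) = J := by
  ext p
  rw [mem_csupp, restr]
  split_ifs with h
  · exact ⟨fun _ => h, fun _ => mem_csupp.1 (hJ h)⟩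
  · simp [h]

lemma restr_csupp (c : Coloring d s) : restr c (csupp c) = c := by
  ext p : 1
  rw [restr]
  split_ifs with h
  · rfl
  · simpa [mem_csupp, eq_comm] using h

lemma mon_eq_prod_csupp (x : (Σ i : Fin n, Fin (d i)) → R) (c : Coloring d s) :
    mon x c = ∏ p ∈ csupp c, hat x p.1 (c p) := by
  rw [mon]
  refine (Finset.prod_subset (Finset.subset_univ _) fun p _ hp => ?_).symm
  rw [mem_csupp, not_not] at hp
  rw [hp, hat_zero]

lemma mon_restr (x : (Σ i : Fin n, Fin (d i)) → R) {c : Coloring d s}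
    {J : Finset (Σ i : Fin n, Fin (s i))} (hJ : J ⊆ csupp c) :
    mon x (restr c J) = ∏ p ∈ J, hat x p.1 (c p) := by
  rw [mon_eq_prod_csupp, csupp_restr hJ]
  exact Finset.prod_congr rfl fun p hp => by rw [restr, if_pos hp]

lemma mon_split (x : (Σ i : Fin n, Fin (d i)) → R) {c : Coloring d s}
    {J : Finset (Σ i : Fin n, Fin (s i))} (hJ : J ⊆ csupp c) :
    mon x c = mon x (restr c J) * mon x (restr c (csupp c \ J)) := by
  rw [mon_restr x hJ, mon_restr x Finset.sdiff_subset, mon_eq_prod_csupp, mul_comm,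
    Finset.prod_sdiff hJ]

/-- This is the expansion of a product of sums over the factors of nonzero color only: color `0`
contributes `1`, not `1 + 1`, to `hat (x + y)`. It is the source of all moment identities below. -/
lemma mon_add (x y : (Σ i : Fin n, Fin (d i)) → R) (c : Coloring d s) :
    mon (x + y) c =
      ∑ J ∈ (csupp c).powerset, mon x (restr c J) * mon y (restr c (csupp c \ J)) := by
  have h : mon (x + y) c = ∏ p ∈ csupp c, (hat x p.1 (c p) + hat y p.1 (c p)) := by
    rw [mon_eq_prod_csupp]
    refine Finset.prod_congr rfl fun p hp => ?_
    obtain ⟨j, hj⟩ := Fin.exists_succ_eq.2 (mem_csupp.1 hp)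
    rw [← hj]
    rfl
  rw [h, Finset.prod_add]
  refine Finset.sum_congr rfl fun J hJ => ?_
  rw [mon_restr x (Finset.mem_powerset.1 hJ), mon_restr y Finset.sdiff_subset]

lemma mon_mul (r : R) (x : (Σ i : Fin n, Fin (d i)) → R) (c : Coloring d s) :
    mon (fun q => r * x q) c = r ^ (csupp c).card * mon x c := by
  rw [mon_eq_prod_csupp, mon_eq_prod_csupp, ← Finset.prod_const, ← Finset.prod_mul_distrib]
  refine Finset.prod_congr rfl fun p hp => ?_
  obtain ⟨j, hj⟩ := Fin.exists_succ_eq.2 (mem_csupp.1 hp)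
  rw [← hj]
  rfl

lemma map_hat {R' : Type*} [CommSemiring R'] (f : R →+* R') (x : (Σ i : Fin n, Fin (d i)) → R)
    (i : Fin n) (j : Fin (d i + 1)) : f (hat x i j) = hat (fun q => f (x q)) i j := by
  cases j using Fin.cases <;> simp

lemma map_mon {R' : Type*} [CommSemiring R'] (f : R →+* R') (x : (Σ i : Fin n, Fin (d i)) → R)
    (c : Coloring d s) : f (mon x c) = mon (fun q => f (x q)) c := by
  rw [mon, mon, map_prod]
  exact Finset.prod_congr rfl fun p _ => map_hat f x _ _

lemma mon_of_csupp_eq_empty (x : (Σ i : Fin n, Fin (d i)) → R) {c : Coloring d s}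
    (hc : csupp c = ∅) : mon x c = 1 := by
  rw [mon_eq_prod_csupp, hc, Finset.prod_empty]

end CommSemiring

/-! ### Multidegrees of colorings -/

/-- The exponents of the monomial given by a coloring. -/
def mdeg (c : Coloring d s) : (Σ i : Fin n, Fin (d i)) →₀ ℕ :=
  Finsupp.equivFunOnFinite.symm fun q => (Finset.univ.filter fun a => c ⟨q.1, a⟩ = q.2.succ).card

lemma mdeg_apply (c : Coloring d s) (i : Fin n) (j : Fin (d i)) :
    mdeg c ⟨i, j⟩ = (Finset.univ.filter fun a => c ⟨i, a⟩ = j.succ).card := rfl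

lemma mon_eq_prod_mdeg {R : Type*} [CommSemiring R] (x : (Σ i : Fin n, Fin (d i)) → R)
    (c : Coloring d s) : mon x c = ∏ q, x q ^ mdeg c q := by
  rw [mon, Fintype.prod_sigma, Fintype.prod_sigma]
  refine Finset.prod_congr rfl fun i _ => ?_
  let f : Fin (s i) → Fin (d i + 1) := fun a => c ⟨i, a⟩
  have := Finset.prod_fiberwise (s := Finset.univ) (g := f) (f := fun a => hat x i (f a))
  refine this.symm.trans ?_
  rw [Fin.prod_univ_succ]
  have h0 : ∏ a with f a = 0, hat x i (f a) = 1 :=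
    Finset.prod_eq_one fun a ha => by rw [(Finset.mem_filter.1 ha).2, hat_zero]
  rw [h0, one_mul]
  refine Finset.prod_congr rfl fun j _ => ?_
  rw [mdeg_apply, ← Finset.prod_const]
  refine Finset.prod_congr rfl fun a ha => ?_
  have ha' : f a = j.succ := (Finset.mem_filter.1 ha).2
  rw [ha', hat_succ]

lemma sum_mdeg (c : Coloring d s) : ∑ q, mdeg c q = (csupp c).card := by
  -- Setting all variables equal to `2` in `ℕ` turns both counts into exponents of `2`.
  have h1 : mon (fun _ => 2 * 1) c = ∏ q, 2 ^ mdeg c q := mon_eq_prod_mdeg _ c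
  rw [mon_mul, mon_eq_prod_mdeg] at h1
  simp only [one_pow, Finset.prod_const_one, mul_one, Finset.prod_pow_eq_pow_sum] at h1
  exact (Nat.pow_right_injective le_rfl h1).symm

lemma sum_mdeg_le (c : Coloring d s) (i : Fin n) : ∑ j, mdeg c ⟨i, j⟩ ≤ s i := by
  let f : Fin (s i) → Fin (d i + 1) := fun a => c ⟨i, a⟩
  have h := Finset.card_eq_sum_card_fiberwise (s := Finset.univ) (t := Finset.univ)
    (f := f) (fun a _ => Finset.mem_coe.2 (Finset.mem_univ _))
  rw [Fin.sum_univ_succ, Finset.card_univ, Fintype.card_fin] at h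
  have h' : ∑ j, mdeg c ⟨i, j⟩ =
      ∑ j : Fin (d i), (Finset.univ.filter fun a => f a = j.succ).card := rfl
  omega

lemma exists_mdeg_eq (m : (Σ i : Fin n, Fin (d i)) →₀ ℕ) (hm : ∀ i, ∑ j, m ⟨i, j⟩ ≤ s i) :
    ∃ c : Coloring d s, mdeg c = m := by
  classical
  have h (i : Fin n) : ∃ f : Fin (s i) → Fin (d i + 1),
      ∀ j, (Finset.univ.filter fun a => f a = j.succ).card = m ⟨i, j⟩ := by
    -- The factors that `m` does not use receive color `0`.
    let m' : Fin (d i + 1) → ℕ := Fin.cons (s i - ∑ j, m ⟨i, j⟩) fun j => m ⟨i, j⟩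
    have hcard : Fintype.card (Σ j, Fin (m' j)) = s i := by
      rw [Fintype.card_sigma, Fin.sum_univ_succ]
      simp only [Fintype.card_fin, m', Fin.cons_zero, Fin.cons_succ]
      exact Nat.sub_add_cancel (hm i)
    let e := Fintype.equivFinOfCardEq hcard
    refine ⟨fun a => (e.symm a).1, fun j => ?_⟩
    have : (Finset.univ.filter fun a => (e.symm a).1 = j.succ) =
        (Finset.univ : Finset (Fin (m' j.succ))).map
          ((Function.Embedding.sigmaMk j.succ).trans e.toEmbedding) := by
      ext a
      simp only [Finset.mem_filter, Finset.mem_univ, true_and, Finset.mem_map,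
        Function.Embedding.trans_apply, Function.Embedding.sigmaMk_apply, Equiv.coe_toEmbedding]
      constructor
      · intro h
        obtain ⟨⟨j', b⟩, rfl⟩ := e.surjective a
        rw [e.symm_apply_apply] at h
        subst h
        exact ⟨b, rfl⟩
      · rintro ⟨b, rfl⟩
        simp
    rw [this, Finset.card_map, Finset.card_univ, Fintype.card_fin]
    rfl
  choose f hf using h
  exact ⟨fun p => f p.1 p.2, Finsupp.ext fun ⟨i, j⟩ => hf i j⟩

end Colorings

/-! ### Moments and cumulants -/

section Cumulants

variable {k : Type u} [Field k] {n : ℕ} {d s : Fin n → ℕ} {A : Type*} [CommRing A] [Algebra k A]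

/-- The algebra generated by the moments is generated by the means and by any family that is related
to the central moments by a triangular transformation. -/
lemma adjoin_moments_eq (hs : ∀ i, 0 < s i) (μ z : (Σ i : Fin n, Fin (d i)) → A) (κ : ℕ → A)
    (h0 : κ 0 = 1) (h1 : κ 1 = 0) (M e : Coloring d s → A)
    (hM : ∀ c, M c = ∑ J ∈ (csupp c).powerset,
      κ J.card * mon z (restr c J) * mon μ (restr c (csupp c \ J)))
    (he : ∀ c, 2 ≤ (csupp c).card → ∃ r : k, r ≠ 0 ∧ κ (csupp c).card * mon z c - r • e c ∈
      Algebra.adjoin k (e '' {c' | 2 ≤ (csupp c').card ∧ (csupp c').card < (csupp c).card})) :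
    Algebra.adjoin k (Set.range M) =
      Algebra.adjoin k (Set.range μ ∪ e '' {c | 2 ≤ (csupp c).card}) := by
  classical
  -- The intermediate generators, one for each coloring: the given `e c` in degree at least two, and
  -- the mean (or `1`) below.
  let g : Coloring d s → A := fun c =>
    if 2 ≤ (csupp c).card then e c else mon μ c
  have hg2 {c : Coloring d s} (hc : 2 ≤ (csupp c).card) : g c = e c := if_pos hc
  have hg1 {c : Coloring d s} (hc : ¬ 2 ≤ (csupp c).card) : g c = mon μ c := if_neg hc
  let F : ℕ → Subalgebra k A := fun N => Algebra.adjoin k (g '' {c | (csupp c).card < N})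
  have hF {N N' : ℕ} (h : N ≤ N') : F N ≤ F N' :=
    Algebra.adjoin_mono (Set.image_mono fun c hc => lt_of_lt_of_le hc h)
  have hEF (N : ℕ) : Algebra.adjoin k (e '' {c' | 2 ≤ (csupp c').card ∧ (csupp c').card < N}) ≤
      F N := by
    refine Algebra.adjoin_mono ?_
    rintro _ ⟨c, hc, rfl⟩
    exact ⟨c, hc.2, hg2 hc.1⟩
  have hK (c : Coloring d s) : κ (csupp c).card * mon z c ∈ F ((csupp c).card + 1) := by
    rcases Nat.lt_or_ge (csupp c).card 2 with hc | hc
    · interval_cases h : (csupp c).card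
      · rw [h0, mon_of_csupp_eq_empty _ (Finset.card_eq_zero.1 h), one_mul]
        exact one_mem _
      · rw [h1, zero_mul]
        exact zero_mem _
    · obtain ⟨r, -, hr⟩ := he c hc
      have h2 : g c ∈ F ((csupp c).card + 1) := Algebra.subset_adjoin ⟨c, Nat.lt_succ_self _, rfl⟩
      rw [hg2 hc] at h2
      have := add_mem (hF (Nat.le_succ _) (hEF _ hr)) (Subalgebra.smul_mem _ h2 r)
      simpa using this
  have hμ (c : Coloring d s) : mon μ c ∈ F 2 := by
    rw [mon_eq_prod_csupp]
    refine prod_mem fun p hp => ?_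
    have hsub : {p} ⊆ csupp c := Finset.singleton_subset_iff.2 hp
    have hcard : (csupp (restr c {p})).card = 1 := by
      rw [csupp_restr hsub, Finset.card_singleton]
    have : g (restr c {p}) = hat μ p.1 (c p) := by
      rw [hg1 (by omega), mon_restr _ hsub, Finset.prod_singleton]
    rw [← this]
    exact Algebra.subset_adjoin ⟨_, by simp [hcard], rfl⟩
  have htri : Algebra.adjoin k (Set.range M) = Algebra.adjoin k (Set.range g) := by
    refine adjoin_eq_of_triangular M g (fun c => (csupp c).card) fun c => ?_
    change ∃ r : k, r ≠ 0 ∧ M c - r • g c ∈ F (csupp c).card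
    rcases Nat.lt_or_ge (csupp c).card 2 with hc | hc
    · refine ⟨1, one_ne_zero, ?_⟩
      have : M c = g c := by
        rw [hg1 (by omega), hM]
        interval_cases h : (csupp c).card
        · rw [Finset.card_eq_zero] at h
          rw [h, Finset.powerset_empty, Finset.sum_singleton, Finset.card_empty, h0,
            mon_restr z (Finset.empty_subset _), Finset.sdiff_self, ← h, restr_csupp]
          simp [h]
        · obtain ⟨p, hp⟩ := Finset.card_eq_one.1 h
          have hpow : ({p} : Finset (Σ i, Fin (s i))).powerset = {∅, {p}} := by
            ext J; simp [Finset.subset_singleton_iff]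
          rw [hp, hpow, Finset.sum_pair (by simp), Finset.card_empty, h0,
            mon_restr z (Finset.empty_subset _), Finset.card_singleton, h1, Finset.sdiff_empty,
            ← hp, restr_csupp]
          simp
      rw [one_smul, this, sub_self]
      exact zero_mem _
    · obtain ⟨r, hr0, hr⟩ := he c hc
      refine ⟨r, hr0, ?_⟩
      -- The summand `J = csupp c` is the central moment itself; in all others `J` is a proper
      -- subset, so they involve only generators of lower degree.
      have hsplit : M c - r • g c = (κ (csupp c).card * mon z c - r • e c) +
          ∑ J ∈ (csupp c).ssubsets,
            κ J.card * mon z (restr c J) * mon μ (restr c (csupp c \ J)) := by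
        rw [hM, Finset.ssubsets, ← Finset.add_sum_erase _ _ (Finset.mem_powerset_self (csupp c)),
          Finset.sdiff_self, mon_restr μ (Finset.empty_subset _), restr_csupp, hg2 hc]
        simp only [Finset.prod_empty, mul_one]
        ring
      rw [hsplit]
      refine add_mem (hEF _ hr) (sum_mem fun J hJ => mul_mem ?_ (hF hc (hμ _)))
      have hJ' := Finset.mem_ssubsets.1 hJ
      have := hK (restr c J)
      rw [csupp_restr hJ'.1] at this
      exact hF (Finset.card_lt_card hJ') this
  rw [htri]
  apply le_antisymm
  · refine Algebra.adjoin_le ?_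
    rintro _ ⟨c, rfl⟩
    by_cases hc : 2 ≤ (csupp c).card
    · rw [hg2 hc]
      exact Algebra.subset_adjoin (Or.inr ⟨c, hc, rfl⟩)
    · rw [hg1 hc, mon_eq_prod_csupp]
      refine prod_mem fun p hp => ?_
      obtain ⟨j, hj⟩ := Fin.exists_succ_eq.2 (mem_csupp.1 hp)
      rw [← hj]
      exact Algebra.subset_adjoin (Or.inl ⟨_, rfl⟩)
  · refine Algebra.adjoin_mono ?_
    rintro _ (⟨⟨i, j⟩, rfl⟩ | ⟨c, hc, rfl⟩)
    -- A mean occurs as the moment of a coloring with a single nonzero color, which exists because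
    -- `s i` is positive.
    · let c : Coloring d s := fun p =>
        if h : p = ⟨i, ⟨0, hs i⟩⟩ then h ▸ j.succ else 0
      have hc : csupp c = {⟨i, ⟨0, hs i⟩⟩} := by
        ext p
        rw [mem_csupp, Finset.mem_singleton]
        by_cases h : p = ⟨i, ⟨0, hs i⟩⟩
        · subst h; simp [c]
        · simp [c, h]
      refine ⟨c, ?_⟩
      rw [hg1 (by rw [hc]; simp), mon_eq_prod_csupp, hc, Finset.prod_singleton]
      simp [c]
    · exact ⟨c, hg2 hc⟩

lemma exists_subset_card_two {c : Coloring d s} (hc : 2 ≤ (csupp c).card) :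
    ∃ J ⊆ csupp c, J.card = 2 := Finset.exists_subset_card_eq hc

/-- For moments of two-point distributions the central moments and the secant cumulants generate
each other triangularly. -/
lemma central_moment_sub_mem (z : (Σ i : Fin n, Fin (d i)) → A) (κ : ℕ → A) (C q : A)
    (h0 : κ 0 = 1) (h1 : κ 1 = 0) (hκ : ∀ r, κ (r + 2) = C * κ (r + 1) + q * κ r)
    (e : Coloring d s → A) (he : ∀ c, e c = q * C ^ ((csupp c).card - 2) * mon z c)
    (r a : ℕ) (c : Coloring d s) (hc : (csupp c).card = r + 2 + a) :
    C ^ a * κ (r + 2) * mon z c - e c ∈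
      Algebra.adjoin k (e '' {c' | 2 ≤ (csupp c').card ∧ (csupp c').card < (csupp c).card}) := by
  -- The factor `C ^ a` is there for the induction: the recurrence for `κ` trades one step in `r`
  -- for one factor `C` at the same coloring.
  induction r using Nat.strong_induction_on generalizing a c with
  | _ r ih =>
    match r with
    | 0 =>
      have : C ^ a * κ (0 + 2) * mon z c - e c = 0 := by
        rw [he, hκ, h0, h1, hc]
        simp only [zero_add, Nat.add_sub_cancel_left]
        ring
      rw [this]
      exact zero_mem _
    | 1 =>
      have : C ^ a * κ (1 + 2) * mon z c - e c = 0 := by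
        rw [he, hκ, hκ, h0, h1, hc, show 1 + 2 + a - 2 = a + 1 by omega, pow_succ]
        ring
      rw [this]
      exact zero_mem _
    | r + 2 =>
      -- The term `q * κ (r + 2)` of the recurrence is a product: `q` and the variables of a pair
      -- `J` make `e (restr c J)`, and the rest is a central moment of the complement of `J`, of
      -- smaller degree.
      obtain ⟨J, hJ, hJ2⟩ := exists_subset_card_two (c := c) (by omega)
      have hc1 : (csupp (restr c J)).card = 2 := by rw [csupp_restr hJ, hJ2]
      have hc2 : (csupp (restr c (csupp c \ J))).card = r + 2 + a := by
        rw [csupp_restr Finset.sdiff_subset, Finset.card_sdiff_of_subset hJ, hJ2, hc]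
        omega
      have i1 := ih (r + 1) (by omega) (a + 1) c (by omega)
      have i2 := ih r (by omega) a _ hc2
      have hle : Algebra.adjoin k (e '' {c' | 2 ≤ (csupp c').card ∧ (csupp c').card <
          (csupp (restr c (csupp c \ J))).card}) ≤ Algebra.adjoin k
          (e '' {c' | 2 ≤ (csupp c').card ∧ (csupp c').card < (csupp c).card}) :=
        Algebra.adjoin_mono (Set.image_mono fun c' hc' => ⟨hc'.1, hc'.2.trans (by omega)⟩)
      have hm1 : e (restr c J) ∈ Algebra.adjoin k
          (e '' {c' | 2 ≤ (csupp c').card ∧ (csupp c').card < (csupp c).card}) :=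
        Algebra.subset_adjoin ⟨_, ⟨hc1.ge, by omega⟩, rfl⟩
      have hm2 : e (restr c (csupp c \ J)) ∈ Algebra.adjoin k
          (e '' {c' | 2 ≤ (csupp c').card ∧ (csupp c').card < (csupp c).card}) :=
        Algebra.subset_adjoin ⟨_, ⟨by omega, by omega⟩, rfl⟩
      have heq : C ^ a * κ (r + 2 + 2) * mon z c - e c =
          (C ^ (a + 1) * κ (r + 1 + 2) * mon z c - e c) + e (restr c J) *
          ((C ^ a * κ (r + 2) * mon z (restr c (csupp c \ J)) - e (restr c (csupp c \ J))) +
            e (restr c (csupp c \ J))) := by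
        rw [he (restr c J), hc1, hκ (r + 2), mon_split z hJ]
        simp only [Nat.sub_self, pow_zero]
        ring
      rw [heq]
      exact add_mem i1 (mul_mem hm1 (add_mem (hle i2) hm2))

end Cumulants

/-! ### Coordinates on the ambient space -/

section HomogeneousMonomials

variable {n : ℕ} {d s : Fin n → ℕ} {R : Type*} [CommSemiring R]

/-- The homogeneous monomial given by a coloring. -/
def hmon (v : ∀ i : Fin n, Fin (d i + 1) → R) (c : Coloring d s) : R := ∏ p, v p.1 (c p)

lemma hmon_hat (x : (Σ i : Fin n, Fin (d i)) → R) (c : Coloring d s) :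
    hmon (hat x) c = mon x c := rfl

/-- The multidegree also determines how often color `0` occurs in each group, since the group has `s
i` factors. These are the linear equations saying that the tensors are symmetric. -/
lemma hmon_congr (v : ∀ i : Fin n, Fin (d i + 1) → R) {c c' : Coloring d s}
    (h : mdeg c = mdeg c') : hmon v c = hmon v c' := by
  have key (c : Coloring d s) : hmon v c = ∏ i, v i 0 ^ (s i - ∑ j, mdeg c ⟨i, j⟩) *
      ∏ j, v i (Fin.succ j) ^ mdeg c ⟨i, j⟩ := by
    rw [hmon, Fintype.prod_sigma]
    refine Finset.prod_congr rfl fun i _ => ?_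
    let f : Fin (s i) → Fin (d i + 1) := fun a => c ⟨i, a⟩
    have h1 := Finset.prod_fiberwise (s := Finset.univ) (g := f) (f := fun a => v i (f a))
    refine h1.symm.trans ?_
    have h2 (j : Fin (d i + 1)) : ∏ a with f a = j, v i (f a) =
        v i j ^ (Finset.univ.filter fun a => f a = j).card := by
      rw [← Finset.prod_const]
      exact Finset.prod_congr rfl fun a ha => by rw [(Finset.mem_filter.1 ha).2]
    have h3 := Finset.card_eq_sum_card_fiberwise (s := Finset.univ) (t := Finset.univ)
      (f := f) (fun a _ => Finset.mem_coe.2 (Finset.mem_univ _))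
    rw [Fin.sum_univ_succ, Finset.card_univ, Fintype.card_fin] at h3
    have h4 : ∑ j, mdeg c ⟨i, j⟩ =
      ∑ j : Fin (d i), (Finset.univ.filter fun a => f a = j.succ).card := rfl
    rw [Finset.prod_congr rfl fun j _ => h2 j, Fin.prod_univ_succ, h4,
      show (Finset.univ.filter fun a => f a = 0).card = s i -
        ∑ j : Fin (d i), (Finset.univ.filter fun a => f a = j.succ).card by omega]
    rfl
  rw [key, key, h]

/-- At each tensor factor the same two colors appear on both sides. These quadratic equations of `X`
bound its tangent spaces. -/
lemma hmon_mul_zero (v : ∀ i : Fin n, Fin (d i + 1) → R) (c : Coloring d s)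
    (J : Finset (Σ i : Fin n, Fin (s i))) :
    hmon v c * hmon v (fun _ => 0 : Coloring d s) =
      hmon v (restr c J) * hmon v (restr c (csupp c \ J)) := by
  rw [hmon, hmon, hmon, hmon, ← Finset.prod_mul_distrib, ← Finset.prod_mul_distrib]
  refine Finset.prod_congr rfl fun p _ => ?_
  by_cases hJ : p ∈ J
  · simp [restr, hJ]
  · by_cases hc : c p = 0
    · simp [restr, hJ, hc]
    · simp [restr, hJ, mem_csupp, hc, mul_comm]

end HomogeneousMonomials

section Coordinates

variable {k : Type u} [Field k]

/-- A vector and a linear form with value `1` on it extend to dual bases. -/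
lemma exists_basis_cons {V : Type*} [AddCommGroup V] [Module k V] [FiniteDimensional k V] {d : ℕ}
    (hd : Module.finrank k V = d + 1) (φ : Module.Dual k V) (e : V) (h : φ e = 1) :
    ∃ b : Module.Basis (Fin (d + 1)) k V, b 0 = e ∧ b.coord 0 = φ := by
  have hφ : φ ≠ 0 := by rintro rfl; simp at h
  have hker : Module.finrank k (LinearMap.ker φ) = d := by
    have := Module.Dual.finrank_ker_add_one_of_ne_zero hφ
    omega
  let b' : Module.Basis (Fin d) k (LinearMap.ker φ) := Module.finBasisOfFinrankEq k _ hker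
  let b := Module.Basis.mkFinCons e b'
    (fun c x hx h0 => by
      have := congrArg φ h0
      rwa [map_add, map_smul, LinearMap.mem_ker.1 hx, h, map_zero, add_zero, smul_eq_mul,
        mul_one] at this)
    (fun z => ⟨-φ z, by simp [h]⟩)
  have hb : (b : Fin (d + 1) → V) = Fin.cons e ((↑) ∘ b') := Module.Basis.coe_mkFinCons _ _ _ _
  refine ⟨b, by rw [hb]; rfl, b.ext fun j => ?_⟩
  rw [Module.Basis.coord_apply, Module.Basis.repr_self]
  cases j using Fin.cases with
  | zero => simp [hb, h]
  | succ j =>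
    have : φ (b' j) = 0 := (b' j).2
    simp [hb, this]

variable {n : ℕ} {V : Fin n → Type u} [∀ i, AddCommGroup (V i)] [∀ i, Module k (V i)]
  {s d : Fin n → ℕ} (b : ∀ i, Module.Basis (Fin (d i + 1)) k (V i))

variable (k s) in
/-- The tensor `v₁^{⊗ s₁} ⊗ ⋯ ⊗ vₙ^{⊗ sₙ}`. -/
def powTensor (v : ∀ i, V i) : Ambient k V s :=
  PiTensorProduct.tprod k fun p : (Σ i, Fin (s i)) => v p.1

variable (s) in
/-- The basis of the ambient space consisting of tensor products of basis vectors. -/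
def tensorBasis : Module.Basis (Coloring d s) k (Ambient k V s) :=
  Basis.piTensorProduct fun p : (Σ i, Fin (s i)) => b p.1

lemma tensorBasis_repr_tprod (v : ∀ p : (Σ i, Fin (s i)), V p.1) (c : Coloring d s) :
    (tensorBasis s b).repr (PiTensorProduct.tprod k v) c = ∏ p, (b p.1).repr (v p) (c p) :=
  Basis.piTensorProduct_repr_tprod_apply _ _ _

lemma tensorBasis_repr_powTensor (v : ∀ i, V i) (c : Coloring d s) :
    (tensorBasis s b).repr (powTensor k s v) c = hmon (fun i j => (b i).repr (v i) j) c :=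
  tensorBasis_repr_tprod _ _ _

lemma dual_apply_eq_sum (ℓ : Module.Dual k (Ambient k V s)) (a : Ambient k V s) :
    ℓ a = ∑ c, (tensorBasis s b).repr a c * ℓ (tensorBasis s b c) := by
  conv_lhs => rw [← (tensorBasis s b).sum_repr a]
  rw [map_sum]
  exact Finset.sum_congr rfl fun c _ => by rw [map_smul, smul_eq_mul]

lemma powerForm_tprod (φ : ∀ i, Module.Dual k (V i)) (v : ∀ p : (Σ i, Fin (s i)), V p.1) :
    powerForm s φ (PiTensorProduct.tprod k v) = ∏ p : (Σ i, Fin (s i)), φ p.1 (v p) :=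
  PiTensorProduct.dualDistrib_apply _ _

lemma powerForm_coord_zero (a : Ambient k V s) :
    powerForm s (fun i => (b i).coord 0) a = (tensorBasis s b).repr a fun _ => 0 := by
  have : powerForm s (fun i => (b i).coord 0) = (tensorBasis s b).coord fun _ => 0 := by
    refine PiTensorProduct.ext (MultilinearMap.ext fun v => ?_)
    simp only [LinearMap.compMultilinearMap_apply]
    rw [powerForm_tprod, Module.Basis.coord_apply, tensorBasis_repr_tprod]
    rfl
  rw [this, Module.Basis.coord_apply]

lemma adjoin_dual_eq_adjoin_repr {Θ : Type*} (π : Θ → Ambient k V s) :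
    Algebra.adjoin k (Set.range fun (ℓ : Module.Dual k (Ambient k V s)) (θ : Θ) => ℓ (π θ)) =
      Algebra.adjoin k (Set.range fun (c : Coloring d s) (θ : Θ) =>
        (tensorBasis s b).repr (π θ) c) :=
  adjoin_dual_eq_adjoin_basis (tensorBasis s b) π

lemma dual_mem_polyFun {u : k → Ambient k V s}
    (hu : ∀ c, (fun t => (tensorBasis s b).repr (u t) c) ∈ polyFun k)
    (ℓ : Module.Dual k (Ambient k V s)) : (fun t => ℓ (u t)) ∈ polyFun k := by
  have : (fun t => ℓ (u t)) = ∑ c, ℓ (tensorBasis s b c) •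
      fun t => (tensorBasis s b).repr (u t) c := by
    ext t
    rw [dual_apply_eq_sum b, Finset.sum_apply]
    exact Finset.sum_congr rfl fun c _ => mul_comm _ _
  rw [this]
  exact sum_mem fun c _ => Subalgebra.smul_mem _ (hu c) _

/-! ### The affine chart of the Segre–Veronese variety -/

/-- The vectors with coordinates `(1, x)`. -/
def affVec (x : (Σ i : Fin n, Fin (d i)) → k) (i : Fin n) : V i := (b i).equivFun.symm (hat x i)

lemma repr_affVec (x : (Σ i : Fin n, Fin (d i)) → k) (i : Fin n) (j : Fin (d i + 1)) :
    (b i).repr (affVec b x i) j = hat x i j := by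
  rw [← Module.Basis.equivFun_apply, affVec, LinearEquiv.apply_symm_apply]

lemma repr_powTensor_affVec (x : (Σ i : Fin n, Fin (d i)) → k) (c : Coloring d s) :
    (tensorBasis s b).repr (powTensor k s (affVec b x)) c = mon x c := by
  rw [tensorBasis_repr_powTensor]
  simp only [repr_affVec]
  rfl

lemma affVec_ne_zero (x : (Σ i : Fin n, Fin (d i)) → k) (i : Fin n) : affVec b x i ≠ 0 := by
  intro h
  have := repr_affVec b x i 0
  rw [h] at this
  simp at this

lemma powTensor_ne_zero [∀ i, FiniteDimensional k (V i)] {v : ∀ i, V i} (hv : ∀ i, v i ≠ 0) :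
    powTensor k s v ≠ 0 := by
  choose φ hφ using fun i => Module.Projective.exists_dual_eq_one k (hv i)
  intro h
  have := powerForm_tprod (s := s) φ fun p => v p.1
  change powerForm s φ (powTensor k s v) = _ at this
  rw [h, map_zero] at this
  simp [hφ] at this

/-- The point of the Segre–Veronese variety given by nonzero vectors. -/
lemma exists_mem_segreVeronese [∀ i, FiniteDimensional k (V i)] {v : ∀ i, V i}
    (hv : ∀ i, v i ≠ 0) :
    ∃ x ∈ segreVeronese k V s, x.submodule = Submodule.span k {powTensor k s v} :=
  ⟨Projectivization.mk k _ (powTensor_ne_zero hv), ⟨v, hv, Projectivization.submodule_mk _ _⟩,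
    Projectivization.submodule_mk _ _⟩

lemma eq_smul_affVec {i : Fin n} {v : ∀ i, V i} (h : (b i).repr (v i) 0 ≠ 0) :
    v i = (b i).repr (v i) 0 • affVec b
      (fun q => ((b q.1).repr (v q.1) 0)⁻¹ * (b q.1).repr (v q.1) q.2.succ) i := by
  refine (b i).ext_elem fun j => ?_
  rw [map_smul, Finsupp.smul_apply, repr_affVec, smul_eq_mul]
  cases j using Fin.cases with
  | zero => simp
  | succ j => simp [h]

lemma powTensor_eq_smul {v : ∀ i, V i} (h : ∀ i, (b i).repr (v i) 0 ≠ 0) :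
    ∃ (r : k) (x : (Σ i : Fin n, Fin (d i)) → k),
      powTensor k s v = r • powTensor k s (affVec b x) := by
  refine ⟨∏ p : (Σ i, Fin (s i)), (b p.1).repr (v p.1) 0,
    fun q => ((b q.1).repr (v q.1) 0)⁻¹ * (b q.1).repr (v q.1) q.2.succ, ?_⟩
  have := MultilinearMap.map_smul_univ (PiTensorProduct.tprod k (s := fun p : (Σ i, Fin (s i)) =>
    V p.1)) (fun p => (b p.1).repr (v p.1) 0) fun p => affVec b
      (fun q => ((b q.1).repr (v q.1) 0)⁻¹ * (b q.1).repr (v q.1) q.2.succ) p.1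
  rw [powTensor, powTensor, ← this]
  congr 1
  ext p : 1
  exact eq_smul_affVec b (h p.1)

end Coordinates

/-! ### Exponents -/

section Exponents

variable {n : ℕ} {d s : Fin n → ℕ}

/-- A lattice point of `P` as an exponent. -/
def latticeExp (m : LatticePoint d s) : (Σ i : Fin n, Fin (d i)) →₀ ℕ :=
  Finsupp.equivFunOnFinite.symm fun q => (m.1 q).toNat

lemma latticeExp_apply (m : LatticePoint d s) (q : Σ i : Fin n, Fin (d i)) :
    (latticeExp m q : ℤ) = m.1 q := by
  have : (0 : ℚ) ≤ m.1 q := m.2.1 q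
  exact Int.toNat_of_nonneg (by exact_mod_cast this)

lemma mem_range_latticeExp {m : (Σ i : Fin n, Fin (d i)) →₀ ℕ} :
    m ∈ Set.range (latticeExp (d := d) (s := s)) ↔ (∀ i, ∑ j, m ⟨i, j⟩ ≤ s i) ∧ 2 ≤ ∑ q, m q := by
  constructor
  · rintro ⟨m, rfl⟩
    have h1 (q) : (m.1 q : ℚ) = (latticeExp m q : ℚ) := by exact_mod_cast (latticeExp_apply m q).symm
    have h2 := m.2.2
    simp only [h1] at h2
    exact ⟨fun i => by exact_mod_cast h2.1 i, by exact_mod_cast h2.2⟩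
  · rintro ⟨h1, h2⟩
    refine ⟨⟨fun q => (m q : ℤ), fun q => ?_, fun i => ?_, ?_⟩, ?_⟩
    · change (0 : ℚ) ≤ ((m q : ℤ) : ℚ)
      exact_mod_cast Nat.zero_le (m q)
    · change ∑ j, ((m ⟨i, j⟩ : ℤ) : ℚ) ≤ s i
      exact_mod_cast h1 i
    · change (2 : ℚ) ≤ ∑ q, ((m q : ℤ) : ℚ)
      exact_mod_cast h2
    · ext q
      simp [latticeExp]

lemma latticeExp_injective : Function.Injective (latticeExp (d := d) (s := s)) := fun a b h => by
  ext q
  rw [← latticeExp_apply, ← latticeExp_apply, h]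

lemma range_latticeExp : Set.range (latticeExp (d := d) (s := s)) =
    mdeg '' {c : Coloring d s | 2 ≤ (csupp c).card} := by
  ext m
  rw [mem_range_latticeExp]
  constructor
  · rintro ⟨h1, h2⟩
    obtain ⟨c, rfl⟩ := exists_mdeg_eq m h1
    exact ⟨c, by rwa [sum_mdeg] at h2, rfl⟩
  · rintro ⟨c, hc, rfl⟩
    exact ⟨sum_mdeg_le c, by rwa [sum_mdeg]⟩

instance finite_latticePoint : Finite (LatticePoint d s) := by
  have : (Set.range (latticeExp (d := d) (s := s))).Finite := by
    rw [range_latticeExp]; exact Set.toFinite _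
  exact (Set.finite_range_iff latticeExp_injective).1 this

/-- The exponents of the toric structure of the charts of the secant variety. -/
def secExp : (Σ i : Fin n, Fin (d i)) ⊕ LatticePoint d s →
    (Σ i : Fin n, Fin (d i)) ⊕ Option (Σ i : Fin n, Fin (d i)) →₀ ℕ
  | Sum.inl q => Finsupp.single (Sum.inl q) 1
  | Sum.inr m => Finsupp.single (Sum.inr none) 1 + (latticeExp m).mapDomain (Sum.inr ∘ some)

/-- The exponents of the toric structure of the charts of the tangential variety. -/
def tanExp : (Σ i : Fin n, Fin (d i)) ⊕ LatticePoint d s →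
    (Σ i : Fin n, Fin (d i)) ⊕ (Σ i : Fin n, Fin (d i)) →₀ ℕ
  | Sum.inl q => Finsupp.single (Sum.inl q) 1
  | Sum.inr m => (latticeExp m).mapDomain Sum.inr

variable {k : Type u} [Field k]

lemma eval_monomial_mapDomain {σ τ : Type} [Fintype σ] (f : σ → τ) (hf : Function.Injective f)
    (m : σ →₀ ℕ) (x : τ → k) :
    MvPolynomial.eval x (MvPolynomial.monomial (m.mapDomain f) 1) = ∏ q, x (f q) ^ m q := by
  rw [MvPolynomial.eval_monomial, one_mul, Finsupp.prod_mapDomain_index_inj hf,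
    Finsupp.prod_fintype _ _ (fun _ => pow_zero _)]

lemma eval_secExp_inl (x : (Σ i : Fin n, Fin (d i)) ⊕ Option (Σ i : Fin n, Fin (d i)) → k)
    (q : Σ i : Fin n, Fin (d i)) : MvPolynomial.eval x (MvPolynomial.monomial
      (secExp (s := s) (Sum.inl q)) 1) = x (Sum.inl q) := by
  rw [secExp]
  exact MvPolynomial.eval_X _

lemma eval_secExp_inr (x : (Σ i : Fin n, Fin (d i)) ⊕ Option (Σ i : Fin n, Fin (d i)) → k)
    (m : LatticePoint d s) : MvPolynomial.eval x (MvPolynomial.monomial (secExp (Sum.inr m)) 1) =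
      x (Sum.inr none) * ∏ q, x (Sum.inr (some q)) ^ latticeExp m q := by
  rw [secExp, ← one_mul (1 : k), ← MvPolynomial.monomial_mul, map_mul, eval_monomial_mapDomain _
    (Sum.inr_injective.comp (Option.some_injective _))]
  congr 1
  exact MvPolynomial.eval_X _

lemma eval_tanExp_inl (x : (Σ i : Fin n, Fin (d i)) ⊕ (Σ i : Fin n, Fin (d i)) → k)
    (q : Σ i : Fin n, Fin (d i)) : MvPolynomial.eval x (MvPolynomial.monomial
      (tanExp (s := s) (Sum.inl q)) 1) = x (Sum.inl q) := by
  rw [tanExp]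
  exact MvPolynomial.eval_X _

lemma eval_tanExp_inr (x : (Σ i : Fin n, Fin (d i)) ⊕ (Σ i : Fin n, Fin (d i)) → k)
    (m : LatticePoint d s) : MvPolynomial.eval x (MvPolynomial.monomial (tanExp (Sum.inr m)) 1) =
      ∏ q, x (Sum.inr q) ^ latticeExp m q := by
  rw [tanExp, eval_monomial_mapDomain _ Sum.inr_injective]

/-- Families indexed by lattice points of `P` and by colorings have the same members. -/
lemma range_latticePoint_eq_image {B : Type*} (f : ((Σ i : Fin n, Fin (d i)) →₀ ℕ) → B) :
    Set.range (fun m : LatticePoint d s => f (latticeExp m)) =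
      (fun c => f (mdeg c)) '' {c : Coloring d s | 2 ≤ (csupp c).card} := by
  have h1 : Set.range (fun m : LatticePoint d s => f (latticeExp m)) =
      f '' Set.range (latticeExp (d := d) (s := s)) := by rw [← Set.range_comp]; rfl
  rw [h1, range_latticeExp, Set.image_image]

end Exponents

/-! ### Charts of the secant variety -/

section Secant

variable {k : Type u} [Field k] {n : ℕ} {V : Fin n → Type u} [∀ i, AddCommGroup (V i)]
  [∀ i, Module k (V i)] {s d : Fin n → ℕ} (b : ∀ i, Module.Basis (Fin (d i + 1)) k (V i))

variable (k V s) in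
/-- The union of the secant lines. -/
def secantLines : Set (ℙ k (Ambient k V s)) :=
  {x | ∃ p ∈ segreVeronese k V s, ∃ q ∈ segreVeronese k V s,
    x.submodule ≤ p.submodule ⊔ q.submodule}

lemma mem_polyFun_id : (fun t : k => t) ∈ polyFun k := mem_polyFun.2 ⟨Polynomial.X, by simp⟩

lemma mem_polyFun_const (a : k) : (fun _ : k => a) ∈ polyFun k :=
  mem_polyFun.2 ⟨Polynomial.C a, by simp⟩

lemma repr_mem_polyFun (v e : ∀ i, V i) (i : Fin n) (j : Fin (d i + 1)) :
    (fun t : k => (b i).repr (v i + t • e i) j) ∈ polyFun k := by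
  have : (fun t : k => (b i).repr (v i + t • e i) j) =
      (fun _ => (b i).repr (v i) j) + (fun t => t) * fun _ => (b i).repr (e i) j := by
    ext t; simp
  rw [this]
  exact add_mem (mem_polyFun_const _) (mul_mem mem_polyFun_id (mem_polyFun_const _))

lemma powTensor_mem_polyFun (v e : ∀ i, V i) (c : Coloring d s) :
    (fun t : k => (tensorBasis s b).repr (powTensor k s fun i => v i + t • e i) c) ∈ polyFun k := by
  have : (fun t : k => (tensorBasis s b).repr (powTensor k s fun i => v i + t • e i) c) =
      ∏ p : (Σ i, Fin (s i)), fun t : k => (b p.1).repr (v p.1 + t • e p.1) (c p) := by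
    ext t; rw [tensorBasis_repr_powTensor, Finset.prod_apply]; rfl
  rw [this]
  exact prod_mem fun p _ => repr_mem_polyFun b v e p.1 (c p)

/-- A generic translate by the first basis vectors lies in the affine chart. -/
lemma exists_generic [Infinite k] (v : ∀ i, V i) : ∃ g ∈ polyFun k, (g ≠ 0) ∧
    ∀ t, g t ≠ 0 → ∀ i, (b i).repr (v i + t • b i 0) 0 ≠ 0 := by
  let P : Polynomial k := ∏ i, (Polynomial.X + Polynomial.C ((b i).repr (v i) 0))
  have hP : P.Monic := Polynomial.monic_prod_of_monic _ _ fun i _ => Polynomial.monic_X_add_C _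
  refine ⟨fun t => P.eval t, mem_polyFun.2 ⟨P, fun _ => rfl⟩, fun h => hP.ne_zero ?_,
    fun t ht i => ?_⟩
  · exact Polynomial.funext fun t => by rw [Polynomial.eval_zero]; exact congrFun h t
  · simp only [P, Polynomial.eval_prod] at ht
    have := Finset.prod_ne_zero_iff.1 ht i (Finset.mem_univ i)
    simpa [add_comm] using this

variable (s) in
/-- The points of secant lines of the affine part of the Segre–Veronese variety. -/
def secPoint (α : k) (x y : (Σ i : Fin n, Fin (d i)) → k) : Ambient k V s :=
  α • powTensor k s (affVec b x) + (1 - α) • powTensor k s (affVec b y)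

lemma repr_secPoint (α : k) (x y : (Σ i : Fin n, Fin (d i)) → k) (c : Coloring d s) :
    (tensorBasis s b).repr (secPoint s b α x y) c = α * mon x c + (1 - α) * mon y c := by
  rw [secPoint, map_add, map_smul, map_smul, Finsupp.add_apply, Finsupp.smul_apply,
    Finsupp.smul_apply, repr_powTensor_affVec, repr_powTensor_affVec, smul_eq_mul, smul_eq_mul]

lemma mon_zero_coloring {R : Type*} [CommSemiring R] (x : (Σ i : Fin n, Fin (d i)) → R) :
    mon x (fun _ => 0 : Coloring d s) = 1 := by
  simp [mon]

/-- A polynomial that vanishes at the generic points of secant lines vanishes on the chart. -/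
lemma vanishes_on_secantLines [Infinite k] [NeZero (2 : k)]
    (F : MvPolynomial (Module.Dual k (Ambient k V s)) k)
    (hF : ∀ α x y, 1 - 2 * α ≠ 0 → polyEval (secPoint s b α x y) F = 0)
    {x : ℙ k (Ambient k V s)} (hx : x ∈ secantLines k V s)
    (hℓ : powerForm s (fun i => (b i).coord 0) x.rep ≠ 0) :
    polyEval ((powerForm s (fun i => (b i).coord 0) x.rep)⁻¹ • x.rep) F = 0 := by
  set ℓ := powerForm s (fun i => (b i).coord 0) with hℓdef
  have hsec (α x y) : ℓ (secPoint s b α x y) = 1 := by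
    rw [hℓdef, powerForm_coord_zero, repr_secPoint, mon_zero_coloring, mon_zero_coloring]; ring
  -- The excluded value `α = 1/2` is reached by moving `α` along the secant line.
  have h1 (α x y) : polyEval (secPoint s b α x y) F = 0 := by
    have hcurve := polyEval_eq_zero_of_curve ℓ F (u := fun t => secPoint s b (α + t) x y)
      (g := fun t => 1 - 2 * (α + t)) (dual_mem_polyFun b fun c => ?_) ?_ ?_ ?_ ?_
    · simpa [hsec] using hcurve
    · have : (fun t => (tensorBasis s b).repr (secPoint s b (α + t) x y) c) =
          ((fun _ => α) + fun t => t) * (fun _ => mon x c) +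
            ((fun _ => 1 - α) - fun t => t) * fun _ => mon y c := by
        ext t
        rw [repr_secPoint]
        simp only [Pi.add_apply, Pi.mul_apply, Pi.sub_apply]
        ring
      rw [this]
      exact add_mem (mul_mem (add_mem (mem_polyFun_const _) mem_polyFun_id) (mem_polyFun_const _))
        (mul_mem (sub_mem (mem_polyFun_const _) mem_polyFun_id) (mem_polyFun_const _))
    · exact sub_mem (mem_polyFun_const _) (mul_mem (mem_polyFun_const _)
        (add_mem (mem_polyFun_const _) mem_polyFun_id))
    · intro h0
      have := congrFun h0 (-α)
      simp at this
    · intro t ht _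
      rw [hsec, inv_one, one_smul]
      exact hF _ _ _ ht
    · rw [hsec]; exact one_ne_zero
  obtain ⟨p, ⟨v, -, hp⟩, q, ⟨w, -, hq⟩, hx⟩ := hx
  rw [hp, hq] at hx
  have hrep : x.rep ∈ x.submodule := by
    rw [Projectivization.submodule_eq]; exact Submodule.mem_span_singleton_self _
  obtain ⟨y, hy, y', hy', hyy⟩ := Submodule.mem_sup.1 (hx hrep)
  obtain ⟨α, rfl⟩ := Submodule.mem_span_singleton.1 hy
  obtain ⟨β, rfl⟩ := Submodule.mem_span_singleton.1 hy'
  -- The two points of `X` may lie outside the chart even if `x` lies in it. Translating both by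
  -- multiples of the first basis vectors brings them into the chart for all but finitely many `t`.
  let u : k → Ambient k V s := fun t => α • powTensor k s (fun i => v i + t • b i 0) +
    β • powTensor k s fun i => w i + t • b i 0
  have hu0 : u 0 = x.rep := by
    rw [← hyy]
    simp [u, powTensor]
  obtain ⟨g, hg, hg0, hgv⟩ := exists_generic b v
  obtain ⟨g', hg', hg0', hgw⟩ := exists_generic b w
  rw [← hu0] at hℓ ⊢
  refine polyEval_eq_zero_of_curve ℓ F (g := g * g') (dual_mem_polyFun b fun c => ?_)
    (mul_mem hg hg') ?_ ?_ hℓ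
  · have : (fun t => (tensorBasis s b).repr (u t) c) =
        (fun _ => α) * (fun t => (tensorBasis s b).repr (powTensor k s fun i => v i + t • b i 0) c) +
        (fun _ => β) *
          fun t => (tensorBasis s b).repr (powTensor k s fun i => w i + t • b i 0) c := by
      ext t; simp [u]
    rw [this]
    exact add_mem (mul_mem (mem_polyFun_const _) (powTensor_mem_polyFun b v _ c))
      (mul_mem (mem_polyFun_const _) (powTensor_mem_polyFun b w _ c))
  · intro h0
    exact hg0 (polyFun_eq_zero hg hg' hg0' fun t ht => by
      have := congrFun h0 t
      simpa [ht] using this)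
  · intro t ht hut
    rw [Pi.mul_apply, mul_ne_zero_iff] at ht
    obtain ⟨r, x', h3⟩ := powTensor_eq_smul (s := s) b (hgv t ht.1)
    obtain ⟨r', y', h4⟩ := powTensor_eq_smul (s := s) b (hgw t ht.2)
    have hut' : u t = (α * r) • powTensor k s (affVec b x') +
        (β * r') • powTensor k s (affVec b y') := by
      simp only [u, h3, h4, smul_smul]
    have hone (x : (Σ i : Fin n, Fin (d i)) → k) : ℓ (powTensor k s (affVec b x)) = 1 := by
      rw [hℓdef, powerForm_coord_zero, repr_powTensor_affVec, mon_zero_coloring]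
    have hval : ℓ (u t) = α * r + β * r' := by
      rw [hut', map_add, map_smul, map_smul, hone, hone]; simp
    have : (ℓ (u t))⁻¹ • u t = secPoint s b ((ℓ (u t))⁻¹ * (α * r)) x' y' := by
      have h5 : (ℓ (u t))⁻¹ • u t = (ℓ (u t))⁻¹ • ((α * r) • powTensor k s (affVec b x') +
          (β * r') • powTensor k s (affVec b y')) := congrArg _ hut'
      rw [h5, smul_add, smul_smul, smul_smul, secPoint]
      congr 2
      -- After normalization the two coefficients add up to one, because the form is `1` at both
      -- points.
      rw [eq_sub_iff_add_eq, ← mul_add, add_comm (β * r'), ← hval, inv_mul_cancel₀ hut]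
    rw [this]
    exact h1 _ _ _

lemma mon_apply {Θ : Type*} (x : (Σ i : Fin n, Fin (d i)) → Θ → k) (c : Coloring d s) (θ : Θ) :
    mon x c θ = mon (fun q => x q θ) c :=
  map_mon (Pi.evalRingHom (fun _ : Θ => k) θ) x c

lemma mon_mul_add {R : Type*} [CommSemiring R] (r : R) (z μ : (Σ i : Fin n, Fin (d i)) → R)
    (c : Coloring d s) : mon (fun q => r * z q + μ q) c = ∑ J ∈ (csupp c).powerset,
      r ^ J.card * mon z (restr c J) * mon μ (restr c (csupp c \ J)) := by
  refine (mon_add (fun q => r * z q) μ c).trans (Finset.sum_congr rfl fun J hJ => ?_)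
  rw [mon_mul, csupp_restr (Finset.mem_powerset.1 hJ)]

/-- The coordinate ring of a chart of the secant variety. -/
theorem nonempty_secant_chart_equiv [IsAlgClosed k] [CharZero k] [∀ i, FiniteDimensional k (V i)]
    (hs : ∀ i, 0 < s i) :
    Nonempty (chartRing (secantVariety (segreVeronese k V s))
      (powerForm s fun i => (b i).coord 0) ≃ₐ[k]
        monomialAlgebra k (Set.range (secExp (d := d) (s := s)))) := by
  let Θ := {θ : k × ((Σ i : Fin n, Fin (d i)) → k) × ((Σ i : Fin n, Fin (d i)) → k) //
    1 - 2 * θ.1 ≠ 0}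
  let π : Θ → Ambient k V s := fun θ => secPoint s b θ.1.1 θ.1.2.1 θ.1.2.2
  obtain ⟨e1⟩ := nonempty_chartRing_equiv (secantLines k V s)
    (powerForm s fun i => (b i).coord 0) π (fun θ => by
      have h1 : powerForm s (fun i => (b i).coord 0) (π θ) = 1 := by
        rw [powerForm_coord_zero, repr_secPoint, mon_zero_coloring, mon_zero_coloring]; ring
      refine ⟨h1, Projectivization.mk k (π θ) (fun h0 => by simp [h0] at h1), ?_,
        Projectivization.submodule_mk _ _⟩
      obtain ⟨p, hp, hp'⟩ := exists_mem_segreVeronese (k := k) (s := s) (affVec_ne_zero b θ.1.2.1)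
      obtain ⟨q, hq, hq'⟩ := exists_mem_segreVeronese (k := k) (s := s) (affVec_ne_zero b θ.1.2.2)
      refine ⟨p, hp, q, hq, ?_⟩
      rw [Projectivization.submodule_mk, Submodule.span_singleton_le_iff_mem, hp', hq']
      exact Submodule.add_mem_sup (Submodule.smul_mem _ _ (Submodule.mem_span_singleton_self _))
        (Submodule.smul_mem _ _ (Submodule.mem_span_singleton_self _)))
    (fun F hF x hx hℓ => vanishes_on_secantLines b F
      (fun α x y h => hF ⟨⟨α, x, y⟩, h⟩) hx hℓ)
  let μ : (Σ i : Fin n, Fin (d i)) → Θ → k := fun q θ =>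
    θ.1.1 * θ.1.2.1 q + (1 - θ.1.1) * θ.1.2.2 q
  let z : (Σ i : Fin n, Fin (d i)) → Θ → k := fun q θ => θ.1.2.1 q - θ.1.2.2 q
  let κ : ℕ → Θ → k := fun r θ => θ.1.1 * (1 - θ.1.1) ^ r + (1 - θ.1.1) * (-θ.1.1) ^ r
  let C : Θ → k := fun θ => 1 - 2 * θ.1.1
  let q : Θ → k := fun θ => θ.1.1 * (1 - θ.1.1)
  -- The truncated exponent matters only in degree at least two; there `e c` equals `q / C ^ 2`
  -- times the monomial of `c` in `C * z`.
  let e : Coloring d s → Θ → k := fun c => q * C ^ ((csupp c).card - 2) * mon z c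
  have hκ0 : κ 0 = 1 := by ext θ; simp [κ]
  have hκ1 : κ 1 = 0 := by ext θ; simp [κ]; ring
  have hM := adjoin_moments_eq (k := k) hs μ z κ hκ0 hκ1
    (fun (c : Coloring d s) (θ : Θ) => (tensorBasis s b).repr (π θ) c) e (fun c => by
      ext θ
      rw [repr_secPoint, Finset.sum_apply]
      have hx : θ.1.2.1 = fun q => (1 - θ.1.1) * z q θ + μ q θ := by
        ext q; simp only [z, μ]; ring
      have hy : θ.1.2.2 = fun q => (-θ.1.1) * z q θ + μ q θ := by
        ext q; simp only [z, μ]; ring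
      have hx' : mon θ.1.2.1 c = _ := (congrArg (fun x => mon x c) hx).trans
        (mon_mul_add (1 - θ.1.1) (fun q => z q θ) (fun q => μ q θ) c)
      have hy' : mon θ.1.2.2 c = _ := (congrArg (fun x => mon x c) hy).trans
        (mon_mul_add (-θ.1.1) (fun q => z q θ) (fun q => μ q θ) c)
      rw [hx', hy', Finset.mul_sum, Finset.mul_sum, ← Finset.sum_add_distrib]
      refine Finset.sum_congr rfl fun J _ => ?_
      simp only [Pi.mul_apply, mon_apply, κ]
      ring)
    (fun c hc => ⟨1, one_ne_zero, by
      have := central_moment_sub_mem (k := k) z κ C q hκ0 hκ1 (fun r => by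
        ext θ; simp only [κ, C, q, Pi.add_apply, Pi.mul_apply]; ring) e (fun c => rfl)
        ((csupp c).card - 2) 0 c (by omega)
      rw [pow_zero, one_mul, Nat.sub_add_cancel hc] at this
      rwa [one_smul]⟩)
  let ρ : Θ → (Σ i : Fin n, Fin (d i)) ⊕ Option (Σ i : Fin n, Fin (d i)) → k := fun θ =>
    Sum.elim (fun q => μ q θ) fun o => o.elim (q θ / C θ ^ 2) fun i => C θ * z i θ
  obtain ⟨e2⟩ := nonempty_monomialAlgebra_equiv ρ (fun P hP => by
    -- Since `C² = 1 - 4q`, the coordinate `T = q / C²` satisfies `1 + 4T = C⁻²`. So `ρ` can only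
    -- miss the hypersurface `1 + 4T = 0`; elsewhere a square root `c` of `(1 + 4T)⁻¹` serves as
    -- `C`, with `α = (1 - c) / 2`.
    have h0 : P * (1 + 4 * MvPolynomial.X (Sum.inr none)) = 0 := by
      refine MvPolynomial.funext fun x => ?_
      simp only [map_mul, map_add, map_one, map_ofNat, MvPolynomial.eval_X, map_zero]
      by_cases hx : 1 + 4 * x (Sum.inr none) = 0
      · rw [hx, mul_zero]
      obtain ⟨c, hc⟩ := IsAlgClosed.exists_pow_nat_eq (1 + 4 * x (Sum.inr none))⁻¹ two_pos
      have hc0 : c ≠ 0 := by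
        rintro rfl
        exact inv_ne_zero hx (by rw [← hc]; simp)
      have hα : 1 - 2 * ((1 - c) / 2) = c := by ring
      have hρ : ρ ⟨⟨(1 - c) / 2, fun i => x (Sum.inl i) + (1 - (1 - c) / 2) *
          (c⁻¹ * x (Sum.inr (some i))), fun i => x (Sum.inl i) - (1 - c) / 2 *
          (c⁻¹ * x (Sum.inr (some i)))⟩, by rwa [hα]⟩ = x := by
        ext (i | _ | i)
        · simp only [ρ, μ, Sum.elim_inl]
          ring
        · simp only [ρ, q, C, Sum.elim_inr, Option.elim, hα]
          have h1 : x (Sum.inr none) = ((c ^ 2)⁻¹ - 1) / 4 := by rw [hc, inv_inv]; ring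
          rw [h1]
          field_simp
          ring
        · simp only [ρ, z, C, Sum.elim_inr, Option.elim, hα]
          field_simp
          ring
      rw [← hρ, hP, zero_mul]
    refine (mul_eq_zero.1 h0).resolve_right fun h => ?_
    have := congrArg (MvPolynomial.eval 0) h
    simp at this) (secExp (d := d) (s := s))
  have hgen : (Set.range fun i (θ : Θ) => MvPolynomial.eval (ρ θ)
      (MvPolynomial.monomial (secExp (d := d) (s := s) i) 1)) =
      Set.range μ ∪ e '' {c | 2 ≤ (csupp c).card} := by
    rw [Sum.range_eq]
    congr 1
    · congr 1
      ext i θ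
      exact eval_secExp_inl _ _
    · let f : ((Σ i : Fin n, Fin (d i)) →₀ ℕ) → Θ → k := fun m θ => q θ / C θ ^ 2 *
        ∏ i, (C θ * z i θ) ^ m i
      have h1 : (fun i (θ : Θ) => MvPolynomial.eval (ρ θ)
          (MvPolynomial.monomial (secExp (d := d) (s := s) i) 1)) ∘ Sum.inr =
          fun m : LatticePoint d s => f (latticeExp m) := by
        ext m θ
        exact eval_secExp_inr _ _
      rw [h1]
      refine (range_latticePoint_eq_image f).trans (Set.image_congr fun c hc => ?_)
      ext θ
      have h2 := mon_eq_prod_mdeg (fun i => C θ * z i θ) c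
      rw [mon_mul] at h2
      have hC : C θ ≠ 0 := θ.2
      have h3 : C θ ^ (csupp c).card = C θ ^ ((csupp c).card - 2) * C θ ^ 2 := by
        rw [← pow_add, Nat.sub_add_cancel hc]
      simp only [f, ← h2, e, Pi.mul_apply, Pi.pow_apply, mon_apply, h3]
      field_simp
  exact ⟨e1.trans ((Subalgebra.equivOfEq _ _ (by
    rw [adjoin_dual_eq_adjoin_repr b, hM, ← hgen])).trans e2.symm)⟩

end Secant

/-! ### Charts of the tangential variety -/

section DualNumbers

variable {k : Type u} [Field k]

lemma fst_prod_dual {ι : Type*} (S : Finset ι) (f : ι → DualNumber k) :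
    (∏ p ∈ S, f p).fst = ∏ p ∈ S, (f p).fst :=
  map_prod (TrivSqZeroExt.fstHom k k k) f S

/-- The Leibniz rule, read off from the `ε`-part. -/
lemma snd_prod_dual {ι : Type*} [DecidableEq ι] (S : Finset ι) (f : ι → DualNumber k) :
    (∏ p ∈ S, f p).snd = ∑ p ∈ S, (f p).snd * ∏ p' ∈ S.erase p, (f p').fst := by
  induction S using Finset.induction_on with
  | empty => simp
  | insert a S ha ih =>
    rw [Finset.prod_insert ha, TrivSqZeroExt.snd_mul, ih, fst_prod_dual, Finset.sum_insert ha,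
      Finset.erase_insert ha, add_comm]
    congr 1
    rw [Finset.smul_sum]
    refine Finset.sum_congr rfl fun p hp => ?_
    have hpa : p ≠ a := fun h => ha (h ▸ hp)
    rw [Finset.erase_insert_of_ne hpa.symm, Finset.prod_insert (by simp [ha])]
    simp only [smul_eq_mul]
    ring

lemma snd_inl_mul (a : k) (x : DualNumber k) : (TrivSqZeroExt.inl a * x).snd = a * x.snd := by
  simp

end DualNumbers

section Tangent

variable {k : Type u} [Field k] {n : ℕ} {V : Fin n → Type u} [∀ i, AddCommGroup (V i)]
  [∀ i, Module k (V i)] {s d : Fin n → ℕ} (b : ∀ i, Module.Basis (Fin (d i + 1)) k (V i))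

variable (k s) in
/-- The derivative of `v ↦ v₁^{⊗ s₁} ⊗ ⋯ ⊗ vₙ^{⊗ sₙ}` in the direction `ω`. -/
def derivTensor (v ω : ∀ i, V i) : Ambient k V s :=
  ∑ p : (Σ i, Fin (s i)), PiTensorProduct.tprod k (Function.update (fun p => v p.1) p (ω p.1))

/-- The coordinates of a vector and of a tangent direction, in the dual numbers. -/
def dualCoord (v ω : ∀ i, V i) (i : Fin n) (j : Fin (d i + 1)) : DualNumber k :=
  TrivSqZeroExt.inl ((b i).repr (v i) j) + TrivSqZeroExt.inr ((b i).repr (ω i) j)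

lemma fst_hmon_dualCoord (v ω : ∀ i, V i) (c : Coloring d s) :
    (hmon (dualCoord b v ω) c).fst = (tensorBasis s b).repr (powTensor k s v) c := by
  rw [tensorBasis_repr_powTensor, hmon, fst_prod_dual]
  simp [dualCoord, hmon]

lemma repr_derivTensor (v ω : ∀ i, V i) (c : Coloring d s) :
    (tensorBasis s b).repr (derivTensor k s v ω) c = (hmon (dualCoord b v ω) c).snd := by
  classical
  rw [derivTensor, map_sum, Finsupp.finsetSum_apply, hmon, snd_prod_dual]
  refine Finset.sum_congr rfl fun p _ => ?_
  rw [tensorBasis_repr_tprod, ← Finset.mul_prod_erase _ _ (Finset.mem_univ p)]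
  congr 1
  · rw [Function.update_self]; simp [dualCoord]
  · refine Finset.prod_congr rfl fun p' hp' => ?_
    rw [Function.update_of_ne (Finset.ne_of_mem_erase hp')]
    simp [dualCoord]

/-- The vectors with coordinates `(0, y)`. -/
def dirVec (y : (Σ i : Fin n, Fin (d i)) → k) (i : Fin n) : V i :=
  (b i).equivFun.symm (Fin.cons 0 fun j => y ⟨i, j⟩)

/-- The point `x + ε y` with coordinates in the dual numbers. -/
def dualPoint (x y : (Σ i : Fin n, Fin (d i)) → k) (q : Σ i : Fin n, Fin (d i)) : DualNumber k :=
  TrivSqZeroExt.inl (x q) + TrivSqZeroExt.inr (y q)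

lemma dualCoord_affVec (x y : (Σ i : Fin n, Fin (d i)) → k) :
    dualCoord b (affVec b x) (dirVec b y) = hat (dualPoint x y) := by
  ext i j : 2
  rw [dualCoord, repr_affVec, ← Module.Basis.equivFun_apply, dirVec, LinearEquiv.apply_symm_apply]
  cases j using Fin.cases with
  | zero => simp
  | succ j => simp [dualPoint]

lemma fst_mon_dualPoint (x y : (Σ i : Fin n, Fin (d i)) → k) (c : Coloring d s) :
    (mon (dualPoint x y) c).fst = mon x c := by
  have := map_mon (TrivSqZeroExt.fstHom k k k).toRingHom (dualPoint x y) c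
  refine this.trans ?_
  congr 1
  ext q
  simp [dualPoint]

lemma snd_mon_dualPoint_mul (r : k) (x y : (Σ i : Fin n, Fin (d i)) → k) (c : Coloring d s) :
    (mon (dualPoint x fun q => r * y q) c).snd = r * (mon (dualPoint x y) c).snd := by
  classical
  rw [mon_eq_prod_csupp, mon_eq_prod_csupp, snd_prod_dual, snd_prod_dual, Finset.mul_sum]
  refine Finset.sum_congr rfl fun p hp => ?_
  have h1 (y) (p : Σ i, Fin (s i)) : (hat (dualPoint x y) p.1 (c p)).fst = hat x p.1 (c p) := by
    generalize c p = j
    cases j using Fin.cases <;> simp [dualPoint]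
  simp only [h1]
  rw [← mul_assoc]
  congr 1
  obtain ⟨j, hj⟩ := Fin.exists_succ_eq.2 (mem_csupp.1 hp)
  rw [← hj]
  simp [dualPoint]

lemma repr_derivTensor_affVec (x y : (Σ i : Fin n, Fin (d i)) → k) (c : Coloring d s) :
    (tensorBasis s b).repr (derivTensor k s (affVec b x) (dirVec b y)) c =
      (mon (dualPoint x y) c).snd := by
  rw [repr_derivTensor, dualCoord_affVec, hmon_hat]

/-- Derivatives of the parametrization are tangent vectors. -/
lemma isTangentVector_derivTensor [Infinite k] [∀ i, FiniteDimensional k (V i)]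
    (x y : (Σ i : Fin n, Fin (d i)) → k)
    {p : ℙ k (Ambient k V s)} (hp : p.submodule = Submodule.span k {powTensor k s (affVec b x)}) :
    IsTangentVector (segreVeronese k V s) p (derivTensor k s (affVec b x) (dirVec b y)) := by
  intro m f hf hX
  rw [Projectivization.submodule_eq, Submodule.span_singleton_eq_span_singleton] at hp
  obtain ⟨r, hr⟩ := hp
  have hr' : p.rep = ((r⁻¹ : kˣ) : k) • powTensor k s (affVec b x) := by
    rw [← hr, ← Units.smul_def, inv_smul_smul]
  generalize r⁻¹ = r at hr'
  -- The curve `t ↦ r • v(x + t r⁻¹ y)` lies on the cone over `X`, passes through `p.rep` at `t =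
  -- 0`, and has the given derivative there; `r⁻¹` compensates for the choice of representative. An
  -- equation of `X` vanishes identically along it, hence also at `t = ε`.
  let ξ : (Σ i : Fin n, Fin (d i)) → Polynomial k := fun q =>
    Polynomial.C (x q) + Polynomial.X * Polynomial.C ((r : k)⁻¹ * y q)
  let Q : Module.Dual k (Ambient k V s) → Polynomial k := fun ℓ =>
    ∑ c, Polynomial.C (r * ℓ (tensorBasis s b c)) * mon ξ c
  have hQeval (t : k) (ℓ : Module.Dual k (Ambient k V s)) : (Q ℓ).eval t =
      ℓ ((r : k) • powTensor k s (affVec b fun q => x q + t * ((r : k)⁻¹ * y q))) := by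
    rw [map_smul, dual_apply_eq_sum b, Polynomial.eval_finsetSum, Finset.smul_sum]
    refine Finset.sum_congr rfl fun c _ => ?_
    rw [repr_powTensor_affVec, Polynomial.eval_mul, Polynomial.eval_C, ← Polynomial.coe_evalRingHom,
      map_mon]
    simp only [ξ, Polynomial.coe_evalRingHom, Polynomial.eval_add, Polynomial.eval_mul,
      Polynomial.eval_C, Polynomial.eval_X, smul_eq_mul]
    ring
  have hQdual (ℓ : Module.Dual k (Ambient k V s)) : Polynomial.aeval (DualNumber.eps : DualNumber k)
      (Q ℓ) = TrivSqZeroExt.inl (ℓ p.rep) + TrivSqZeroExt.inr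
        (ℓ (derivTensor k s (affVec b x) (dirVec b y))) := by
    have hξ (c : Coloring d s) : Polynomial.aeval (DualNumber.eps : DualNumber k) (mon ξ c) =
        mon (dualPoint x fun q => (r : k)⁻¹ * y q) c := by
      refine (map_mon (Polynomial.aeval (DualNumber.eps : DualNumber k)).toRingHom ξ c).trans ?_
      congr 1
      ext q <;> simp [ξ, dualPoint, TrivSqZeroExt.algebraMap_eq_inl]
    rw [map_sum]
    simp only [map_mul, hξ, Polynomial.aeval_C]
    ext
    · rw [hr', map_smul, dual_apply_eq_sum b ℓ (powTensor k s (affVec b x))]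
      simp only [TrivSqZeroExt.fst_sum, TrivSqZeroExt.fst_add, TrivSqZeroExt.fst_inl,
        TrivSqZeroExt.fst_inr, add_zero, TrivSqZeroExt.fst_mul, TrivSqZeroExt.algebraMap_eq_inl,
        fst_mon_dualPoint, repr_powTensor_affVec, smul_eq_mul, Finset.mul_sum]
      exact Finset.sum_congr rfl fun c _ => by ring
    · rw [dual_apply_eq_sum b ℓ (derivTensor k s (affVec b x) (dirVec b y))]
      simp only [TrivSqZeroExt.snd_sum, TrivSqZeroExt.snd_add, TrivSqZeroExt.snd_inl,
        TrivSqZeroExt.snd_inr, zero_add, TrivSqZeroExt.algebraMap_eq_inl, ← TrivSqZeroExt.inl_mul,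
        snd_inl_mul, repr_derivTensor_affVec, snd_mon_dualPoint_mul]
      refine Finset.sum_congr rfl fun c _ => ?_
      field_simp
  have hzero : MvPolynomial.aeval Q f = 0 := by
    refine Polynomial.funext fun t => ?_
    have h1 : (MvPolynomial.aeval Q f).eval t = polyEval ((r : k) •
        powTensor k s (affVec b fun q => x q + t * ((r : k)⁻¹ * y q))) f := by
      have : (Polynomial.evalRingHom t).comp (MvPolynomial.aeval Q).toRingHom =
          MvPolynomial.eval fun ℓ => ℓ ((r : k) •
            powTensor k s (affVec b fun q => x q + t * ((r : k)⁻¹ * y q))) := by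
        ext ℓ
        · simp
        · simp [hQeval]
      exact DFunLike.congr_fun this f
    obtain ⟨z, hz, hz'⟩ := exists_mem_segreVeronese (k := k) (s := s)
      (affVec_ne_zero b fun q => x q + t * ((r : k)⁻¹ * y q))
    rw [h1, polyEval_smul hf, (polyEval_rep_eq_zero_iff hf z hz').1 (hX z hz), mul_zero,
      Polynomial.eval_zero]
  have hcomp : (Polynomial.aeval (DualNumber.eps : DualNumber k)).comp (MvPolynomial.aeval Q) =
      MvPolynomial.aeval fun ℓ => (TrivSqZeroExt.inl (ℓ p.rep) + TrivSqZeroExt.inr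
        (ℓ (derivTensor k s (affVec b x) (dirVec b y))) : DualNumber k) := by
    refine MvPolynomial.algHom_ext fun ℓ => ?_
    simp [hQdual]
  rw [← hcomp, AlgHom.comp_apply, hzero, map_zero]

/-! ### Tangent vectors from the equations of the variety -/

/-- The value of a linear form at a tensor and a tangent vector satisfies the linearized
equations. -/
lemma repr_eq_of_isTangentVector {p : ℙ k (Ambient k V s)} {w : Ambient k V s}
    (hw : IsTangentVector (segreVeronese k V s) p w) {c c' : Coloring d s}
    (h : mdeg c = mdeg c') : (tensorBasis s b).repr w c = (tensorBasis s b).repr w c' := by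
  have := hw 1 (MvPolynomial.X ((tensorBasis s b).coord c) -
    MvPolynomial.X ((tensorBasis s b).coord c'))
    ((MvPolynomial.isHomogeneous_X _ _).sub (MvPolynomial.isHomogeneous_X _ _)) ?_
  · have h2 := congrArg TrivSqZeroExt.snd this
    simpa [sub_eq_zero] using h2
  · rintro y ⟨v, -, hy⟩
    rw [polyEval_rep_eq_zero_iff
      ((MvPolynomial.isHomogeneous_X _ _).sub (MvPolynomial.isHomogeneous_X _ _)) y hy]
    have := hmon_congr (fun i j => (b i).repr (v i) j) h
    rw [← tensorBasis_repr_powTensor, ← tensorBasis_repr_powTensor] at this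
    simpa [polyEval, sub_eq_zero, powTensor] using this

/-- At the base point only the coordinate of the zero coloring is nonzero. The quadric that
exchanges the colors in `J` therefore has differential a nonzero multiple of the coordinate at `c`,
provided that `J` and its complement in `csupp c` are both nonempty. -/
lemma repr_eq_zero_of_isTangentVector {p : ℙ k (Ambient k V s)} {w : Ambient k V s}
    (hw : IsTangentVector (segreVeronese k V s) p w)
    (hp : p.submodule = Submodule.span k {powTensor k s fun i => b i 0})
    {c : Coloring d s} (hc : 2 ≤ (csupp c).card) : (tensorBasis s b).repr w c = 0 := by
  rw [Projectivization.submodule_eq, Submodule.span_singleton_eq_span_singleton] at hp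
  obtain ⟨r, hr⟩ := hp
  have hr' : p.rep = ((r⁻¹ : kˣ) : k) • powTensor k s fun i => b i 0 := by
    rw [← hr, ← Units.smul_def, inv_smul_smul]
  generalize r⁻¹ = r at hr'
  have hb : (powTensor k s fun i => b i 0) = tensorBasis s b fun _ => 0 :=
    (Basis.piTensorProduct_apply _ _).symm
  obtain ⟨J, hJ, hJ1⟩ := Finset.exists_subset_card_eq (show 1 ≤ (csupp c).card by omega)
  have hne {c : Coloring d s} (hc : (csupp c).card ≠ 0) :
      (tensorBasis s b).repr p.rep c = 0 := by
    have : (fun _ => 0 : Coloring d s) ≠ c := by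
      rintro rfl
      simp [csupp] at hc
    rw [hr', hb, map_smul, Module.Basis.repr_self, Finsupp.smul_apply,
      Finsupp.single_eq_of_ne this.symm, smul_zero]
  have h0 : (tensorBasis s b).repr p.rep (fun _ => 0) = r := by
    rw [hr', hb, map_smul, Module.Basis.repr_self, Finsupp.smul_apply, Finsupp.single_eq_same,
      smul_eq_mul, mul_one]
  have hhom : (MvPolynomial.X ((tensorBasis s b).coord c) *
      MvPolynomial.X ((tensorBasis s b).coord fun _ => 0) -
      MvPolynomial.X ((tensorBasis s b).coord (restr c J)) *
      MvPolynomial.X ((tensorBasis s b).coord (restr c (csupp c \ J))) :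
      MvPolynomial (Module.Dual k (Ambient k V s)) k).IsHomogeneous (1 + 1) :=
    ((MvPolynomial.isHomogeneous_X _ _).mul (MvPolynomial.isHomogeneous_X _ _)).sub
      ((MvPolynomial.isHomogeneous_X _ _).mul (MvPolynomial.isHomogeneous_X _ _))
  have := hw _ _ hhom ?_
  · have h2 := congrArg TrivSqZeroExt.snd this
    have h3 : (tensorBasis s b).repr p.rep c = 0 := hne (by omega)
    have h4 : (tensorBasis s b).repr p.rep (restr c J) = 0 :=
      hne (by rw [csupp_restr hJ]; omega)
    have h5 : (tensorBasis s b).repr p.rep (restr c (csupp c \ J)) = 0 :=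
      hne (by rw [csupp_restr Finset.sdiff_subset, Finset.card_sdiff_of_subset hJ]; omega)
    simpa [h0, h3, h4, h5] using h2
  · rintro y ⟨v, -, hy⟩
    rw [polyEval_rep_eq_zero_iff hhom y hy]
    have := hmon_mul_zero (fun i j => (b i).repr (v i) j) c J
    simp only [← tensorBasis_repr_powTensor] at this
    simpa [polyEval, sub_eq_zero, powTensor] using this

lemma mdeg_of_csupp_eq_singleton {c : Coloring d s} {p : Σ i, Fin (s i)} {j : Fin (d p.1)}
    (h : csupp c = {p}) (hj : c p = j.succ) : mdeg c = Finsupp.single ⟨p.1, j⟩ 1 := by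
  -- Evaluated at the variables themselves, `mon` determines its exponent.
  have h1 : mon (MvPolynomial.X (R := ℤ)) c = MvPolynomial.monomial (mdeg c) 1 := by
    rw [mon_eq_prod_mdeg, MvPolynomial.monomial_eq, map_one, one_mul]
    exact (Finsupp.prod_fintype _ _ fun _ => pow_zero _).symm
  rw [mon_eq_prod_csupp, h, Finset.prod_singleton, hj, hat_succ] at h1
  exact (MvPolynomial.monomial_left_injective one_ne_zero h1).symm

/-- Every tangent vector is a derivative of the parametrization, up to a multiple of the point. -/
lemma exists_eq_derivTensor [∀ i, FiniteDimensional k (V i)] (hs : ∀ i, 0 < s i)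
    (hd : ∀ i, Module.finrank k (V i) = d i + 1)
    {p : ℙ k (Ambient k V s)} {w : Ambient k V s} {v : ∀ i, V i} (hv : ∀ i, v i ≠ 0)
    (hp : p.submodule = Submodule.span k {powTensor k s v})
    (hw : IsTangentVector (segreVeronese k V s) p w) :
    ∃ (a : k) (ω : ∀ i, V i), w = a • powTensor k s v + derivTensor k s v ω := by
  -- Bases that start with the vectors `v i` turn the given point into the base point `x = 0`.
  choose φ hφ using fun i => Module.Projective.exists_dual_eq_one k (hv i)
  choose b hb using fun i => exists_basis_cons (hd i) (φ i) (v i) (hφ i)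
  obtain rfl : v = fun i => b i 0 := funext fun i => (hb i).1.symm
  have h0 : (fun i => b i 0) = affVec b 0 := by
    ext i
    refine (b i).ext_elem fun j => ?_
    rw [repr_affVec, Module.Basis.repr_self]
    cases j using Fin.cases <;> simp
  let c₁ : (Σ i : Fin n, Fin (d i)) → Coloring d s := fun q p =>
    if h : p = ⟨q.1, ⟨0, hs q.1⟩⟩ then h ▸ q.2.succ else 0
  -- Coordinates of `w` with one nonzero color depend only on that color and its group, so these
  -- representatives give the direction; the coordinate of the zero coloring gives the multiple of
  -- the point.
  let y : (Σ i : Fin n, Fin (d i)) → k := fun q => (tensorBasis s b).repr w (c₁ q)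
  refine ⟨(tensorBasis s b).repr w fun _ => 0, dirVec b y, (tensorBasis s b).ext_elem fun c => ?_⟩
  rw [map_add, map_smul, Finsupp.add_apply, Finsupp.smul_apply]
  rw [show powTensor k s (fun i => b i 0) = powTensor k s (affVec b 0) by rw [h0], h0,
    repr_derivTensor_affVec, repr_powTensor_affVec, smul_eq_mul]
  rcases Nat.lt_or_ge (csupp c).card 2 with hc | hc
  · interval_cases h : (csupp c).card
    · rw [Finset.card_eq_zero] at h
      rw [mon_of_csupp_eq_empty _ h, mon_of_csupp_eq_empty _ h]
      have : c = fun _ => 0 := by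
        rw [← restr_csupp c, h]; ext p; simp [restr]
      simp [this]
    · obtain ⟨p, hp⟩ := Finset.card_eq_one.1 h
      obtain ⟨j, hj⟩ := Fin.exists_succ_eq.2 (mem_csupp.1 (hp ▸ Finset.mem_singleton_self p))
      rw [mon_eq_prod_csupp, mon_eq_prod_csupp, hp, Finset.prod_singleton, Finset.prod_singleton,
        ← hj]
      simp only [hat_succ, Pi.zero_apply, mul_zero, zero_add, dualPoint, TrivSqZeroExt.snd_add,
        TrivSqZeroExt.snd_inl, TrivSqZeroExt.snd_inr, y]
      refine repr_eq_of_isTangentVector b hw ?_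
      rw [mdeg_of_csupp_eq_singleton hp hj.symm]
      refine (mdeg_of_csupp_eq_singleton (p := ⟨p.1, ⟨0, hs p.1⟩⟩) (j := j) ?_ ?_).symm
      · ext p'
        rw [mem_csupp, Finset.mem_singleton]
        by_cases h : p' = ⟨p.1, ⟨0, hs p.1⟩⟩
        · subst h; simp [c₁]
        · simp [c₁, h]
      · simp [c₁]
  · classical
    rw [repr_eq_zero_of_isTangentVector b hw hp hc]
    have hzero {S : Finset (Σ i, Fin (s i))} (hS : S.Nonempty) (hSc : S ⊆ csupp c) :
        ∏ p ∈ S, hat (0 : (Σ i : Fin n, Fin (d i)) → k) p.1 (c p) = 0 := by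
      obtain ⟨p, hp⟩ := hS
      refine Finset.prod_eq_zero hp ?_
      obtain ⟨j, hj⟩ := Fin.exists_succ_eq.2 (mem_csupp.1 (hSc hp))
      rw [← hj]
      rfl
    have hfst (p : Σ i, Fin (s i)) : (hat (dualPoint 0 y) p.1 (c p)).fst =
        hat (0 : (Σ i : Fin n, Fin (d i)) → k) p.1 (c p) := by
      generalize c p = j
      cases j using Fin.cases <;> simp [dualPoint]
    rw [mon_eq_prod_csupp, mon_eq_prod_csupp, snd_prod_dual,
      hzero (Finset.card_pos.1 (by omega)) subset_rfl, mul_zero, zero_add, eq_comm]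
    refine Finset.sum_eq_zero fun p hp => ?_
    simp only [hfst]
    rw [hzero (Finset.card_pos.1 (by rw [Finset.card_erase_of_mem hp]; omega))
      (Finset.erase_subset _ _), mul_zero]

/-! ### Tangent lines in the affine chart -/

variable (k V s) in
/-- The union of the tangent lines. -/
def tangentLines : Set (ℙ k (Ambient k V s)) :=
  {x | ∃ p ∈ segreVeronese k V s, ∃ w, IsTangentVector (segreVeronese k V s) p w ∧
    x.submodule ≤ Submodule.span k {p.rep, w}}

variable (s) in
/-- The points of tangent lines of the affine part of the Segre–Veronese variety. -/
def tanPoint (x y : (Σ i : Fin n, Fin (d i)) → k) : Ambient k V s :=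
  powTensor k s (affVec b x) + derivTensor k s (affVec b x) (dirVec b y)

lemma repr_tanPoint (x y : (Σ i : Fin n, Fin (d i)) → k) (c : Coloring d s) :
    (tensorBasis s b).repr (tanPoint s b x y) c = mon x c + (mon (dualPoint x y) c).snd := by
  rw [tanPoint, map_add, Finsupp.add_apply, repr_powTensor_affVec, repr_derivTensor_affVec]

lemma derivTensor_mem_polyFun (v e ω : ∀ i, V i) (c : Coloring d s) :
    (fun t : k => (tensorBasis s b).repr (derivTensor k s (fun i => v i + t • e i) ω) c) ∈
      polyFun k := by
  classical
  have : (fun t : k => (tensorBasis s b).repr (derivTensor k s (fun i => v i + t • e i) ω) c) =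
      ∑ p : (Σ i, Fin (s i)), (fun _ => (b p.1).repr (ω p.1) (c p)) *
        ∏ p' ∈ Finset.univ.erase p, fun t : k => (b p'.1).repr (v p'.1 + t • e p'.1) (c p') := by
    ext t
    rw [repr_derivTensor, hmon, snd_prod_dual, Finset.sum_apply]
    refine Finset.sum_congr rfl fun p _ => ?_
    rw [Pi.mul_apply, Finset.prod_apply]
    simp [dualCoord]
  rw [this]
  exact sum_mem fun p _ => mul_mem (mem_polyFun_const _)
    (prod_mem fun p' _ => repr_mem_polyFun b v e p'.1 (c p'))

/-- A point of a tangent line over the affine chart, in normal form. -/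
lemma exists_eq_smul_tanPoint {v : ∀ i, V i} (hv : ∀ i, (b i).repr (v i) 0 ≠ 0) (ω : ∀ i, V i)
    (α β : k) {u : Ambient k V s} (hu : u = α • powTensor k s v + β • derivTensor k s v ω)
    (hu0 : powerForm s (fun i => (b i).coord 0) u ≠ 0) :
    ∃ x y, (powerForm s (fun i => (b i).coord 0) u)⁻¹ • u = tanPoint s b x y := by
  let r : Fin n → k := fun i => (b i).repr (v i) 0
  let x : (Σ i : Fin n, Fin (d i)) → k := fun q => (r q.1)⁻¹ * (b q.1).repr (v q.1) q.2.succ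
  let ζ : Fin n → k := fun i => (r i)⁻¹ * (b i).repr (ω i) 0
  let y : (Σ i : Fin n, Fin (d i)) → k := fun q =>
    (r q.1)⁻¹ * (b q.1).repr (ω q.1) q.2.succ - ζ q.1 * x q
  -- The first coordinate of `v i + ε ω i` is the unit `U i`. Dividing by it normalizes this
  -- coordinate to `1` and leaves `x + ε y`; the product of these units then acts on the tensor as
  -- one dual-number scalar.
  let U : Fin n → DualNumber k := fun i =>
    TrivSqZeroExt.inl (r i) * (1 + TrivSqZeroExt.inr (ζ i))
  have hcoord (i : Fin n) (j : Fin (d i + 1)) :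
      dualCoord b v ω i j = U i * hat (dualPoint x y) i j := by
    have hr : r i ≠ 0 := hv i
    cases j using Fin.cases with
    | zero =>
      ext
      · simp [dualCoord, U, r]
      · simp [dualCoord, U, ζ, mul_inv_cancel_left₀ hr]
    | succ j =>
      ext
      · simp [dualCoord, U, dualPoint, x, mul_inv_cancel_left₀ hr]
      · simp [dualCoord, U, dualPoint, x, y]
        field_simp
        ring
  have hmon' (c : Coloring d s) : hmon (dualCoord b v ω) c =
      (∏ p : (Σ i, Fin (s i)), U p.1) * mon (dualPoint x y) c := by
    rw [hmon, mon, ← Finset.prod_mul_distrib]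
    exact Finset.prod_congr rfl fun p _ => hcoord p.1 (c p)
  let U' : DualNumber k := ∏ p : (Σ i, Fin (s i)), U p.1
  have hrepr (c : Coloring d s) : (tensorBasis s b).repr u c =
      (α * U'.fst + β * U'.snd) * mon x c + β * U'.fst * (mon (dualPoint x y) c).snd := by
    rw [hu, map_add, map_smul, map_smul, Finsupp.add_apply, Finsupp.smul_apply, Finsupp.smul_apply,
      ← fst_hmon_dualCoord b v ω, repr_derivTensor, hmon', TrivSqZeroExt.fst_mul,
      TrivSqZeroExt.snd_mul, fst_mon_dualPoint]
    simp only [smul_eq_mul, MulOpposite.smul_eq_mul_unop, MulOpposite.unop_op, U']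
    ring
  have hN : powerForm s (fun i => (b i).coord 0) u = α * U'.fst + β * U'.snd := by
    rw [powerForm_coord_zero, hrepr, mon_zero_coloring, mon_zero_coloring]
    simp
  refine ⟨x, fun q => (powerForm s (fun i => (b i).coord 0) u)⁻¹ * (β * U'.fst) * y q,
    (tensorBasis s b).ext_elem fun c => ?_⟩
  rw [repr_tanPoint, snd_mon_dualPoint_mul, map_smul, Finsupp.smul_apply, hrepr, smul_eq_mul,
    mul_add, ← hN, inv_mul_cancel_left₀ hu0]
  ring

/-- Only the base point `v` has to be moved into the chart: `exists_eq_derivTensor` writes the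
tangent vector through a direction `ω`, which stays fixed along the curve. -/
lemma vanishes_on_tangentLines [Infinite k] [∀ i, FiniteDimensional k (V i)] (hs : ∀ i, 0 < s i)
    (F : MvPolynomial (Module.Dual k (Ambient k V s)) k)
    (hF : ∀ x y, polyEval (tanPoint s b x y) F = 0)
    {x : ℙ k (Ambient k V s)} (hx : x ∈ tangentLines k V s)
    (hℓ : powerForm s (fun i => (b i).coord 0) x.rep ≠ 0) :
    polyEval ((powerForm s (fun i => (b i).coord 0) x.rep)⁻¹ • x.rep) F = 0 := by
  have hd (i : Fin n) : Module.finrank k (V i) = d i + 1 := by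
    rw [Module.finrank_eq_card_basis (b i), Fintype.card_fin]
  obtain ⟨p, ⟨v, hv, hp⟩, w, hw, hx⟩ := hx
  have hrep : x.rep ∈ x.submodule := by
    rw [Projectivization.submodule_eq]; exact Submodule.mem_span_singleton_self _
  obtain ⟨α, β, hαβ⟩ := Submodule.mem_span_pair.1 (hx hrep)
  obtain ⟨γ, ω, rfl⟩ := exists_eq_derivTensor hs hd hv hp hw
  have hprep : p.rep ∈ p.submodule := by
    rw [Projectivization.submodule_eq]; exact Submodule.mem_span_singleton_self _
  rw [hp] at hprep
  obtain ⟨r, hr⟩ := Submodule.mem_span_singleton.1 hprep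
  let u : k → Ambient k V s := fun t => (α * r + β * γ) • powTensor k s (fun i => v i + t • b i 0) +
    β • derivTensor k s (fun i => v i + t • b i 0) ω
  have hu0 : u 0 = x.rep := by
    rw [← hαβ, ← hr]
    simp only [u, zero_smul, add_zero, smul_add, smul_smul, add_smul, powTensor]
    abel
  obtain ⟨g, hg, hg0, hgv⟩ := exists_generic b v
  rw [← hu0] at hℓ ⊢
  refine polyEval_eq_zero_of_curve _ F (g := g) (dual_mem_polyFun b fun c => ?_) hg hg0 ?_ hℓ
  · have : (fun t => (tensorBasis s b).repr (u t) c) = (fun _ => α * r + β * γ) *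
        (fun t => (tensorBasis s b).repr (powTensor k s fun i => v i + t • b i 0) c) +
        (fun _ => β) *
          fun t => (tensorBasis s b).repr (derivTensor k s (fun i => v i + t • b i 0) ω) c := by
      ext t; simp [u]
    rw [this]
    exact add_mem (mul_mem (mem_polyFun_const _) (powTensor_mem_polyFun b v _ c))
      (mul_mem (mem_polyFun_const _) (derivTensor_mem_polyFun b v _ ω c))
  · intro t ht hut
    obtain ⟨x', y', h⟩ := exists_eq_smul_tanPoint b (hgv t ht) ω _ _ rfl hut
    exact (congrArg (fun a => polyEval a F) h).trans (hF x' y')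

/-- Because `ε² = 0`, the power is `(-1)^r (1 - r ε)`. The sum of the two parts is the central
moment `κ r` of the tangential case. -/
lemma eps_sub_one_pow (r : ℕ) : ((DualNumber.eps - 1 : DualNumber k) ^ r).fst = (-1) ^ r ∧
    ((DualNumber.eps - 1 : DualNumber k) ^ r).snd = -((-1) ^ r * r) := by
  induction r with
  | zero => simp
  | succ r ih =>
    rw [pow_succ, TrivSqZeroExt.fst_mul, TrivSqZeroExt.snd_mul, ih.1, ih.2]
    simp [pow_succ]
    ring

/-- The coordinate ring of a chart of the tangential variety. -/
theorem nonempty_tangent_chart_equiv [Infinite k] [CharZero k] [∀ i, FiniteDimensional k (V i)]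
    (hs : ∀ i, 0 < s i) :
    Nonempty (chartRing (tangentialVariety (segreVeronese k V s))
      (powerForm s fun i => (b i).coord 0) ≃ₐ[k]
        monomialAlgebra k (Set.range (tanExp (d := d) (s := s)))) := by
  let Θ := ((Σ i : Fin n, Fin (d i)) → k) × ((Σ i : Fin n, Fin (d i)) → k)
  let π : Θ → Ambient k V s := fun θ => tanPoint s b θ.1 θ.2
  obtain ⟨e1⟩ := nonempty_chartRing_equiv (tangentLines k V s)
    (powerForm s fun i => (b i).coord 0) π (fun θ => by
      have h1 : powerForm s (fun i => (b i).coord 0) (π θ) = 1 := by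
        rw [powerForm_coord_zero, repr_tanPoint, mon_zero_coloring, mon_zero_coloring]; simp
      refine ⟨h1, Projectivization.mk k (π θ) (fun h0 => by simp [h0] at h1), ?_,
        Projectivization.submodule_mk _ _⟩
      obtain ⟨p, hp, hp'⟩ := exists_mem_segreVeronese (k := k) (s := s) (affVec_ne_zero b θ.1)
      refine ⟨p, hp, _, isTangentVector_derivTensor b θ.1 θ.2 hp', ?_⟩
      rw [Projectivization.submodule_mk, Submodule.span_singleton_le_iff_mem]
      refine add_mem ?_ (Submodule.subset_span (by simp))
      have h2 : powTensor k s (affVec b θ.1) ∈ p.submodule := by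
        rw [hp']; exact Submodule.mem_span_singleton_self _
      rw [Projectivization.submodule_eq] at h2
      exact Submodule.span_mono (by simp) h2)
    (fun F hF x hx hℓ => vanishes_on_tangentLines b hs F (fun x y => hF ⟨x, y⟩) hx hℓ)
  -- Coordinates of `tanPoint` are values of the functional `a + bε ↦ a + b`. The mean of `x + ε y`
  -- is thus `x + y`, and the deviation from it is `(ε - 1) y`, whose mean is zero.
  let μ : (Σ i : Fin n, Fin (d i)) → Θ → k := fun q θ => θ.1 q + θ.2 q
  let z : (Σ i : Fin n, Fin (d i)) → Θ → k := fun q θ => θ.2 q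
  let κ : ℕ → Θ → k := fun r _ => (-1) ^ r * (1 - r)
  have hM := adjoin_moments_eq (k := k) hs μ z κ (by ext θ; simp [κ]) (by ext θ; simp [κ])
    (fun (c : Coloring d s) (θ : Θ) => (tensorBasis s b).repr (π θ) c) (mon z) (fun c => by
      ext θ
      have hx : dualPoint θ.1 θ.2 = fun q => (DualNumber.eps - 1) *
          TrivSqZeroExt.inlHom k k (θ.2 q) + TrivSqZeroExt.inlHom k k (θ.1 q + θ.2 q) := by
        ext q <;> simp [dualPoint]
      rw [repr_tanPoint, Finset.sum_apply, ← fst_mon_dualPoint θ.1 θ.2, hx, mon_mul_add]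
      simp only [← map_mon, TrivSqZeroExt.fst_sum, TrivSqZeroExt.snd_sum]
      rw [← Finset.sum_add_distrib]
      refine Finset.sum_congr rfl fun J _ => ?_
      simp only [TrivSqZeroExt.inlHom_apply, TrivSqZeroExt.fst_mul, TrivSqZeroExt.snd_mul,
        TrivSqZeroExt.fst_inl, TrivSqZeroExt.snd_inl, (eps_sub_one_pow J.card).1,
        (eps_sub_one_pow J.card).2, Pi.mul_apply, mon_apply, κ, z, μ, smul_eq_mul,
        MulOpposite.smul_eq_mul_unop, MulOpposite.unop_op]
      ring)
    (fun c hc => ⟨(-1) ^ (csupp c).card * (1 - (csupp c).card), by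
      have : (1 - (csupp c).card : k) ≠ 0 := by
        rw [sub_ne_zero]
        exact_mod_cast (by omega : 1 ≠ (csupp c).card)
      exact mul_ne_zero (pow_ne_zero _ (by simp)) this, by
      have : κ (csupp c).card * mon z c -
          ((-1) ^ (csupp c).card * (1 - (csupp c).card) : k) • mon z c = 0 := by
        ext θ
        simp [κ]
      rw [this]
      exact zero_mem _⟩)
  let ρ : Θ → (Σ i : Fin n, Fin (d i)) ⊕ (Σ i : Fin n, Fin (d i)) → k := fun θ =>
    Sum.elim (fun q => μ q θ) fun q => z q θ
  obtain ⟨e2⟩ := nonempty_monomialAlgebra_equiv ρ (fun P hP => MvPolynomial.funext fun x => by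
    have hρ : ρ ⟨fun q => x (Sum.inl q) - x (Sum.inr q), fun q => x (Sum.inr q)⟩ = x := by
      ext (q | q) <;> simp [ρ, μ, z]
    rw [← hρ, hP, map_zero]) (tanExp (d := d) (s := s))
  have hgen : (Set.range fun i (θ : Θ) => MvPolynomial.eval (ρ θ)
      (MvPolynomial.monomial (tanExp (d := d) (s := s) i) 1)) =
      Set.range μ ∪ mon z '' {c : Coloring d s | 2 ≤ (csupp c).card} := by
    rw [Sum.range_eq]
    congr 1
    · congr 1
      ext i θ
      exact eval_tanExp_inl _ _
    · let f : ((Σ i : Fin n, Fin (d i)) →₀ ℕ) → Θ → k := fun m θ => ∏ i, z i θ ^ m i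
      have h1 : (fun i (θ : Θ) => MvPolynomial.eval (ρ θ)
          (MvPolynomial.monomial (tanExp (d := d) (s := s) i) 1)) ∘ Sum.inr =
          fun m : LatticePoint d s => f (latticeExp m) := by
        ext m θ
        exact eval_tanExp_inr _ _
      rw [h1]
      refine (range_latticePoint_eq_image f).trans (Set.image_congr fun c hc => ?_)
      ext θ
      rw [mon_apply, mon_eq_prod_mdeg]
  exact ⟨e1.trans ((Subalgebra.equivOfEq _ _ (by
    rw [adjoin_dual_eq_adjoin_repr b, hM, ← hgen])).trans e2.symm)⟩

end Tangent

/-! ### Covering by charts -/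

section Cover

variable {k : Type u} [Field k]

lemma eq_zero_of_mem_projClosure {W : Type v} [AddCommGroup W] [Module k W] {S : Set (ℙ k W)}
    (ℓ : Module.Dual k W) (h : ∀ x ∈ S, ℓ x.rep = 0) {x : ℙ k W} (hx : x ∈ projClosure S) :
    ℓ x.rep = 0 := by
  have := hx 1 (MvPolynomial.X ℓ) (MvPolynomial.isHomogeneous_X _ _) fun y hy => by
    simpa [polyEval] using h y hy
  simpa [polyEval] using this

variable {n : ℕ} {V : Fin n → Type u} [∀ i, AddCommGroup (V i)]
  [∀ i, Module k (V i)] {s d : Fin n → ℕ} (b : ∀ i, Module.Basis (Fin (d i + 1)) k (V i))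

lemma repr_eq_of_mem_segreVeronese {x : ℙ k (Ambient k V s)} (hx : x ∈ segreVeronese k V s)
    {c c' : Coloring d s} (h : mdeg c = mdeg c') :
    (tensorBasis s b).repr x.rep c = (tensorBasis s b).repr x.rep c' := by
  obtain ⟨v, -, hx⟩ := hx
  have hrep : x.rep ∈ x.submodule := by
    rw [Projectivization.submodule_eq]; exact Submodule.mem_span_singleton_self _
  rw [hx] at hrep
  obtain ⟨r, hr⟩ := Submodule.mem_span_singleton.1 hrep
  change r • powTensor k s v = _ at hr
  rw [← hr, map_smul, Finsupp.smul_apply, Finsupp.smul_apply, tensorBasis_repr_powTensor,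
    tensorBasis_repr_powTensor, hmon_congr _ h]

/-- The difference of two coordinates of the same multidegree. -/
def coordDiff (c c' : Coloring d s) : Module.Dual k (Ambient k V s) :=
  (tensorBasis s b).coord c - (tensorBasis s b).coord c'

lemma coordDiff_eq_zero {c c' : Coloring d s} {a : Ambient k V s} :
    coordDiff b c c' a = 0 ↔ (tensorBasis s b).repr a c = (tensorBasis s b).repr a c' := by
  rw [coordDiff, LinearMap.sub_apply, sub_eq_zero]
  rfl

lemma repr_eq_of_mem_secantVariety {x : ℙ k (Ambient k V s)}
    (hx : x ∈ secantVariety (segreVeronese k V s)) {c c' : Coloring d s} (h : mdeg c = mdeg c') :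
    (tensorBasis s b).repr x.rep c = (tensorBasis s b).repr x.rep c' := by
  rw [← coordDiff_eq_zero]
  refine eq_zero_of_mem_projClosure _ ?_ hx
  rintro x ⟨p, hp, q, hq, hx⟩
  have hrep : x.rep ∈ x.submodule := by
    rw [Projectivization.submodule_eq]; exact Submodule.mem_span_singleton_self _
  rw [Projectivization.submodule_eq p, Projectivization.submodule_eq q,
    ← Submodule.span_union, Set.singleton_union] at hx
  obtain ⟨α, β, hαβ⟩ := Submodule.mem_span_pair.1 (hx hrep)
  rw [← hαβ, map_add, map_smul, map_smul,
    (coordDiff_eq_zero b).2 (repr_eq_of_mem_segreVeronese b hp h),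
    (coordDiff_eq_zero b).2 (repr_eq_of_mem_segreVeronese b hq h)]
  simp

lemma repr_eq_of_mem_tangentialVariety {x : ℙ k (Ambient k V s)}
    (hx : x ∈ tangentialVariety (segreVeronese k V s)) {c c' : Coloring d s}
    (h : mdeg c = mdeg c') :
    (tensorBasis s b).repr x.rep c = (tensorBasis s b).repr x.rep c' := by
  rw [← coordDiff_eq_zero]
  refine eq_zero_of_mem_projClosure _ ?_ hx
  rintro x ⟨p, hp, w, hw, hx⟩
  have hrep : x.rep ∈ x.submodule := by
    rw [Projectivization.submodule_eq]; exact Submodule.mem_span_singleton_self _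
  obtain ⟨α, β, hαβ⟩ := Submodule.mem_span_pair.1 (hx hrep)
  rw [← hαβ, map_add, map_smul, map_smul,
    (coordDiff_eq_zero b).2 (repr_eq_of_mem_segreVeronese b hp h),
    (coordDiff_eq_zero b).2 (repr_eq_of_isTangentVector b hw h)]
  simp

/-- A tensor whose coordinates only depend on the multidegree is detected by powers of linear
forms. -/
lemma eq_zero_of_powerForm_eq_zero [CharZero k] {a : Ambient k V s}
    (ha : ∀ c c' : Coloring d s, mdeg c = mdeg c' →
      (tensorBasis s b).repr a c = (tensorBasis s b).repr a c')
    (h : ∀ φ : ∀ i, Module.Dual k (V i), (∀ i, φ i ≠ 0) → powerForm s φ a = 0) : a = 0 := by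
  classical
  have hsum (x : (Σ i : Fin n, Fin (d i)) → k) :
      ∑ c : Coloring d s, (tensorBasis s b).repr a c * mon x c = 0 := by
    let φ : ∀ i, Module.Dual k (V i) := fun i => (b i).constr k (hat x i)
    have hφ (i : Fin n) (j : Fin (d i + 1)) : φ i (b i j) = hat x i j :=
      Module.Basis.constr_basis _ _ _ _
    have hφ0 : ∀ i, φ i ≠ 0 := fun i h0 => by
      have := hφ i 0
      rw [h0] at this
      simp at this
    rw [← h φ hφ0, dual_apply_eq_sum b]
    refine Finset.sum_congr rfl fun c _ => ?_
    congr 1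
    rw [tensorBasis, Basis.piTensorProduct_apply, powerForm_tprod, mon]
    exact Finset.prod_congr rfl fun p _ => (hφ p.1 (c p)).symm
  let P : MvPolynomial (Σ i : Fin n, Fin (d i)) k :=
    ∑ c : Coloring d s, MvPolynomial.monomial (mdeg c) ((tensorBasis s b).repr a c)
  have hP : P = 0 := MvPolynomial.funext fun x => by
    rw [map_zero, ← hsum x, map_sum]
    refine Finset.sum_congr rfl fun c _ => ?_
    rw [MvPolynomial.eval_monomial, mon_eq_prod_mdeg, Finsupp.prod_fintype _ _ fun _ => pow_zero _]
  refine (tensorBasis s b).ext_elem fun c₀ => ?_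
  have h1 := congrArg (MvPolynomial.coeff (mdeg c₀)) hP
  -- By symmetry this coefficient is the coordinate at `c₀` times the number of colorings of the
  -- same multidegree, which is nonzero in `k` by characteristic zero.
  simp only [P, MvPolynomial.coeff_sum, MvPolynomial.coeff_monomial, MvPolynomial.coeff_zero] at h1
  rw [← Finset.sum_filter, Finset.sum_congr rfl (g := fun _ => (tensorBasis s b).repr a c₀)
    (fun c hc => ha _ _ (Finset.mem_filter.1 hc).2), Finset.sum_const, nsmul_eq_mul,
    mul_eq_zero] at h1
  rw [map_zero, Finsupp.zero_apply]
  refine h1.resolve_left ?_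
  rw [Nat.cast_eq_zero, Finset.card_eq_zero]
  exact Finset.ne_empty_of_mem (Finset.mem_filter.2 ⟨Finset.mem_univ c₀, rfl⟩)

/-- The dual of the ambient space has finite dimension, so the span of all these forms has a finite
basis chosen among them. -/
lemma exists_finset_powerForm [∀ i, FiniteDimensional k (V i)] (s : Fin n → ℕ) :
    ∃ Φ : Finset (∀ i, Module.Dual k (V i)), (∀ φ ∈ Φ, ∀ i, φ i ≠ 0) ∧
      ∀ a : Ambient k V s, (∀ φ ∈ Φ, powerForm s φ a = 0) →
        ∀ φ : ∀ i, Module.Dual k (V i), (∀ i, φ i ≠ 0) → powerForm s φ a = 0 := by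
  classical
  let D : Set (∀ i, Module.Dual k (V i)) := {φ | ∀ i, φ i ≠ 0}
  obtain ⟨B, hB, hspan, hli⟩ := exists_linearIndependent k (powerForm s '' D)
  have hfin : B.Finite := hli.setFinite
  obtain ⟨Φ, hΦ, hΦB⟩ := Finset.subset_set_image_iff.1
    (show (hfin.toFinset : Set _) ⊆ powerForm s '' D by simpa using hB)
  refine ⟨Φ, fun φ hφ => hΦ hφ, fun a ha φ hφ => ?_⟩
  have h1 : powerForm s φ ∈ Submodule.span k B := by
    rw [hspan]; exact Submodule.subset_span ⟨φ, hφ, rfl⟩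
  have h2 : Submodule.span k B ≤ LinearMap.ker (Module.Dual.eval k (Ambient k V s) a) := by
    refine Submodule.span_le.2 fun ℓ hℓ => ?_
    have : ℓ ∈ hfin.toFinset := by simpa using hℓ
    rw [← hΦB, Finset.mem_image] at this
    obtain ⟨ψ, hψ, rfl⟩ := this
    exact ha ψ hψ
  exact h2 h1

/-- The linear equations of symmetry hold on secant and tangent lines and pass to the closures. A
point on all the hyperplanes would be a symmetric tensor killed by every power form, hence zero. -/
theorem exists_finset_cover [CharZero k] [∀ i, FiniteDimensional k (V i)]
    (hd : ∀ i, Module.finrank k (V i) = d i + 1) :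
    ∃ Φ : Finset (∀ i, Module.Dual k (V i)), (∀ φ ∈ Φ, ∀ i, φ i ≠ 0) ∧
      secantVariety (segreVeronese k V s) =
        ⋃ φ ∈ Φ, hyperplaneCompl (secantVariety (segreVeronese k V s)) (powerForm s φ) ∧
      tangentialVariety (segreVeronese k V s) =
        ⋃ φ ∈ Φ, hyperplaneCompl (tangentialVariety (segreVeronese k V s)) (powerForm s φ) := by
  let b : ∀ i, Module.Basis (Fin (d i + 1)) k (V i) := fun i =>
    Module.finBasisOfFinrankEq k (V i) (hd i)
  obtain ⟨Φ, hΦ, h⟩ := exists_finset_powerForm (k := k) (V := V) s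
  have key (Y : Set (ℙ k (Ambient k V s))) (hY : ∀ x ∈ Y, ∀ c c' : Coloring d s, mdeg c = mdeg c' →
      (tensorBasis s b).repr x.rep c = (tensorBasis s b).repr x.rep c') :
      Y = ⋃ φ ∈ Φ, hyperplaneCompl Y (powerForm s φ) := by
    ext x
    simp only [Set.mem_iUnion, hyperplaneCompl, Set.mem_ofPred_eq, exists_prop]
    constructor
    · intro hx
      by_contra! hcon
      exact x.rep_nonzero (eq_zero_of_powerForm_eq_zero b (hY x hx)
        (h x.rep fun φ hφ => hcon φ hφ hx))
    · rintro ⟨-, -, hx, -⟩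
      exact hx
  exact ⟨Φ, hΦ, key _ fun x hx c c' hc => repr_eq_of_mem_secantVariety b hx hc,
    key _ fun x hx c c' hc => repr_eq_of_mem_tangentialVariety b hx hc⟩

end Cover

/-! ### Coordinate rings of closures and cones -/

section CoordRing

variable {k : Type u} [Field k] {W : Type v} [AddCommGroup W] [Module k W]

/-- The coordinate ring of a variety, computed on a parametrized dense subset. -/
lemma nonempty_coordRing_equiv (Z : Set W) {Θ : Type*} (π : Θ → W) (h1 : ∀ θ, π θ ∈ Z)
    (h2 : ∀ F : MvPolynomial (Module.Dual k W) k, (∀ θ, polyEval (π θ) F = 0) →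
      ∀ z ∈ Z, polyEval z F = 0) :
    Nonempty (coordRing k Z ≃ₐ[k] Algebra.adjoin k (Set.range
      fun (ℓ : Module.Dual k W) (θ : Θ) => ℓ (π θ))) := by
  refine nonempty_adjoin_equiv _ _ fun F => ?_
  have e1 (z : Z) : MvPolynomial.aeval (fun (ℓ : Module.Dual k W) (z : Z) => ℓ z) F z =
      polyEval z.1 F := aeval_fun_apply _ _ _
  have e2 (θ : Θ) : MvPolynomial.aeval (fun (ℓ : Module.Dual k W) (θ : Θ) => ℓ (π θ)) F θ =
      polyEval (π θ) F := aeval_fun_apply _ _ _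
  constructor
  · intro h
    ext θ
    rw [e2, ← e1 ⟨π θ, h1 θ⟩, h]; rfl
  · intro h
    ext z
    rw [e1, h2 F (fun θ => by rw [← e2, h]; rfl) z z.2]; rfl

/-- Freezing the first component reduces vanishing on a product with an affine space to vanishing on
the second factor. -/
lemma exists_polyEval_prod {U : Type*} [AddCommGroup U] [Module k U] (u : U)
    (F : MvPolynomial (Module.Dual k (U × W)) k) :
    ∃ G : MvPolynomial (Module.Dual k W) k, ∀ a, polyEval a G = polyEval (u, a) F := by
  refine ⟨MvPolynomial.aeval (fun ℓ : Module.Dual k (U × W) => MvPolynomial.C (ℓ (u, 0)) +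
    MvPolynomial.X (ℓ.comp (LinearMap.inr k U W))) F, fun a => ?_⟩
  have : (MvPolynomial.eval fun ℓ : Module.Dual k W => ℓ a).comp
      (MvPolynomial.aeval (fun ℓ : Module.Dual k (U × W) => MvPolynomial.C (ℓ (u, 0)) +
        MvPolynomial.X (ℓ.comp (LinearMap.inr k U W)))).toRingHom =
      MvPolynomial.eval fun ℓ : Module.Dual k (U × W) => ℓ (u, a) := by
    ext ℓ
    · simp
    · have h : (u, a) = (u, 0) + LinearMap.inr k U W a := by simp
      simp only [AlgHom.toRingHom_eq_coe, RingHom.coe_comp, RingHom.coe_coe, Function.comp_apply,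
        MvPolynomial.aeval_X, map_add, MvPolynomial.eval_C, MvPolynomial.eval_X,
        LinearMap.comp_apply, h]
  exact DFunLike.congr_fun this F

lemma subset_affineClosure (S : Set W) : S ⊆ affineClosure k S := fun _ ha _ hf => hf _ ha

/-- A polynomial vanishing on the multiples of a vector has homogeneous components vanishing
there. -/
lemma polyEval_homogeneousComponent_eq_zero [Infinite k] {F : MvPolynomial (Module.Dual k W) k}
    {a : W} (h : ∀ c : k, polyEval (c • a) F = 0) (j : ℕ) :
    polyEval a (MvPolynomial.homogeneousComponent j F) = 0 := by
  let Q : Polynomial k := ∑ j ∈ Finset.range (F.totalDegree + 1),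
    Polynomial.monomial j (polyEval a (MvPolynomial.homogeneousComponent j F))
  have hQ : Q = 0 := Polynomial.funext fun c => by
    rw [Polynomial.eval_zero, ← h c]
    conv_rhs => rw [← MvPolynomial.sum_homogeneousComponent F]
    have hs : polyEval (c • a) (∑ j ∈ Finset.range (F.totalDegree + 1),
        MvPolynomial.homogeneousComponent j F) = ∑ j ∈ Finset.range (F.totalDegree + 1),
        polyEval (c • a) (MvPolynomial.homogeneousComponent j F) :=
      map_sum (MvPolynomial.eval _) _ _
    rw [hs, Polynomial.eval_finsetSum]
    refine Finset.sum_congr rfl fun j _ => ?_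
    rw [Polynomial.eval_monomial,
      polyEval_smul (MvPolynomial.homogeneousComponent_isHomogeneous j F), mul_comm]
  by_cases hj : j < F.totalDegree + 1
  · have := congrArg (fun P => P.coeff j) hQ
    simpa [Q, Polynomial.finsetSum_coeff, Polynomial.coeff_monomial, hj] using this
  · rw [MvPolynomial.homogeneousComponent_eq_zero _ _ (by omega)]
    exact map_zero (MvPolynomial.eval _)

lemma smul_mem_affineCone {T : Type*} (p : T → W) (c : k) (t : T) :
    c • p t ∈ affineCone (projClosure {x : ℙ k W | ∃ t, x.submodule = Submodule.span k {p t}}) := by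
  intro h
  refine subset_projClosure _ ⟨t, ?_⟩
  rw [Projectivization.submodule_mk]
  exact Submodule.span_singleton_smul_eq (IsUnit.mk0 c fun hc => h (by rw [hc, zero_smul])) _

/-- A polynomial vanishing on the multiples of a family of vectors vanishes on the cone over the
closure of the corresponding set of points. -/
lemma polyEval_eq_zero_of_mem_affineCone [Infinite k] {T : Type*} [Nonempty T] (p : T → W)
    {F : MvPolynomial (Module.Dual k W) k} (h : ∀ (c : k) (t : T), polyEval (c • p t) F = 0) {a : W}
    (ha : a ∈ affineCone
      (projClosure {x : ℙ k W | ∃ t, x.submodule = Submodule.span k {p t}})) :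
    polyEval a F = 0 := by
  -- The vertex is no point of projective space; there the hypothesis at `c = 0` applies, for which
  -- some `t` must exist.
  by_cases h0 : a = 0
  · have := h 0 (Classical.arbitrary T)
    rwa [zero_smul, ← h0] at this
  · rw [← MvPolynomial.sum_homogeneousComponent F]
    refine (map_sum (MvPolynomial.eval _) _ _).trans (Finset.sum_eq_zero fun j _ => ?_)
    have hj := MvPolynomial.homogeneousComponent_isHomogeneous j F
    refine (polyEval_rep_eq_zero_iff hj _ (Projectivization.submodule_mk a h0)).1
      (ha h0 j _ hj fun y hy => ?_)
    obtain ⟨t, ht⟩ := hy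
    exact (polyEval_rep_eq_zero_iff hj _ ht).2
      (polyEval_homogeneousComponent_eq_zero (fun c => h c t) j)

end CoordRing

/-! ### Coordinate rings of the toric varieties of the polytope -/

section ToricRings

variable {k : Type u} [Field k] {n : ℕ} {d s : Fin n → ℕ}

lemma torusPoint_apply (t : (Σ i : Fin n, Fin (d i)) → kˣ) (m : LatticePoint d s) :
    torusPoint d s k t m = ∏ q, (t q : k) ^ latticeExp m q := by
  rw [torusPoint, Units.coe_prod]
  refine Finset.prod_congr rfl fun q _ => ?_
  rw [← latticeExp_apply, zpow_natCast, Units.val_pow_eq_pow_val]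

/-- The torus is Zariski dense in affine space. -/
lemma eq_zero_of_eval_eq_zero [Infinite k] {τ : Type} {P : MvPolynomial τ k}
    (h : ∀ x : τ → k, (∀ i, x i ≠ 0) → MvPolynomial.eval x P = 0) : P = 0 :=
  MvPolynomial.funext_set (fun _ => {0}ᶜ) (fun _ => (Set.finite_singleton 0).infinite_compl)
    fun x hx => by rw [h x fun i => hx i trivial, map_zero]

/-- The coordinate ring of `X'_P`. -/
theorem nonempty_affineToric_equiv [Infinite k] :
    Nonempty (coordRing k (affineToric d s k) ≃ₐ[k]
      monomialAlgebra k (Set.range (latticeExp (d := d) (s := s)))) := by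
  have := Fintype.ofFinite (LatticePoint d s)
  obtain ⟨e1⟩ := nonempty_coordRing_equiv (affineToric d s k) (torusPoint d s k)
    (fun t => subset_affineClosure _ ⟨t, rfl⟩)
    (fun F hF z hz => hz F (by rintro _ ⟨t, rfl⟩; exact hF t))
  obtain ⟨e2⟩ := nonempty_monomialAlgebra_equiv
    (fun (t : (Σ i : Fin n, Fin (d i)) → kˣ) q => (t q : k))
    (fun P hP => eq_zero_of_eval_eq_zero fun x hx => hP fun q => Units.mk0 (x q) (hx q))
    (latticeExp (d := d) (s := s))
  refine ⟨e1.trans ((Subalgebra.equivOfEq _ _ ?_).trans e2.symm)⟩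
  rw [adjoin_dual_eq_adjoin_basis (Pi.basisFun k (LatticePoint d s))]
  congr 2
  ext m t
  rw [Pi.basisFun_repr, torusPoint_apply, MvPolynomial.eval_monomial, one_mul,
    Finsupp.prod_fintype _ _ (fun _ => pow_zero _)]

lemma range_coord_eq {Θ : Type*} [Fintype (LatticePoint d s)]
    (π : Θ → (Fin (∑ i, d i) → k) × (LatticePoint d s → k))
    (f : (Σ i : Fin n, Fin (d i)) ⊕ LatticePoint d s → Θ → k)
    (h1 : ∀ q θ, f (Sum.inl q) θ = (π θ).1 (finSigmaFinEquiv q))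
    (h2 : ∀ m θ, f (Sum.inr m) θ = (π θ).2 m) :
    Set.range (fun c (θ : Θ) => ((Pi.basisFun k (Fin (∑ i, d i))).prod
      (Pi.basisFun k (LatticePoint d s))).repr (π θ) c) = Set.range f := by
  rw [← EquivLike.range_comp _ (Equiv.sumCongr finSigmaFinEquiv (Equiv.refl (LatticePoint d s)))]
  congr 1
  ext (q | m) θ
  · simp [h1]
  · simp [h2]

/-- The coordinate ring of the product of an affine space and `X'_P`. -/
theorem nonempty_prod_affineToric_equiv [Infinite k] :
    Nonempty (coordRing k ((Set.univ : Set (Fin (∑ i, d i) → k)) ×ˢ affineToric d s k) ≃ₐ[k]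
      monomialAlgebra k (Set.range (tanExp (d := d) (s := s)))) := by
  have := Fintype.ofFinite (LatticePoint d s)
  let Θ := (Fin (∑ i, d i) → k) × ((Σ i : Fin n, Fin (d i)) → kˣ)
  let π : Θ → (Fin (∑ i, d i) → k) × (LatticePoint d s → k) :=
    fun θ => (θ.1, torusPoint d s k θ.2)
  obtain ⟨e1⟩ := nonempty_coordRing_equiv
    ((Set.univ : Set (Fin (∑ i, d i) → k)) ×ˢ affineToric d s k) π
    (fun θ => ⟨trivial, subset_affineClosure _ ⟨θ.2, rfl⟩⟩)
    (fun F hF z hz => by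
      obtain ⟨G, hG⟩ := exists_polyEval_prod (k := k) z.1 F
      rw [← hG]
      refine hz.2 G ?_
      rintro _ ⟨t, rfl⟩
      rw [hG]
      exact hF (z.1, t))
  let ρ : Θ → (Σ i : Fin n, Fin (d i)) ⊕ (Σ i : Fin n, Fin (d i)) → k := fun θ =>
    Sum.elim (fun q => θ.1 (finSigmaFinEquiv q)) fun q => (θ.2 q : k)
  obtain ⟨e2⟩ := nonempty_monomialAlgebra_equiv ρ
    (fun P hP => eq_zero_of_eval_eq_zero fun x hx => by
      rw [← hP (fun q => x (Sum.inl (finSigmaFinEquiv.symm q)),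
        fun q => Units.mk0 (x (Sum.inr q)) (hx _))]
      congr 2
      ext (q | q) <;> simp [ρ]) (tanExp (d := d) (s := s))
  refine ⟨e1.trans ((Subalgebra.equivOfEq _ _ ?_).trans e2.symm)⟩
  rw [adjoin_dual_eq_adjoin_basis ((Pi.basisFun k (Fin (∑ i, d i))).prod
    (Pi.basisFun k (LatticePoint d s))), range_coord_eq π]
  · exact fun q θ => eval_tanExp_inl _ _
  · exact fun m θ => (eval_tanExp_inr _ _).trans (torusPoint_apply _ _).symm

/-- The coordinate ring of the product of an affine space and the affine cone over `X_P`. -/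
theorem nonempty_prod_cone_equiv [Infinite k] :
    Nonempty (coordRing k ((Set.univ : Set (Fin (∑ i, d i) → k)) ×ˢ
      affineCone (projToric d s k)) ≃ₐ[k]
        monomialAlgebra k (Set.range (secExp (d := d) (s := s)))) := by
  have := Fintype.ofFinite (LatticePoint d s)
  let Θ := (Fin (∑ i, d i) → k) × k × ((Σ i : Fin n, Fin (d i)) → kˣ)
  let π : Θ → (Fin (∑ i, d i) → k) × (LatticePoint d s → k) :=
    fun θ => (θ.1, θ.2.1 • torusPoint d s k θ.2.2)
  obtain ⟨e1⟩ := nonempty_coordRing_equiv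
    ((Set.univ : Set (Fin (∑ i, d i) → k)) ×ˢ affineCone (projToric d s k)) π
    (fun θ => ⟨trivial, smul_mem_affineCone _ _ _⟩)
    (fun F hF z hz => by
      obtain ⟨G, hG⟩ := exists_polyEval_prod (k := k) z.1 F
      rw [← hG]
      refine polyEval_eq_zero_of_mem_affineCone (torusPoint d s k) (fun c t => ?_) hz.2
      rw [hG]
      exact hF (z.1, c, t))
  let ρ : Θ → (Σ i : Fin n, Fin (d i)) ⊕ Option (Σ i : Fin n, Fin (d i)) → k := fun θ =>
    Sum.elim (fun q => θ.1 (finSigmaFinEquiv q)) fun o => o.elim θ.2.1 fun q => (θ.2.2 q : k)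
  obtain ⟨e2⟩ := nonempty_monomialAlgebra_equiv ρ
    (fun P hP => eq_zero_of_eval_eq_zero fun x hx => by
      rw [← hP (fun q => x (Sum.inl (finSigmaFinEquiv.symm q)), x (Sum.inr none),
        fun q => Units.mk0 (x (Sum.inr (some q))) (hx _))]
      congr 2
      ext (q | _ | q) <;> simp [ρ]) (secExp (d := d) (s := s))
  refine ⟨e1.trans ((Subalgebra.equivOfEq _ _ ?_).trans e2.symm)⟩
  rw [adjoin_dual_eq_adjoin_basis ((Pi.basisFun k (Fin (∑ i, d i))).prod
    (Pi.basisFun k (LatticePoint d s))), range_coord_eq π]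
  · exact fun q θ => eval_secExp_inl _ _
  · exact fun m θ => (eval_secExp_inr _ _).trans
      (congrArg (θ.2.1 * ·) (torusPoint_apply _ _).symm)

end ToricRings

/-! ### Normality of the monoids -/

section Normality

/-- Every intermediate value of the sum is attained between two families of natural numbers. -/
lemma exists_le_le_sum_eq {ι : Type*} [Fintype ι] {lo hi : ι → ℕ} (h : ∀ i, lo i ≤ hi i) {R : ℕ}
    (h1 : ∑ i, lo i ≤ R) (h2 : R ≤ ∑ i, hi i) :
    ∃ r : ι → ℕ, (∀ i, lo i ≤ r i) ∧ (∀ i, r i ≤ hi i) ∧ ∑ i, r i = R := by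
  classical
  induction R, h1 using Nat.le_induction with
  | base => exact ⟨lo, fun _ => le_rfl, h, rfl⟩
  | succ R _ ih =>
    obtain ⟨r, hr1, hr2, hr3⟩ := ih (by omega)
    obtain ⟨i, -, hi'⟩ := Finset.exists_lt_of_sum_lt (s := Finset.univ) (f := r) (g := hi) (by omega)
    refine ⟨fun j => r j + if j = i then 1 else 0, fun j => (hr1 j).trans (Nat.le_add_right _ _),
      fun j => ?_, by simp [Finset.sum_add_distrib, hr3]⟩
    by_cases hj : j = i
    · subst hj; simpa using hi'
    · simpa [hj] using hr2 j

variable {n : ℕ} {d s : Fin n → ℕ}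

/-- The polytope `P` has the integer decomposition property: a lattice point can be split off from
a lattice point of `(h + 1) P`. -/
lemma exists_latticeExp_add (h : ℕ) (m : (Σ i : Fin n, Fin (d i)) →₀ ℕ)
    (h1 : ∀ i, ∑ j, m ⟨i, j⟩ ≤ (h + 1) * s i) (h2 : 2 * (h + 1) ≤ ∑ q, m q) :
    ∃ (p : LatticePoint d s) (m' : (Σ i : Fin n, Fin (d i)) →₀ ℕ), latticeExp p + m' = m ∧
      (∀ i, ∑ j, m' ⟨i, j⟩ ≤ h * s i) ∧ 2 * h ≤ ∑ q, m' q := by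
  let a : Fin n → ℕ := fun i => ∑ j, m ⟨i, j⟩
  have ha (i) : a i ≤ h * s i + s i := by rw [← Nat.succ_mul]; exact h1 i
  rw [Fintype.sum_sigma] at h2
  change _ ≤ ∑ i, a i at h2
  -- Bounds for the row sums of the point to be split off: at least `lo i`, so that the remainder
  -- satisfies the row bounds of `h P`, and at most `hi i`, so that the point fits into `m` and into
  -- `P`.
  let lo : Fin n → ℕ := fun i => a i - h * s i
  let hi : Fin n → ℕ := fun i => min (s i) (a i)
  have hlohi (i) : lo i ≤ hi i := by have := ha i; simp only [lo, hi]; omega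
  have hhi : 2 ≤ ∑ i, hi i := by
    have h3 : ∑ i, a i ≤ (h + 1) * ∑ i, hi i := by
      rw [Finset.mul_sum]
      refine Finset.sum_le_sum fun i _ => ?_
      simp only [hi]
      rcases min_cases (s i) (a i) with ⟨h4, -⟩ | ⟨h4, -⟩ <;> rw [h4]
      · exact h1 i
      · exact Nat.le_mul_of_pos_left _ (Nat.succ_pos h)
    by_contra h4
    have h5 : (h + 1) * ∑ i, hi i ≤ (h + 1) * 1 := Nat.mul_le_mul_left _ (by omega)
    omega
  -- If `lo i` is positive, then `a i = h * s i + lo i` with `lo i ≤ s i`; so `(h + 1) * lo i ≤ a i`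
  -- in every row.
  have hlo : h * ∑ i, lo i + ∑ i, lo i ≤ ∑ i, a i := by
    rw [Finset.mul_sum, ← Finset.sum_add_distrib]
    refine Finset.sum_le_sum fun i _ => ?_
    by_cases h3 : a i ≤ h * s i
    · simp [lo, Nat.sub_eq_zero_of_le h3]
    · have h4 : h * lo i ≤ h * s i :=
        Nat.mul_le_mul_left _ ((hlohi i).trans (min_le_left _ _))
      have h5 : lo i = a i - h * s i := rfl
      omega
  have hR : max 2 (∑ i, lo i) + 2 * h ≤ ∑ i, a i := by
    rcases le_total 2 (∑ i, lo i) with h3 | h3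
    · have h4 : h * 2 ≤ h * ∑ i, lo i := Nat.mul_le_mul_left _ h3
      rw [max_eq_right h3]
      omega
    · rw [max_eq_left h3]
      omega
  -- The split-off total is the smallest one allowed, `max 2 (∑ lo)`, so that at least `2 * h`
  -- remains.
  obtain ⟨r, hr1, hr2, hr3⟩ := exists_le_le_sum_eq hlohi (le_max_right 2 _)
    (max_le hhi (Finset.sum_le_sum fun i _ => hlohi i))
  have hrow (i) : ∃ f : Fin (d i) → ℕ, (∀ j, 0 ≤ f j) ∧ (∀ j, f j ≤ m ⟨i, j⟩) ∧ ∑ j, f j = r i :=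
    exists_le_le_sum_eq (fun j => Nat.zero_le _) (by simp) ((hr2 i).trans (min_le_right _ _))
  choose f _ hf1 hf2 using hrow
  let m1 : (Σ i : Fin n, Fin (d i)) →₀ ℕ := Finsupp.equivFunOnFinite.symm fun q => f q.1 q.2
  have hm1 : m1 ≤ m := fun q => hf1 q.1 q.2
  obtain ⟨p, hp⟩ : m1 ∈ Set.range (latticeExp (d := d) (s := s)) := by
    rw [mem_range_latticeExp, Fintype.sum_sigma]
    refine ⟨fun i => (hf2 i).trans_le ((hr2 i).trans (min_le_left _ _)), ?_⟩
    have : ∑ i, ∑ j, m1 ⟨i, j⟩ = ∑ i, r i := Finset.sum_congr rfl fun i _ => hf2 i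
    rw [this, hr3]
    exact le_max_left _ _
  have hsum (i) : r i + ∑ j, (m - m1) ⟨i, j⟩ = a i := by
    rw [← hf2 i, ← Finset.sum_add_distrib]
    exact Finset.sum_congr rfl fun j _ => Nat.add_sub_cancel' (hf1 i j)
  refine ⟨p, m - m1, by rw [hp, add_tsub_cancel_of_le hm1], fun i => ?_, ?_⟩
  · have h3 := hsum i
    have h4 : a i - h * s i ≤ r i := hr1 i
    omega
  · rw [Fintype.sum_sigma]
    have h3 : ∑ i, r i + ∑ i, ∑ j, (m - m1) ⟨i, j⟩ = ∑ i, a i := by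
      rw [← Finset.sum_add_distrib]
      exact Finset.sum_congr rfl fun i _ => hsum i
    omega

/-- Repeated splitting writes a lattice point of `h P` as a sum of `h` lattice points of `P`. The
element `e` records the height: it is the exponent of `T` for the secant variety and `0` for the
tangential variety. -/
lemma nsmul_add_map_mem {M : Type*} [AddCommMonoid M] (e : M)
    (g : ((Σ i : Fin n, Fin (d i)) →₀ ℕ) →+ M) (N : AddSubmonoid M)
    (hN : ∀ p : LatticePoint d s, e + g (latticeExp p) ∈ N) (h : ℕ)
    (m : (Σ i : Fin n, Fin (d i)) →₀ ℕ) (h1 : ∀ i, ∑ j, m ⟨i, j⟩ ≤ h * s i)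
    (h2 : 2 * h ≤ ∑ q, m q) : h • e + g m ∈ N := by
  induction h generalizing m with
  | zero =>
    have : m = 0 := by
      ext ⟨i, j⟩
      have h3 := h1 i
      rw [zero_mul, Nat.le_zero, Finset.sum_eq_zero_iff] at h3
      exact h3 j (Finset.mem_univ j)
    rw [this, zero_smul, map_zero, zero_add]
    exact zero_mem N
  | succ h ih =>
    obtain ⟨p, m', rfl, h3, h4⟩ := exists_latticeExp_add h m h1 h2
    have := add_mem (hN p) (ih m' h3 h4)
    rw [map_add, succ_nsmul']
    rwa [add_add_add_comm] at this

/-- A submonoid that contains the exponents of the first group of variables is determined by the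
exponents in the second group. -/
lemma mem_of_inr_eq {σ τ : Type*} [Fintype σ] {N : AddSubmonoid (σ ⊕ τ →₀ ℕ)}
    (hN : ∀ q, Finsupp.single (Sum.inl q) 1 ∈ N) {m m' : σ ⊕ τ →₀ ℕ} (hm' : m' ∈ N)
    (h0 : ∀ q, m' (Sum.inl q) = 0) (h1 : ∀ q, m' (Sum.inr q) = m (Sum.inr q)) : m ∈ N := by
  classical
  have : m = ∑ q, m (Sum.inl q) • Finsupp.single (Sum.inl q) 1 + m' := by
    ext (q | q)
    · simp [Finsupp.single_apply, h0]
    · simp [h1]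
  rw [this]
  exact add_mem (sum_mem fun q _ => nsmul_mem (hN q) _) hm'

lemma secExp_inr_none (p : LatticePoint d s) : secExp (Sum.inr p) (Sum.inr none) = 1 := by
  rw [secExp, Finsupp.add_apply, Finsupp.single_eq_same, Finsupp.mapDomain_of_notMem_range _ _ (by simp), add_zero]

lemma secExp_inr_some (p : LatticePoint d s) (q : Σ i : Fin n, Fin (d i)) :
    secExp (Sum.inr p) (Sum.inr (some q)) = latticeExp p q := by
  rw [secExp, Finsupp.add_apply, Finsupp.single_eq_of_ne (by simp), zero_add]
  exact Finsupp.mapDomain_apply (Sum.inr_injective.comp (Option.some_injective _)) _ _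

lemma tanExp_inr_inr (p : LatticePoint d s) (q : Σ i : Fin n, Fin (d i)) :
    tanExp (Sum.inr p) (Sum.inr q) = latticeExp p q :=
  Finsupp.mapDomain_apply Sum.inr_injective _ _

variable (s) in
/-- The facets of the cone over `P`. -/
def secWeight : Option (Fin n) →
    ((Σ i : Fin n, Fin (d i)) ⊕ Option (Σ i : Fin n, Fin (d i)) →₀ ℕ) →+ ℤ
  | none =>
    { toFun := fun m => ∑ q, (m (Sum.inr (some q)) : ℤ) - 2 * m (Sum.inr none)
      map_zero' := by simp
      map_add' := fun m m' => by simp [Finset.sum_add_distrib]; ring }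
  | some i =>
    { toFun := fun m => (m (Sum.inr none) : ℤ) * s i - ∑ j, (m (Sum.inr (some ⟨i, j⟩)) : ℤ)
      map_zero' := by simp
      map_add' := fun m m' => by simp [Finset.sum_add_distrib]; ring }

lemma secWeight_none (m : (Σ i : Fin n, Fin (d i)) ⊕ Option (Σ i : Fin n, Fin (d i)) →₀ ℕ) :
    0 ≤ secWeight s none m ↔ 2 * m (Sum.inr none) ≤ ∑ q, m (Sum.inr (some q)) := by
  change 0 ≤ ∑ q, (m (Sum.inr (some q)) : ℤ) - 2 * m (Sum.inr none) ↔ _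
  rw [sub_nonneg]
  exact_mod_cast Iff.rfl

lemma secWeight_some (i : Fin n)
    (m : (Σ i : Fin n, Fin (d i)) ⊕ Option (Σ i : Fin n, Fin (d i)) →₀ ℕ) :
    0 ≤ secWeight s (some i) m ↔
      ∑ j, m (Sum.inr (some ⟨i, j⟩)) ≤ m (Sum.inr none) * s i := by
  change 0 ≤ (m (Sum.inr none) : ℤ) * s i - ∑ j, (m (Sum.inr (some ⟨i, j⟩)) : ℤ) ↔ _
  rw [sub_nonneg]
  exact_mod_cast Iff.rfl

lemma weight_nonneg_of_mem_closure {ι τ : Type*} {G : Set (τ →₀ ℕ)} (w : ι → (τ →₀ ℕ) →+ ℤ)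
    (hG : ∀ m ∈ G, ∀ i, 0 ≤ w i m) {m : τ →₀ ℕ} (hm : m ∈ AddSubmonoid.closure G) (i : ι) :
    0 ≤ w i m := by
  induction hm using AddSubmonoid.closure_induction with
  | mem m hm => exact hG m hm i
  | zero => rw [map_zero]
  | add a b _ _ ha hb => rw [map_add]; exact add_nonneg ha hb

/-- The exponent of `T` is the height at which the `u`-exponent is to be decomposed, and the
inequalities say that this exponent lies in the corresponding multiple of `P`. The variables `μ` are
free. -/
lemma mem_closure_range_secExp
    {m : (Σ i : Fin n, Fin (d i)) ⊕ Option (Σ i : Fin n, Fin (d i)) →₀ ℕ} :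
    m ∈ AddSubmonoid.closure (Set.range (secExp (d := d) (s := s))) ↔
      ∀ i, 0 ≤ secWeight s i m := by
  constructor
  · refine weight_nonneg_of_mem_closure _ ?_
    rintro _ ⟨q | p, rfl⟩ (_ | i)
    · rw [secWeight_none]; simp [secExp]
    · rw [secWeight_some]; simp [secExp]
    · rw [secWeight_none]
      simp only [secExp_inr_none, secExp_inr_some, mul_one]
      exact (mem_range_latticeExp.1 ⟨p, rfl⟩).2
    · rw [secWeight_some]
      simp only [secExp_inr_none, secExp_inr_some, one_mul]
      exact (mem_range_latticeExp.1 ⟨p, rfl⟩).1 i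
  · intro h
    let m2 : (Σ i : Fin n, Fin (d i)) →₀ ℕ :=
      Finsupp.equivFunOnFinite.symm fun q => m (Sum.inr (some q))
    have key := nsmul_add_map_mem (s := s) (Finsupp.single (Sum.inr none) 1)
      (Finsupp.mapDomain.addMonoidHom (Sum.inr ∘ some))
      (AddSubmonoid.closure (Set.range (secExp (d := d) (s := s))))
      (fun p => AddSubmonoid.subset_closure (Set.mem_range_self (Sum.inr p))) (m (Sum.inr none)) m2
      (fun i => (secWeight_some i m).1 (h (some i))) ((secWeight_none m).1 (h none))
    refine mem_of_inr_eq (fun q => AddSubmonoid.subset_closure (Set.mem_range_self (Sum.inl q))) key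
      (fun q => ?_) ?_
    · rw [Finsupp.add_apply, Finsupp.mapDomain.addMonoidHom_apply,
        Finsupp.mapDomain_of_notMem_range _ _ (by simp)]
      simp
    · rintro (_ | q)
      · rw [Finsupp.add_apply, Finsupp.mapDomain.addMonoidHom_apply,
          Finsupp.mapDomain_of_notMem_range _ _ (by simp)]
        simp
      · rw [Finsupp.add_apply, Finsupp.mapDomain.addMonoidHom_apply]
        refine (congrArg₂ (· + ·) ?_ (Finsupp.mapDomain_apply
          (Sum.inr_injective.comp (Option.some_injective _)) m2 q)).trans (zero_add _)
        simp

/-- The inequalities of the cone of the tangential variety of a Segre variety. -/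
def tanWeight (i : Fin n) : ((Σ i : Fin n, Fin (d i)) ⊕ (Σ i : Fin n, Fin (d i)) →₀ ℕ) →+ ℤ where
  toFun := fun m => ∑ q, (m (Sum.inr q) : ℤ) - 2 * ∑ j, (m (Sum.inr ⟨i, j⟩) : ℤ)
  map_zero' := by simp
  map_add' := fun m m' => by simp [Finset.sum_add_distrib]; ring

lemma tanWeight_nonneg (i : Fin n)
    (m : (Σ i : Fin n, Fin (d i)) ⊕ (Σ i : Fin n, Fin (d i)) →₀ ℕ) :
    0 ≤ tanWeight i m ↔ 2 * ∑ j, m (Sum.inr ⟨i, j⟩) ≤ ∑ q, m (Sum.inr q) := by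
  change 0 ≤ ∑ q, (m (Sum.inr q) : ℤ) - 2 * ∑ j, (m (Sum.inr ⟨i, j⟩) : ℤ) ↔ _
  rw [sub_nonneg]
  exact_mod_cast Iff.rfl

/-- Here no coordinate records the height, so one has to be found. When every `s i` is `1`, a height
`r` works if it lies between the largest row sum and half of the total, and the inequalities say
that this interval is nonempty. -/
lemma mem_closure_range_tanExp (hs : ∀ i, s i = 1)
    {m : (Σ i : Fin n, Fin (d i)) ⊕ (Σ i : Fin n, Fin (d i)) →₀ ℕ} :
    m ∈ AddSubmonoid.closure (Set.range (tanExp (d := d) (s := s))) ↔ ∀ i, 0 ≤ tanWeight i m := by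
  constructor
  · refine weight_nonneg_of_mem_closure _ ?_
    rintro _ ⟨q | p, rfl⟩ i <;> rw [tanWeight_nonneg]
    · simp [tanExp]
    · simp only [tanExp_inr_inr]
      have h1 := mem_range_latticeExp.1 ⟨p, rfl⟩
      have h2 := h1.1 i
      rw [hs i] at h2
      have h3 := h1.2
      omega
  · intro h
    let m2 : (Σ i : Fin n, Fin (d i)) →₀ ℕ :=
      Finsupp.equivFunOnFinite.symm fun q => m (Sum.inr q)
    -- The smallest admissible height; integrality of the row sums lets it lie below the
    -- rounded-down half of the total.
    let r : ℕ := Finset.univ.sup fun i => ∑ j, m2 ⟨i, j⟩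
    have hr : r ≤ (∑ q, m2 q) / 2 := Finset.sup_le fun i _ => by
      have : 2 * ∑ j, m2 ⟨i, j⟩ ≤ ∑ q, m2 q := (tanWeight_nonneg i m).1 (h i)
      omega
    have key := nsmul_add_map_mem (s := s) 0
      (Finsupp.mapDomain.addMonoidHom Sum.inr)
      (AddSubmonoid.closure (Set.range (tanExp (d := d) (s := s))))
      (fun p => by
        rw [zero_add]
        exact AddSubmonoid.subset_closure (Set.mem_range_self (Sum.inr p))) r m2
      (fun i => by
        rw [hs i, mul_one]
        exact Finset.le_sup (f := fun i => ∑ j, m2 ⟨i, j⟩) (Finset.mem_univ i)) (by omega)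
    rw [smul_zero, zero_add] at key
    refine mem_of_inr_eq (fun q => AddSubmonoid.subset_closure (Set.mem_range_self (Sum.inl q))) key
      (fun q => ?_) fun q => Finsupp.mapDomain_apply Sum.inr_injective m2 q
    exact Finsupp.mapDomain_of_notMem_range _ _ (by simp)

end Normality

/-! ### Structure of the charts -/

section Charts

variable {k : Type u} [Field k]

lemma isNondegenerate_of_monomialAlgebra {τ : Type} {G : Set (τ →₀ ℕ)} {R : Type u} [CommRing R]
    [Algebra k R] (e : R ≃ₐ[k] monomialAlgebra k G) : IsNondegenerate k R :=
  isNondegenerate_of_injective ((monomialAlgebra k G).val.comp e.toAlgHom)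
    (Subtype.val_injective.comp e.injective)

lemma not_hasTorusFactor_of_monomialAlgebra {τ : Type} {G : Set (τ →₀ ℕ)} {R : Type u} [CommRing R]
    [Algebra k R] (e : R ≃ₐ[k] monomialAlgebra k G) : ¬ HasTorusFactor k R := by
  have : Nontrivial R := e.toEquiv.nontrivial
  exact not_hasTorusFactor (isNondegenerate_of_monomialAlgebra e)

/-- A tuple of nonzero linear forms is dual to the first vectors of suitable bases. -/
lemma exists_bases {n : ℕ} {V : Fin n → Type u} [∀ i, AddCommGroup (V i)] [∀ i, Module k (V i)]
    [∀ i, FiniteDimensional k (V i)] {d : Fin n → ℕ} (hd : ∀ i, Module.finrank k (V i) = d i + 1)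
    {φ : ∀ i, Module.Dual k (V i)} (hφ : ∀ i, φ i ≠ 0) :
    ∃ b : ∀ i, Module.Basis (Fin (d i + 1)) k (V i), φ = fun i => (b i).coord 0 := by
  have h (i) : ∃ b : Module.Basis (Fin (d i + 1)) k (V i), b.coord 0 = φ i := by
    obtain ⟨x, hx⟩ : ∃ x, φ i x ≠ 0 := by
      by_contra! h0
      exact hφ i (LinearMap.ext h0)
    obtain ⟨b, -, hb⟩ := exists_basis_cons (hd i) (φ i) ((φ i x)⁻¹ • x)
      (by rw [map_smul, smul_eq_mul, inv_mul_cancel₀ hx])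
    exact ⟨b, hb⟩
  choose b hb using h
  exact ⟨b, funext fun i => (hb i).symm⟩

end Charts

end SegreVeronese

end

open SegreVeronese in
theorem mainTheorem3 {k : Type u} [Field k] [IsAlgClosed k] [CharZero k] {n : ℕ}
    (V : Fin n → Type u) [∀ i, AddCommGroup (V i)] [∀ i, Module k (V i)]
    [∀ i, FiniteDimensional k (V i)]
    (s : Fin n → ℕ) (hs : ∀ i, 0 < s i)
    (d : Fin n → ℕ) (hd : ∀ i, Module.finrank k (V i) = d i + 1) :
    -- finitely many complements of hyperplane sections cover both varieties
    (∃ Φ : Finset (∀ i, Module.Dual k (V i)), (∀ φ ∈ Φ, ∀ i, φ i ≠ 0) ∧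
      secantVariety (segreVeronese k V s) =
        ⋃ φ ∈ Φ, hyperplaneCompl (secantVariety (segreVeronese k V s)) (powerForm s φ) ∧
      tangentialVariety (segreVeronese k V s) =
        ⋃ φ ∈ Φ, hyperplaneCompl (tangentialVariety (segreVeronese k V s)) (powerForm s φ)) ∧
    -- the charts of the secant variety
    (∀ φ : ∀ i, Module.Dual k (V i), (∀ i, φ i ≠ 0) →
      IsAffineToric k (chartRing (secantVariety (segreVeronese k V s)) (powerForm s φ)) ∧
      ¬ HasTorusFactor k (chartRing (secantVariety (segreVeronese k V s)) (powerForm s φ)) ∧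
      IsIntegrallyClosed (chartRing (secantVariety (segreVeronese k V s)) (powerForm s φ)) ∧
      Nonempty (chartRing (secantVariety (segreVeronese k V s)) (powerForm s φ) ≃ₐ[k]
        coordRing k ((Set.univ : Set (Fin (∑ i, d i) → k)) ×ˢ affineCone (projToric d s k)))) ∧
    -- the charts of the tangential variety
    (∀ φ : ∀ i, Module.Dual k (V i), (∀ i, φ i ≠ 0) →
      IsAffineToric k (chartRing (tangentialVariety (segreVeronese k V s)) (powerForm s φ)) ∧
      ¬ HasTorusFactor k (chartRing (tangentialVariety (segreVeronese k V s)) (powerForm s φ)) ∧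
      ((∀ i, s i = 1) →
        IsIntegrallyClosed (chartRing (tangentialVariety (segreVeronese k V s)) (powerForm s φ))) ∧
      Nonempty (chartRing (tangentialVariety (segreVeronese k V s)) (powerForm s φ) ≃ₐ[k]
        coordRing k ((Set.univ : Set (Fin (∑ i, d i) → k)) ×ˢ affineToric d s k))) ∧
    -- the factor `X'_P` is a nondegenerate affine toric variety
    IsAffineToric k (coordRing k (affineToric d s k)) ∧
    IsNondegenerate k (coordRing k (affineToric d s k)) := by
  obtain ⟨eT⟩ := nonempty_affineToric_equiv (k := k) (d := d) (s := s)
  refine ⟨exists_finset_cover hd, fun φ hφ => ?_, fun φ hφ => ?_,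
    isAffineToric_of_monomialAlgebra (Set.finite_range _) eT.symm,
    isNondegenerate_of_monomialAlgebra eT⟩
  · obtain ⟨b, rfl⟩ := exists_bases hd hφ
    obtain ⟨e⟩ := nonempty_secant_chart_equiv b hs
    obtain ⟨e'⟩ := nonempty_prod_cone_equiv (k := k) (d := d) (s := s)
    have := isIntegrallyClosed_monomialAlgebra (k := k) _
      fun _ => mem_closure_range_secExp (d := d) (s := s)
    exact ⟨isAffineToric_of_monomialAlgebra (Set.finite_range _) e.symm,
      not_hasTorusFactor_of_monomialAlgebra e, IsIntegrallyClosed.of_equiv e.symm.toRingEquiv,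
      ⟨e.trans e'.symm⟩⟩
  · obtain ⟨b, rfl⟩ := exists_bases hd hφ
    obtain ⟨e⟩ := nonempty_tangent_chart_equiv b hs
    obtain ⟨e'⟩ := nonempty_prod_affineToric_equiv (k := k) (d := d) (s := s)
    refine ⟨isAffineToric_of_monomialAlgebra (Set.finite_range _) e.symm,
      not_hasTorusFactor_of_monomialAlgebra e, fun hs1 => ?_, ⟨e.trans e'.symm⟩⟩
    have := isIntegrallyClosed_monomialAlgebra (k := k) _
      fun _ => mem_closure_range_tanExp (d := d) hs1
    exact IsIntegrallyClosed.of_equiv e.symm.toRingEquiv
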